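/- Let $\varphi$ be a monotone CNF in variables $x_1,\dots,x_n$, regarded as a finite set of clauses (each a set of variables), and let $\|\varphi\|$ be its length, i.e. its number of literal occurrences. $\varphi$ is prime if each of its clauses is a prime implicate of the function $f$ it represents. For an ordering $y_1,\dots,y_n$ of the variables let $\varphi_i$ be the CNF obtained from $\varphi$ by fixing $y_j=1$ for all $j\ge i+1$ (clauses containing a fixed variable disappear), and let $\Delta^i$ be the set of clauses of $\varphi_i$ that are not in $\varphi_{i-1}$. $\varphi$ is $k$-degenerate if for some ordering of the variables $|\Delta^i|\le k$ for all $i=1,\dots,n$. Problem Dualization: given the prime CNF $\varphi$ of a monotone Boolean function $f$, output the clauses of the prime CNF of the dual function $f^d(x)=\overline{f(\overline{x})}$ (equivalently, the prime implicants of $f$), each exactly once. Theorem. For every constant $k\ge 1$ there are an algorithm (a program for a unit-cost random access machine whose only arithmetic is successor and predecessor) and a constant $C$, both depending on $k$ only, such that on every $k$-degenerate prime monotone CNF $\varphi$ in which all of its $n$ variables occur, given as a list of its clauses in arbitrary order, the algorithm solves Dualization with delay at most $C\cdot(\|\varphi\|\cdot n^{k+1}+1)$: at most that many steps pass before the first clause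 is output, between the outputs of two consecutive clauses, and between the last output and the halt (between the start and the halt if there is no output). (The summand $1$ matters only for the constant CNFs, $n=0$.) Hence Dualization for $k$-degenerate CNFs is solvable with $O(\|\varphi\|\cdot n^{k+1})$ polynomial delay. -/

import Mathlib

namespace Dualization

/-! ### Boolean functions, clauses, monotone CNFs -/

/-- Boolean functions of `n` variables, ordered pointwise (`false ≤ true`). -/
abbrev BoolFn (n : ℕ) := (Fin n → Bool) → Bool

/-- The function represented by the clause with positive literals `P` and negative literals `N`. -/
def clauseFn {n : ℕ} (P N : Finset (Fin n)) : BoolFn n :=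
  fun v => decide ((∃ i ∈ P, v i = true) ∨ (∃ i ∈ N, v i = false))

/-- The monotone clause `c` (the disjunction of the variables in `c`) is a prime implicate of `f`:
it is an implicate, and no clause (monotone or not, with at most one of `xᵢ`, `¬ xᵢ` for
each `i`) that is an implicate of `f` is strictly smaller. -/
def IsPrimeImplicate {n : ℕ} (f : BoolFn n) (c : Finset (Fin n)) : Prop :=
  f ≤ clauseFn c ∅ ∧
    ∀ P N : Finset (Fin n), Disjoint P N → f ≤ clauseFn P N → ¬ clauseFn P N < clauseFn c ∅

/-- A monotone CNF, as a finite set of monotone clauses, each clause a finite set of variables. -/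
abbrev MonotoneCNF (n : ℕ) := Finset (Finset (Fin n))

/-- The function represented by a monotone CNF. -/
def cnfFn {n : ℕ} (φ : MonotoneCNF n) : BoolFn n :=
  fun v => decide (∀ c ∈ φ, clauseFn c ∅ v = true)

/-- `φ` is the prime CNF of `f`: it represents `f`, and its clauses are exactly the prime implicates
of `f`. (All prime implicates of a monotone `f` are monotone.) -/
def IsPrimeCNFOf {n : ℕ} (φ : MonotoneCNF n) (f : BoolFn n) : Prop :=
  cnfFn φ = f ∧ ∀ c : Finset (Fin n), c ∈ φ ↔ IsPrimeImplicate f c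

/-- `φ` is prime: all its clauses are prime implicates of the function it represents. -/
def IsPrime {n : ℕ} (φ : MonotoneCNF n) : Prop := ∀ c ∈ φ, IsPrimeImplicate (cnfFn φ) c

/-- The dual function `v ↦ ¬ f (¬ v)`. -/
def dual {n : ℕ} (f : BoolFn n) : BoolFn n := fun v => !f (fun i => !v i)

/-- The length of `φ`: its number of literal occurrences. -/
def length {n : ℕ} (φ : MonotoneCNF n) : ℕ := ∑ c ∈ φ, c.card

/-- Every one of the `n` variables occurs in `φ`. -/
def AllOccur {n : ℕ} (φ : MonotoneCNF n) : Prop := ∀ v : Fin n, ∃ c ∈ φ, v ∈ c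

/-! ### Degeneracy

A variable ordering is a permutation `x` of `Fin n`; since positions are counted from `0`,
the variables in order are `x 0, …, x (n - 1)`. -/

/-- The CNF obtained from `φ` by fixing to `1` all variables but the first `i` ones
in the ordering `x`: the clauses containing a fixed variable disappear. -/
def fixTail {n : ℕ} (φ : MonotoneCNF n) (x : Equiv.Perm (Fin n)) (i : ℕ) : MonotoneCNF n :=
  φ.filter (fun c => ∀ j : Fin n, i ≤ (j : ℕ) → x j ∉ c)

/-- The clauses that belong to the CNF on the first `i + 1` variables but not to the CNF on
the first `i` variables. -/
def Delta {n : ℕ} (φ : MonotoneCNF n) (x : Equiv.Perm (Fin n)) (i : Fin n) : MonotoneCNF n :=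
  fixTail φ x ((i : ℕ) + 1) \ fixTail φ x (i : ℕ)

/-- `φ` is `k`-degenerate. -/
def IsDegenerate {n : ℕ} (k : ℕ) (φ : MonotoneCNF n) : Prop :=
  ∃ x : Equiv.Perm (Fin n), ∀ i : Fin n, (Delta φ x i).card ≤ k

/-! ### Machine model

Structured programs for a unit-cost random access machine whose only arithmetic is successor and
predecessor. The memory consists of arrays of natural numbers `σ a 0, σ a 1, …`, one for each
name `a`; a program is a finite text and mentions finitely many names. As numbers grow by at most
a constant in each step, they have `O(log (N + t))` bits after `t` steps on an input of
length and entries at most `N`. -/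

/-- Memory contents: `σ a i` is the entry number `i` of the array `a`. -/
abbrev Memory := ℕ → ℕ → ℕ

inductive Expr : Type
  | const (c : ℕ) : Expr
  /-- `get a e` reads the entry of the array `a` whose index is the value of `e`. -/
  | get (a : ℕ) (e : Expr) : Expr
  | succ (e : Expr) : Expr
  | pred (e : Expr) : Expr

def Expr.eval (σ : Memory) : Expr → ℕ
  | .const c => c
  | .get a e => σ a (e.eval σ)
  | .succ e => e.eval σ + 1
  | .pred e => e.eval σ - 1

inductive Test : Type
  | lt (e₁ e₂ : Expr) : Test
  | eq (e₁ e₂ : Expr) : Test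
  | not (b : Test) : Test
  | and (b₁ b₂ : Test) : Test

def Test.eval (σ : Memory) : Test → Bool
  | .lt e₁ e₂ => decide (e₁.eval σ < e₂.eval σ)
  | .eq e₁ e₂ => decide (e₁.eval σ = e₂.eval σ)
  | .not b => !b.eval σ
  | .and b₁ b₂ => b₁.eval σ && b₂.eval σ

inductive Program : Type
  | skip : Program
  /-- `a[i] := e` -/
  | assign (a : ℕ) (i e : Expr) : Program
  | seq (p q : Program) : Program
  | ite (b : Test) (p q : Program) : Program
  | while (b : Test) (p : Program) : Program
  /-- Write the value of `e` on the output. -/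
  | write (e : Expr) : Program
  /-- Declare the current output item complete. -/
  | endItem : Program

/-- What can be observed of one step of a run. Every event takes exactly one unit of time. -/
inductive Event : Type
  | silent : Event
  | symbol (v : ℕ) : Event
  | itemEnd : Event

/-- `Run p σ σ' tr`: the program `p`, started with memory `σ`, halts with memory `σ'`, and
`tr` is its sequence of steps. Each assignment, each evaluation of a test and each output
operation is one step (expressions have constant size in a fixed program). -/
inductive Run : Program → Memory → Memory → List Event → Prop
  | skip (σ : Memory) : Run .skip σ σ [.silent]
  | assign (σ : Memory) (a : ℕ) (i e : Expr) :
      Run (.assign a i e) σ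
        (Function.update σ a (Function.update (σ a) (i.eval σ) (e.eval σ))) [.silent]
  | seq {p q : Program} {σ σ' σ'' : Memory} {tr tr' : List Event} :
      Run p σ σ' tr → Run q σ' σ'' tr' → Run (.seq p q) σ σ'' (tr ++ tr')
  | ite_true {b : Test} {p q : Program} {σ σ' : Memory} {tr : List Event} :
      b.eval σ = true → Run p σ σ' tr → Run (.ite b p q) σ σ' (.silent :: tr)
  | ite_false {b : Test} {p q : Program} {σ σ' : Memory} {tr : List Event} :
      b.eval σ = false → Run q σ σ' tr → Run (.ite b p q) σ σ' (.silent :: tr)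
  | while_true {b : Test} {p : Program} {σ σ' σ'' : Memory} {tr tr' : List Event} :
      b.eval σ = true → Run p σ σ' tr → Run (.while b p) σ' σ'' tr' →
        Run (.while b p) σ σ'' (.silent :: (tr ++ tr'))
  | while_false {b : Test} {p : Program} {σ : Memory} :
      b.eval σ = false → Run (.while b p) σ σ [.silent]
  | write (σ : Memory) (e : Expr) : Run (.write e) σ σ [.symbol (e.eval σ)]
  | endItem (σ : Memory) : Run .endItem σ σ [.itemEnd]

/-- The memory at the start: the input word in array `0`, zeros elsewhere. -/
def initial (w : List ℕ) : Memory := fun a i => if a = 0 then w.getD i 0 else 0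

/-- The sequence of numbers written during a sequence of steps. -/
def symbols (tr : List Event) : List ℕ :=
  tr.filterMap (fun
    | .symbol v => some v
    | _ => none)

/-- The steps `tr` of a halting run output exactly the items `items`, in this order, with delay at
most `D`: at most `D` steps pass until the first item is complete, from the completion of an item
to the completion of the next one, and from the completion of the last item
(from the start, if there is none) until the machine halts. -/
def OutputsWithDelay (D : ℕ) (tr : List Event) (items : List (List ℕ)) : Prop :=
  ∃ (blocks : List (List Event)) (rest : List Event),
    tr = (blocks.map (fun b => b ++ [Event.itemEnd])).flatten ++ rest ∧
    (∀ b ∈ blocks, Event.itemEnd ∉ b ∧ b.length + 1 ≤ D) ∧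
    (Event.itemEnd ∉ rest ∧ rest.length ≤ D) ∧
    blocks.map symbols = items ∧ symbols rest = []

/-! ### The problem Dualization -/

/-- The list `L` lists the clauses of `φ`, each once, in some order, and each clause is given as the
list of its variables, each once, in some order. -/
def Lists {n : ℕ} (L : List (List (Fin n))) (φ : MonotoneCNF n) : Prop :=
  (∀ l ∈ L, l.Nodup) ∧ (L.map List.toFinset).Nodup ∧ (L.map List.toFinset).toFinset = φ

/-- The input word for a listed CNF: the number of variables, the number of clauses, and then for
each clause its number of variables followed by these variables (numbered from `0`). -/
def encode {n : ℕ} (L : List (List (Fin n))) : List ℕ :=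
  n :: L.length :: L.flatMap (fun l => l.length :: l.map Fin.val)

/-- On the input `φ`, in whatever order it is listed, the program `p` outputs one by one, without
repetition, the clauses of the prime CNF of the dual of the function represented by `φ`, and
halts; the delay is at most `D`. -/
def DualizesWithDelay {n : ℕ} (p : Program) (φ : MonotoneCNF n) (D : ℕ) : Prop :=
  ∀ L : List (List (Fin n)), Lists L φ →
    ∃ (σ : Memory) (tr : List Event) (ψ : MonotoneCNF n) (out : List (List (Fin n))),
      Run p (initial (encode L)) σ tr ∧
      IsPrimeCNFOf ψ (dual (cnfFn φ)) ∧ Lists out ψ ∧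
      OutputsWithDelay D tr (out.map (fun l => l.map Fin.val))

end Dualization

namespace Dualization

/-! ### Verification of programs -/

/-! The prime implicants are the minimal transversals of the hypergraph of the clauses
(`isPrimeImplicate_dual`), and these are the leaves at depth `n` of a tree that is searched depth
first.

Degeneracy splits the clauses into layers `0, …, n - 1` of at most `k` clauses each, such that the
clauses of a layer share a vertex lying in no clause of a lower layer. The degenerate ordering
itself need not be known: in every nonempty set of clauses the last variable that occurs has degree
at most `k` (`Lists.lowDegree`), so repeatedly removing any vertex of positive degree at most `k`
yields suitable layers from the top down (`LayersFrom.step`).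

The nodes at depth `i` are the minimal transversals of the layers below `i`. The parent of a node
`T'` at depth `i + 1` is the transversal `T ⊆ T'` of the layers below `i` that minimizes the sum of
`2 ^ u` over `u ∈ T`. The local condition `Greedy` characterizes it: it holds for the minimizer
(`exists_greedy`) and for no other transversal inside `T'` (`Greedy.subset`). Three facts follow.
The elements of `T' \ T` have private clauses in layer `i`, so there are at most `k` of them
(`exists_parent`), and all children arise by adding one of at most `(k + 1) * n ^ k` candidate sets.
Parents are unique, so no leaf occurs twice (`setOf_injective`). Every node above depth `n` has a
child, obtained by adding nothing or the shared vertex of the next layer (`exists_good`), so the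
search never descends into a dead end.

Moving from a leaf to the next one therefore takes at most `n` steps up and `n` steps down. Each
tries at most all candidates, and one trial is linear in `‖φ‖` because `Good` can be decided by
counting marks (`exec_test`). This gives the factor `‖φ‖ * n ^ (k + 1)`.

The programs are verified by Hoare-style rules with time bounds (`Exec`, `exec_while`, `exec_for`)
and a syntactic frame rule (`Run.frame`). `Data.At.run_enumerate` turns the bounds for single moves
into the delay, and `dualize_correct` assembles everything. -/

/-- The memory `σ` after storing `v` in entry `i` of array `a`. -/
def store (σ : Memory) (a i v : ℕ) : Memory := Function.update σ a (Function.update (σ a) i v)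

theorem store_same (σ : Memory) (a i v : ℕ) : store σ a i v a = Function.update (σ a) i v := by
  simp [store]

theorem store_ne {σ : Memory} {a b : ℕ} (h : b ≠ a) (i v : ℕ) : store σ a i v b = σ b := by
  simp [store, h]

/-- `p` writes to the array `a`. -/
def Program.touches : Program → ℕ → Bool
  | .skip, _ => false
  | .assign b _ _, a => a == b
  | .seq p q, a => p.touches a || q.touches a
  | .ite _ p q, a => p.touches a || q.touches a
  | .while _ p, a => p.touches a
  | .write _, _ => false
  | .endItem, _ => false

/-- Since `touches` is a computable Boolean, its hypothesis is proved by `rfl` for concrete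
programs. This is how facts about memory are carried past later code. -/
theorem Run.frame {p : Program} {σ σ' : Memory} {tr : List Event} (h : Run p σ σ' tr) {a : ℕ}
    (ha : p.touches a = false) : σ' a = σ a := by
  induction h with
  | skip | while_false | write | endItem => rfl
  | assign σ b i e =>
    have : a ≠ b := by simpa [Program.touches] using ha
    simp [this]
  | seq _ _ ih ih' =>
    simp only [Program.touches, Bool.or_eq_false_iff] at ha
    rw [ih' ha.2, ih ha.1]
  | ite_true _ _ ih =>
    simp only [Program.touches, Bool.or_eq_false_iff] at ha
    exact ih ha.1
  | ite_false _ _ ih =>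
    simp only [Program.touches, Bool.or_eq_false_iff] at ha
    exact ih ha.2
  | while_true _ _ _ ih ih' => rw [ih' ha, ih ha]

/-- Started with memory `σ`, the program `p` halts after at most `t` steps without any output,
and the final memory satisfies `Q`. -/
def Exec (p : Program) (σ : Memory) (t : ℕ) (Q : Memory → Prop) : Prop :=
  ∃ (σ' : Memory) (tr : List Event), Run p σ σ' tr ∧ (∀ e ∈ tr, e = .silent) ∧ tr.length ≤ t ∧ Q σ'

theorem Exec.mono {p : Program} {σ : Memory} {t t' : ℕ} {Q Q' : Memory → Prop}
    (h : Exec p σ t Q) (ht : t ≤ t') (hQ : ∀ σ', Q σ' → Q' σ') : Exec p σ t' Q' := by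
  obtain ⟨σ', tr, h1, h2, h3, h4⟩ := h
  exact ⟨σ', tr, h1, h2, h3.trans ht, hQ _ h4⟩

theorem Exec.frame {p : Program} {σ : Memory} {t : ℕ} {Q : Memory → Prop} (h : Exec p σ t Q) :
    Exec p σ t (fun σ' => Q σ' ∧ ∀ a, p.touches a = false → σ' a = σ a) := by
  obtain ⟨σ', tr, h1, h2, h3, h4⟩ := h
  exact ⟨σ', tr, h1, h2, h3, h4, fun a ha => h1.frame ha⟩

theorem Exec.seq {p q : Program} {σ : Memory} {t t' : ℕ} {Q R : Memory → Prop}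
    (h : Exec p σ t R)
    (h' : ∀ σ', R σ' → (∀ a, p.touches a = false → σ' a = σ a) → Exec q σ' t' Q) :
    Exec (.seq p q) σ (t + t') Q := by
  obtain ⟨σ', tr, h1, h2, h3, h4⟩ := h
  obtain ⟨σ'', tr', k1, k2, k3, k4⟩ := h' σ' h4 (fun a ha => h1.frame ha)
  refine ⟨σ'', tr ++ tr', h1.seq k1, ?_, ?_, k4⟩
  · intro e he
    rcases List.mem_append.1 he with he | he
    exacts [h2 e he, k2 e he]
  · rw [List.length_append]; omega

theorem Exec.ite {b : Test} {p q : Program} {σ : Memory} {t : ℕ} {Q : Memory → Prop}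
    (h : b.eval σ = true → Exec p σ t Q) (h' : b.eval σ = false → Exec q σ t Q) :
    Exec (.ite b p q) σ (t + 1) Q := by
  cases hb : b.eval σ with
  | true =>
    obtain ⟨σ', tr, h1, h2, h3, h4⟩ := h hb
    exact ⟨σ', _, h1.ite_true hb, by simpa using h2, by simpa using h3, h4⟩
  | false =>
    obtain ⟨σ', tr, h1, h2, h3, h4⟩ := h' hb
    exact ⟨σ', _, h1.ite_false hb, by simpa using h2, by simpa using h3, h4⟩

/-! ### Symbolic execution of loop-free programs, and rules for loops -/

/-- Programs without loops and without output. -/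
def Program.straight : Program → Bool
  | .skip => true
  | .assign _ _ _ => true
  | .seq p q => p.straight && q.straight
  | .ite _ p q => p.straight && q.straight
  | _ => false

/-- The effect of a program without loops. -/
def Program.eff : Program → Memory → Memory
  | .assign a i e, σ => store σ a (i.eval σ) (e.eval σ)
  | .seq p q, σ => q.eff (p.eff σ)
  | .ite b p q, σ => if b.eval σ = true then p.eff σ else q.eff σ
  | _, σ => σ

/-- The largest number of steps of a program without loops. -/
def Program.cost : Program → ℕ
  | .seq p q => p.cost + q.cost
  | .ite _ p q => max p.cost q.cost + 1
  | _ => 1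

theorem exec_straight {p : Program} (hp : p.straight = true) (σ : Memory) :
    Exec p σ p.cost (fun σ' => σ' = p.eff σ) := by
  induction p generalizing σ with
  | skip => exact ⟨σ, _, .skip σ, by simp, by simp [Program.cost], rfl⟩
  | assign a i e => exact ⟨_, _, .assign σ a i e, by simp, by simp [Program.cost], rfl⟩
  | seq p q ihp ihq =>
    simp only [Program.straight, Bool.and_eq_true] at hp
    exact (ihp hp.1 σ).seq fun σ' h _ => by subst h; exact ihq hp.2 _
  | ite b p q ihp ihq =>
    simp only [Program.straight, Bool.and_eq_true] at hp
    refine Exec.ite (fun hb => (ihp hp.1 σ).mono (le_max_left _ _) ?_)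
      (fun hb => (ihq hp.2 σ).mono (le_max_right _ _) ?_)
    · rintro σ' rfl; simp [Program.eff, hb]
    · rintro σ' rfl; simp [Program.eff, hb]
  | _ => simp [Program.straight] at hp

theorem Exec.of_eff {p : Program} {σ : Memory} {t : ℕ} {Q : Memory → Prop}
    (hp : p.straight = true) (ht : p.cost ≤ t) (hQ : Q (p.eff σ)) : Exec p σ t Q :=
  (exec_straight hp σ).mono ht (by rintro _ rfl; exact hQ)

/-- A loop whose number of rounds is bounded by a decreasing measure. -/
theorem exec_while {b : Test} {p : Program} {t : ℕ} (I : ℕ → Memory → Prop)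
    (hstep : ∀ r σ, I r σ → b.eval σ = true → ∃ r', r' < r ∧ Exec p σ t (I r')) :
    ∀ (r : ℕ) (σ : Memory), I r σ →
      Exec (.while b p) σ (r * (t + 1) + 1)
        (fun σ' => b.eval σ' = false ∧ ∃ r', r' ≤ r ∧ I r' σ') := by
  intro r
  induction r using Nat.strong_induction_on with
  | _ r ih =>
    intro σ hI
    cases hb : b.eval σ with
    | false => exact ⟨σ, _, .while_false hb, by simp, by simp, hb, r, le_rfl, hI⟩
    | true =>
      -- The measure is an argument of the invariant and not a function of the memory, so a round
      -- may end at any smaller value.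
      obtain ⟨r', hr, σ', tr, h1, h2, h3, h4⟩ := hstep r σ hI hb
      obtain ⟨σ'', tr', k1, k2, k3, k4, r'', k5, k6⟩ := ih r' hr σ' h4
      refine ⟨σ'', _, .while_true hb h1 k1, ?_, ?_, k4, r'', by omega, k6⟩
      · intro e he
        rcases List.mem_cons.1 he with he | he
        · exact he
        rcases List.mem_append.1 he with he | he
        exacts [h2 e he, k2 e he]
      · have : (r' + 1) * (t + 1) ≤ r * (t + 1) := Nat.mul_le_mul_right _ hr
        simp only [List.length_cons, List.length_append]
        nlinarith

/-- The scalar stored in the array `a`. -/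
def scal (a : ℕ) : Expr := .get a (.const 0)

/-- `for x := 0, …, e - 1 do p`. -/
def forLoop (x : ℕ) (e : Expr) (p : Program) : Program :=
  .seq (.assign x (.const 0) (.const 0))
    (.while (.lt (scal x) e) (.seq p (.assign x (.const 0) (.succ (scal x)))))

theorem exec_for {x : ℕ} {e : Expr} {p : Program} {σ : Memory} {N t : ℕ}
    (I : ℕ → Memory → Prop) (hx : p.touches x = false)
    (h0 : I 0 (store σ x 0 0))
    (he : ∀ σ', (∀ a, (forLoop x e p).touches a = false → σ' a = σ a) → e.eval σ' = N)
    (hp : ∀ j σ', j < N → I j σ' → σ' x 0 = j →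
      (∀ a, (forLoop x e p).touches a = false → σ' a = σ a) →
      Exec p σ' t (fun σ'' => I (j + 1) (store σ'' x 0 (j + 1)))) :
    Exec (forLoop x e p) σ (N * (t + 2) + 2) (I N) := by
  have h1 : Exec (.assign x (.const 0) (.const 0)) σ 1 (fun σ' => σ' = store σ x 0 0) :=
    ⟨_, _, .assign σ x _ _, by simp, by simp, rfl⟩
  have key := h1.seq (q := .while (.lt (scal x) e) (.seq p (.assign x (.const 0) (.succ (scal x)))))
    (t' := N * (t + 2) + 1) (Q := I N) (fun σ1 hσ1 _ => ?_)
  · exact key.mono (by omega) (fun _ h => h)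
  subst hσ1
  set F : Memory → Prop := fun σ' => ∀ a, (forLoop x e p).touches a = false → σ' a = σ a with hF
  have hfr : ∀ a, (forLoop x e p).touches a = false → a ≠ x ∧ p.touches a = false := by
    intro a ha
    simp only [forLoop, Program.touches, Bool.or_eq_false_iff, beq_eq_false_iff_ne] at ha
    exact ⟨ha.1, ha.2.1⟩
  -- The measure `r` is the number of rounds left, so the counter holds `N - r`. Each round pays for
  -- the body, the increment and the test.
  have hw := exec_while (b := .lt (scal x) e)
    (p := .seq p (.assign x (.const 0) (.succ (scal x)))) (t := t + 1)
    (fun r σ' => r ≤ N ∧ I (N - r) σ' ∧ σ' x 0 = N - r ∧ F σ') ?_ N (store σ x 0 0) ?_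
  · refine hw.mono le_rfl ?_
    rintro σ' ⟨hb, r, _, hr, hI, hxr, hFr⟩
    simp only [Test.eval, scal, Expr.eval, he σ' hFr, hxr, decide_eq_false_iff_not, not_lt] at hb
    have hr0 : r = 0 := by omega
    subst hr0
    simpa using hI
  · rintro r σ' ⟨hr, hI, hxr, hFr⟩ hb
    simp only [Test.eval, scal, Expr.eval, he σ' hFr, hxr, decide_eq_true_eq] at hb
    have hr' : N - (r - 1) = N - r + 1 := by omega
    refine ⟨r - 1, by omega, (hp (N - r) σ' hb hI hxr hFr).seq (t' := 1) fun σ2 hI2 hf2 => ?_⟩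
    have hx2 : σ2 x 0 = N - r := by rw [hf2 x hx, hxr]
    refine ⟨_, _, .assign σ2 x _ _, by simp, by simp, by omega, ?_, ?_, ?_⟩
    · rw [hr']
      simpa [store, scal, Expr.eval, hx2] using hI2
    · simp [scal, Expr.eval, hx2, hr']
    · intro a ha
      have := hfr a ha
      simp only [Function.update_of_ne this.1]
      rw [hf2 a this.2, hFr a ha]
  · refine ⟨le_rfl, by simpa using h0, by simp [store], ?_⟩
    intro a ha
    exact store_ne (hfr a ha).1 _ _

/-- The loop rule for bodies without loops. -/
theorem exec_for_straight {x : ℕ} {e : Expr} {p : Program} {σ : Memory} {N : ℕ}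
    (I : ℕ → Memory → Prop) (t : ℕ) (hs : p.straight = true) (hc : p.cost = t)
    (hx : p.touches x = false)
    (h0 : I 0 (store σ x 0 0))
    (he : ∀ σ', (∀ a, (forLoop x e p).touches a = false → σ' a = σ a) → e.eval σ' = N)
    (hp : ∀ j σ', j < N → I j σ' → σ' x 0 = j →
      (∀ a, (forLoop x e p).touches a = false → σ' a = σ a) →
      I (j + 1) (store (p.eff σ') x 0 (j + 1))) :
    Exec (forLoop x e p) σ (N * (t + 2) + 2) (I N) :=
  exec_for I hx h0 he fun j σ' h1 h2 h3 h4 => .of_eff hs hc.le (hp j σ' h1 h2 h3 h4)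

/-! ### Minimal transversals of layered hypergraphs

The edges are `cl c` for `c < m`, and the edge `c` lies in layer `lv c`. -/

/-- `T` is a minimal transversal of the edges in the layers below `i`. -/
def MinTr (m : ℕ) (cl : ℕ → Finset ℕ) (lv : ℕ → ℕ) (i : ℕ) (T : Finset ℕ) : Prop :=
  (∀ c < m, lv c < i → (cl c ∩ T).Nonempty) ∧ ∀ v ∈ T, ∃ c < m, lv c < i ∧ cl c ∩ T = {v}

/-- Every element of `T` has a private edge (among those below layer `i`) in which it is the
smallest element of `T'`. This determines `T` from `T'` among the transversals contained in
`T'`. -/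
def Greedy (m : ℕ) (cl : ℕ → Finset ℕ) (lv : ℕ → ℕ) (i : ℕ) (T T' : Finset ℕ) : Prop :=
  ∀ v ∈ T, ∃ c < m, lv c < i ∧ cl c ∩ T = {v} ∧ ∀ u ∈ cl c ∩ T', v ≤ u

/-- `T ∪ S` is a child of `T`. -/
def Good (m : ℕ) (cl : ℕ → Finset ℕ) (lv : ℕ → ℕ) (i : ℕ) (T S : Finset ℕ) : Prop :=
  Disjoint T S ∧ MinTr m cl lv (i + 1) (T ∪ S) ∧ Greedy m cl lv i T (T ∪ S)

/-- Every layer below `n` has at most `k` edges, and they share a vertex that lies in no edge of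
a lower layer. -/
def Layered (k n m : ℕ) (cl : ℕ → Finset ℕ) (lv : ℕ → ℕ) : Prop :=
  ∀ i < n, ((Finset.range m).filter (fun c => lv c = i)).card ≤ k ∧
    ∃ y < n, ∀ c < m, (lv c = i → y ∈ cl c) ∧ (lv c < i → y ∉ cl c)

variable {k n m : ℕ} {cl : ℕ → Finset ℕ} {lv : ℕ → ℕ}

/-- Let `v` be the largest element in which the two sets differ, say `v ∈ T₁`. The private edge of
`v` is met by `T₂` in some `u ∈ T'`, and `u > v` because `v` is smallest there. By the choice of `v`
also `u ∈ T₁`, so the edge was not private. -/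
theorem Greedy.subset {i : ℕ} {T₁ T₂ T' : Finset ℕ} (h₁ : Greedy m cl lv i T₁ T')
    (h₂ : Greedy m cl lv i T₂ T') (t₁ : ∀ c < m, lv c < i → (cl c ∩ T₁).Nonempty)
    (t₂ : ∀ c < m, lv c < i → (cl c ∩ T₂).Nonempty) (s₁ : T₁ ⊆ T') (s₂ : T₂ ⊆ T') : T₁ = T₂ := by
  by_contra hne
  have hD : (symmDiff T₁ T₂).Nonempty := by
    rw [Finset.nonempty_iff_ne_empty]
    simpa using hne
  obtain ⟨v, hv, hmax⟩ := (symmDiff T₁ T₂).exists_max_image id hD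
  wlog hv1 : v ∈ T₁ ∧ v ∉ T₂ generalizing T₁ T₂
  · refine this h₂ h₁ t₂ t₁ s₂ s₁ (fun h => hne h.symm) (by rwa [symmDiff_comm])
      (by rwa [symmDiff_comm]) (by rwa [symmDiff_comm]) ?_
    rcases Finset.mem_symmDiff.1 hv with h | h
    exacts [absurd h hv1, h]
  obtain ⟨c, hc, hci, hp, hmin⟩ := h₁ v hv1.1
  obtain ⟨u, hu⟩ := t₂ c hc hci
  rw [Finset.mem_inter] at hu
  have hvu := hmin u (Finset.mem_inter.2 ⟨hu.1, s₂ hu.2⟩)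
  have huv : u ≠ v := fun h => hv1.2 (h ▸ hu.2)
  have hu1 : u ∈ T₁ := by
    by_contra hu1
    have := hmax u (Finset.mem_symmDiff.2 (Or.inr ⟨hu.2, hu1⟩))
    simp only [id] at this
    omega
  have : u ∈ cl c ∩ T₁ := Finset.mem_inter.2 ⟨hu.1, hu1⟩
  rw [hp, Finset.mem_singleton] at this
  exact huv this

/-- Among the transversals inside `T'`, the one of least weight `∑ 2 ^ u` works: an offending
element `v` could be exchanged for all smaller elements of `T'`, which together weigh less than `2 ^
v`. -/
theorem exists_greedy {i : ℕ} {T' : Finset ℕ}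
    (h : ∀ c < m, lv c < i → (cl c ∩ T').Nonempty) :
    ∃ T ⊆ T', (∀ c < m, lv c < i → (cl c ∩ T).Nonempty) ∧ Greedy m cl lv i T T' := by
  classical
  obtain ⟨T, hT, hmin⟩ := (T'.powerset.filter
    (fun T => ∀ c < m, lv c < i → (cl c ∩ T).Nonempty)).exists_min_image (fun T => ∑ u ∈ T, 2 ^ u)
    ⟨T', by simpa using h⟩
  rw [Finset.mem_filter, Finset.mem_powerset] at hT
  refine ⟨T, hT.1, hT.2, fun v hv => ?_⟩
  by_contra hno
  push Not at hno
  set R := T.filter (fun u => v < u) ∪ T'.filter (fun u => u < v) with hR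
  -- An edge missed by `R` meets `T` in `v` alone; since `v` is not smallest in it, some smaller
  -- element of `T'` lies in the edge, and that element belongs to `R`.
  have hRt : ∀ c < m, lv c < i → (cl c ∩ R).Nonempty := by
    intro c hc hci
    by_contra hemp
    rw [Finset.not_nonempty_iff_eq_empty] at hemp
    have hnot : ∀ u ∈ cl c, u ∉ R := fun u hu hu' => by
      have := Finset.mem_inter.2 ⟨hu, hu'⟩
      simp [hemp] at this
    have honly : ∀ u ∈ cl c ∩ T, u = v := by
      intro u hu
      rw [Finset.mem_inter] at hu
      have := hnot u hu.1
      simp only [hR, Finset.mem_union, Finset.mem_filter, not_or, not_and, not_lt] at this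
      exact le_antisymm (this.1 hu.2) (this.2 (hT.1 hu.2))
    have hs : cl c ∩ T = {v} := Finset.eq_singleton_iff_nonempty_unique_mem.2
      ⟨hT.2 c hc hci, honly⟩
    obtain ⟨u, hu, huv⟩ := hno c hc hci hs
    rw [Finset.mem_inter] at hu
    exact hnot u hu.1 (by simp [hR, hu.2, huv])
  have hRm := hmin R (by
    rw [Finset.mem_filter, Finset.mem_powerset]
    refine ⟨?_, hRt⟩
    intro u hu
    simp only [hR, Finset.mem_union, Finset.mem_filter] at hu
    rcases hu with hu | hu
    exacts [hT.1 hu.1, hu.1])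
  have h1 : ∑ u ∈ T'.filter (fun u => u < v), 2 ^ u < 2 ^ v :=
    Nat.geomSum_lt le_rfl (by simp)
  have h2 : ∑ u ∈ T.filter (fun u => v < u), 2 ^ u + 2 ^ v ≤ ∑ u ∈ T, 2 ^ u := by
    have hvn : v ∉ T.filter (fun u => v < u) := by simp
    rw [add_comm, ← Finset.sum_insert hvn]
    apply Finset.sum_le_sum_of_subset
    intro u hu
    rcases Finset.mem_insert.1 hu with rfl | hu
    exacts [hv, (Finset.mem_filter.1 hu).1]
  have h3 : ∑ u ∈ R, 2 ^ u ≤ ∑ u ∈ T.filter (fun u => v < u), 2 ^ u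
      + ∑ u ∈ T'.filter (fun u => u < v), 2 ^ u := by
    rw [hR, ← Finset.sum_union_inter]
    exact Nat.le_add_right _ _
  omega

/-- Minimal transversals have children. -/
theorem exists_good (hL : Layered k n m cl lv) (hk : 1 ≤ k) {i : ℕ} (hi : i < n) {T : Finset ℕ}
    (hT : MinTr m cl lv i T) : ∃ S ⊆ Finset.range n, S.card ≤ k ∧ Good m cl lv i T S := by
  obtain ⟨-, y, hy, hyc⟩ := hL i hi
  by_cases hall : ∀ c < m, lv c = i → (cl c ∩ T).Nonempty
  · refine ⟨∅, by simp, by simp, by simp, ?_, ?_⟩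
    · rw [Finset.union_empty]
      refine ⟨fun c hc hci => ?_, fun v hv => ?_⟩
      · rcases (Nat.lt_succ_iff_lt_or_eq.1 hci) with h | h
        exacts [hT.1 c hc h, hall c hc h]
      · obtain ⟨c, hc, hci, h⟩ := hT.2 v hv
        exact ⟨c, hc, by omega, h⟩
    · rw [Finset.union_empty]
      intro v hv
      obtain ⟨c, hc, hci, h⟩ := hT.2 v hv
      refine ⟨c, hc, hci, h, ?_⟩
      rw [h]; simp
  -- Some edge `c₀` of layer `i` is missed by `T`, so the vertex `y` shared by the layer is added.
  -- It lies in no lower edge, hence all private edges of `T` survive, and `c₀` becomes private to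
  -- `y`.
  · push Not at hall
    obtain ⟨c₀, hc₀, hl₀, hn₀⟩ := hall
    have hyT : y ∉ T := by
      intro h
      obtain ⟨c, hc, hci, h⟩ := hT.2 y h
      have : y ∈ cl c ∩ T := by rw [h]; simp
      exact (hyc c hc).2 hci (Finset.mem_inter.1 this).1
    have hlow : ∀ c < m, lv c < i → cl c ∩ (T ∪ {y}) = cl c ∩ T := by
      intro c hc hci
      ext u
      simp only [Finset.mem_inter, Finset.mem_union, Finset.mem_singleton]
      constructor
      · rintro ⟨h1, h2 | rfl⟩
        exacts [⟨h1, h2⟩, absurd h1 ((hyc c hc).2 hci)]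
      · exact fun h => ⟨h.1, Or.inl h.2⟩
    refine ⟨{y}, by simpa using hy, by simpa using hk, by simpa using hyT, ⟨?_, ?_⟩, ?_⟩
    · intro c hc hci
      rcases (Nat.lt_succ_iff_lt_or_eq.1 hci) with h | h
      · rw [hlow c hc h]; exact hT.1 c hc h
      · exact ⟨y, by simp [(hyc c hc).1 h]⟩
    · intro v hv
      rcases Finset.mem_union.1 hv with hv | hv
      · obtain ⟨c, hc, hci, h⟩ := hT.2 v hv
        exact ⟨c, hc, by omega, by rw [hlow c hc hci, h]⟩
      · rw [Finset.mem_singleton] at hv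
        subst hv
        refine ⟨c₀, hc₀, by omega, ?_⟩
        rw [Finset.inter_union_distrib_left, hn₀, Finset.empty_union]
        simp [(hyc c₀ hc₀).1 hl₀]
    · intro v hv
      obtain ⟨c, hc, hci, h⟩ := hT.2 v hv
      refine ⟨c, hc, hci, h, ?_⟩
      rw [hlow c hc hci, h]; simp

/-- Every minimal transversal has a parent. -/
theorem exists_parent (hL : Layered k n m cl lv) {i : ℕ} (hi : i < n) {T' : Finset ℕ}
    (hT' : MinTr m cl lv (i + 1) T') :
    ∃ T S, MinTr m cl lv i T ∧ S.card ≤ k ∧ T ∪ S = T' ∧ Good m cl lv i T S := by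
  obtain ⟨T, hTT, ht, hg⟩ := exists_greedy (fun c hc hci => hT'.1 c hc (Nat.lt_succ_of_lt hci))
  have hu : T ∪ (T' \ T) = T' := Finset.union_sdiff_of_subset hTT
  refine ⟨T, T' \ T, ⟨ht, fun v hv => ?_⟩, ?_, hu, Finset.disjoint_sdiff, by rwa [hu], by rwa [hu]⟩
  · obtain ⟨c, hc, hci, h, -⟩ := hg v hv
    exact ⟨c, hc, hci, h⟩
  · refine le_trans ?_ (hL i hi).1
    -- A private edge of `v ∉ T` cannot lie below layer `i`, because there `T` meets every edge in
    -- another element of `T'`. Private edges of distinct vertices are distinct, so `T' \ T` injects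
    -- into layer `i`.
    have hpr : ∀ v ∈ T' \ T, ∃ c, c ∈ (Finset.range m).filter (fun c => lv c = i) ∧
        cl c ∩ T' = {v} := by
      intro v hv
      rw [Finset.mem_sdiff] at hv
      obtain ⟨c, hc, hci, h⟩ := hT'.2 v hv.1
      refine ⟨c, ?_, h⟩
      rw [Finset.mem_filter, Finset.mem_range]
      refine ⟨hc, ?_⟩
      rcases (Nat.lt_succ_iff_lt_or_eq.1 hci) with hl | hl
      · exfalso
        obtain ⟨u, hu⟩ := ht c hc hl
        rw [Finset.mem_inter] at hu
        have : u ∈ cl c ∩ T' := Finset.mem_inter.2 ⟨hu.1, hTT hu.2⟩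
        rw [h, Finset.mem_singleton] at this
        exact hv.2 (this ▸ hu.2)
      · exact hl
    choose! f hf using hpr
    refine Finset.card_le_card_of_injOn f (fun v hv => (hf v hv).1) ?_
    intro v hv w hw hvw
    have h1 := (hf v hv).2
    rw [hvw, (hf w hw).2] at h1
    simpa using h1.symm

/-! ### Depth-first search -/

/-- A node of a search tree of branching degree at most `M` is given by the list of the choices
made on the path from the root, the last one first. -/
def ValidNode (M : ℕ) (tst : List ℕ → ℕ → Prop) : List ℕ → Prop
  | [] => True
  | x :: st => x < M ∧ tst st x ∧ ValidNode M tst st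

open Classical in
/-- The descendants `r` generations below the node `st`. -/
noncomputable def leaves (M : ℕ) (tst : List ℕ → ℕ → Prop) : ℕ → List ℕ → List (List ℕ)
  | 0, st => [st]
  | r + 1, st => ((List.range' 0 M).filter (fun x => tst st x)).flatMap
      (fun x => leaves M tst r (x :: st))

open Classical in
/-- The leaves at depth `n` that come after the node `st` and its descendants. -/
noncomputable def later (M : ℕ) (tst : List ℕ → ℕ → Prop) (n : ℕ) : List ℕ → List (List ℕ)
  | [] => []
  | x :: st => ((List.range' (x + 1) (M - (x + 1))).filter (fun x => tst st x)).flatMap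
      (fun y => leaves M tst (n - (st.length + 1)) (y :: st)) ++ later M tst n st

variable {M : ℕ} {tst : List ℕ → ℕ → Prop}

theorem mem_leaves {r : ℕ} {s st : List ℕ} (hs : ValidNode M tst s) :
    st ∈ leaves M tst r s ↔ st.length = r + s.length ∧ s <:+ st ∧ ValidNode M tst st := by
  classical
  induction r generalizing s with
  | zero =>
    simp only [leaves, List.mem_singleton, zero_add]
    constructor
    · rintro rfl; exact ⟨rfl, List.suffix_rfl, hs⟩
    · rintro ⟨h1, h2, _⟩; exact (h2.eq_of_length h1.symm).symm
  | succ r ih =>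
    simp only [leaves, List.mem_flatMap, List.mem_filter, List.mem_range'_1, decide_eq_true_eq]
    constructor
    · rintro ⟨x, ⟨⟨_, hx⟩, ht⟩, h⟩
      obtain ⟨h1, h2, h3⟩ := (ih (s := x :: s) ⟨by omega, ht, hs⟩).1 h
      refine ⟨by simp at h1; omega, (List.suffix_cons x s).trans h2, h3⟩
    · rintro ⟨h1, ⟨e, he⟩, h3⟩
      -- The latest choice stands at the head, so the first choice made below `s` is the last entry
      -- of `e`.
      rcases List.eq_nil_or_concat e with rfl | ⟨e', x, rfl⟩
      · simp at he; subst he; omega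
      · have hst : st = e' ++ (x :: s) := by simp [← he]
        have hv : ValidNode M tst (x :: s) := by
          rw [hst] at h3
          clear hst h1 he
          induction e' with
          | nil => exact h3
          | cons a e' ih' => exact ih' h3.2.2
        exact ⟨x, ⟨⟨by omega, by have := hv.1; omega⟩, hv.2.1⟩,
          (ih hv).2 ⟨by simp; omega, ⟨e', hst.symm⟩, h3⟩⟩

theorem suffix_of_mem_leaves {r : ℕ} {s st : List ℕ} (h : st ∈ leaves M tst r s) :
    s <:+ st := by
  classical
  induction r generalizing s with
  | zero => simp only [leaves, List.mem_singleton] at h; rw [h]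
  | succ r ih =>
    simp only [leaves, List.mem_flatMap] at h
    obtain ⟨x, -, h⟩ := h
    exact (List.suffix_cons x s).trans (ih h)

/-- Leaves below two different siblings have different suffixes of the same length. -/
theorem nodup_leaves {r : ℕ} {s : List ℕ} : (leaves M tst r s).Nodup := by
  classical
  induction r generalizing s with
  | zero => simp [leaves]
  | succ r ih =>
    rw [leaves, List.nodup_flatMap]
    refine ⟨fun x _ => ih, ?_⟩
    refine List.Pairwise.imp ?_ (List.Nodup.filter _ (List.nodup_range' (step := 1)))
    intro x y hxy
    rw [Function.onFun, List.disjoint_left]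
    intro st h1 h2
    have h1 := suffix_of_mem_leaves h1
    have h2 := suffix_of_mem_leaves h2
    have := List.suffix_of_suffix_length_le h1 h2 (by simp)
    have := this.eq_of_length (by simp)
    simp at this
    exact hxy this

open Classical in
theorem filter_range'_first {a b y : ℕ} (p : ℕ → Prop) (hay : a ≤ y) (hyb : y < b)
    (hno : ∀ z, a ≤ z → z < y → ¬ p z) (hy : p y) :
    (List.range' a (b - a)).filter (fun x => p x)
      = y :: (List.range' (y + 1) (b - (y + 1))).filter (fun x => p x) := by
  have h1 : b - a = (y - a) + (1 + (b - (y + 1))) := by omega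
  rw [h1, ← List.range'_append_1, ← List.range'_append_1, List.filter_append, List.filter_append]
  have h2 : a + (y - a) = y := by omega
  rw [h2, List.filter_eq_nil_iff.2]
  · simp [hy]
  · intro z hz
    rw [List.mem_range'_1] at hz
    simpa using hno z hz.1 (by omega)

open Classical in
theorem filter_range'_none {a b : ℕ} (p : ℕ → Prop)
    (hno : ∀ z, a ≤ z → z < b → ¬ p z) :
    (List.range' a (b - a)).filter (fun x => p x) = [] := by
  rw [List.filter_eq_nil_iff]
  intro z hz
  rw [List.mem_range'_1] at hz
  simpa using hno z hz.1 (by omega)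

/-- This and the next two lemmas are the invariants of the search: going down to the first child,
across to the next sibling, or up from a last child leaves the list of leaves still to be visited
unchanged. -/
theorem leaves_first {n y : ℕ} {st : List ℕ} (hst : st.length < n) (hy : y < M)
    (hno : ∀ z < y, ¬ tst st z) (hty : tst st y) :
    leaves M tst (n - st.length) st ++ later M tst n st =
      leaves M tst (n - (y :: st).length) (y :: st) ++ later M tst n (y :: st) := by
  have h1 : n - st.length = (n - (st.length + 1)) + 1 := by omega
  have h2 := filter_range'_first (tst st) (Nat.zero_le y) hy (fun z _ => hno z) hty
  rw [Nat.sub_zero] at h2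
  rw [h1, leaves, h2, List.flatMap_cons, later, List.append_assoc]
  rfl

theorem later_next {n x y : ℕ} {st : List ℕ} (hxy : x < y) (hy : y < M)
    (hno : ∀ z, x + 1 ≤ z → z < y → ¬ tst st z) (hty : tst st y) :
    later M tst n (x :: st) =
      leaves M tst (n - (y :: st).length) (y :: st) ++ later M tst n (y :: st) := by
  rw [later, filter_range'_first (tst st) hxy hy hno hty, List.flatMap_cons, later,
    List.append_assoc]
  rfl

theorem later_none {n x : ℕ} {st : List ℕ} (hno : ∀ z, x + 1 ≤ z → z < M → ¬ tst st z) :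
    later M tst n (x :: st) = later M tst n st := by
  rw [later, filter_range'_none (tst st) hno]
  rfl

/-! ### The search tree of minimal transversals -/

/-- The union of the sets chosen on the path to a node. -/
def setOf (cand : ℕ → Finset ℕ) : List ℕ → Finset ℕ
  | [] => ∅
  | x :: st => setOf cand st ∪ cand x

/-- The candidate with number `x` leads from the node `st` to a child. -/
def Child (m : ℕ) (cl : ℕ → Finset ℕ) (lv : ℕ → ℕ) (cand : ℕ → Finset ℕ) (st : List ℕ) (x : ℕ) :
    Prop :=
  Good m cl lv st.length (setOf cand st) (cand x)

/-- `cand` enumerates the sets of at most `k` numbers below `n`. -/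
def IsTable (k n M : ℕ) (cand : ℕ → Finset ℕ) : Prop :=
  Set.InjOn cand (Set.Iio M) ∧ ∀ S : Finset ℕ, (S ⊆ Finset.range n ∧ S.card ≤ k) ↔
    ∃ x < M, cand x = S

variable {cand : ℕ → Finset ℕ}

theorem ValidNode.minTr {st : List ℕ} (h : ValidNode M (Child m cl lv cand) st) :
    MinTr m cl lv st.length (setOf cand st) := by
  cases st with
  | nil => exact ⟨by simp, by simp [setOf]⟩
  | cons x st => exact h.2.1.2.1

/-- By `Greedy.subset` the set of a node determines that of its parent; the candidate added is then
the difference, by disjointness, and candidates are listed without repetition. -/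
theorem setOf_injective (hc : IsTable k n M cand) {st st' : List ℕ}
    (h : ValidNode M (Child m cl lv cand) st) (h' : ValidNode M (Child m cl lv cand) st')
    (hl : st.length = st'.length) (hs : setOf cand st = setOf cand st') : st = st' := by
  induction st generalizing st' with
  | nil => cases st' with
    | nil => rfl
    | cons => simp at hl
  | cons x st ih =>
    cases st' with
    | nil => simp at hl
    | cons x' st' =>
      simp only [List.length_cons, Nat.add_right_cancel_iff] at hl
      simp only [setOf] at hs
      have e : setOf cand st = setOf cand st' := by
        have g := h.2.1.2.2
        have g' := h'.2.1.2.2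
        rw [← hl, ← hs] at g'
        refine g.subset g' h.2.2.minTr.1 ?_ Finset.subset_union_left ?_
        · rw [hl]; exact h'.2.2.minTr.1
        · rw [hs]; exact Finset.subset_union_left
      have ex : cand x = cand x' := by
        rw [← Finset.union_sdiff_cancel_left h.2.1.1, hs, e,
          Finset.union_sdiff_cancel_left h'.2.1.1]
      rw [ih h.2.2 h'.2.2 hl e, hc.1 h.1 h'.1 ex]

/-- Completeness of the search: following parents from a minimal transversal leads to the root. -/
theorem exists_node (hL : Layered k n m cl lv) (hc : IsTable k n M cand) {i : ℕ} (hi : i ≤ n)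
    {T : Finset ℕ} (hTn : T ⊆ Finset.range n) (hT : MinTr m cl lv i T) :
    ∃ st, st.length = i ∧ ValidNode M (Child m cl lv cand) st ∧ setOf cand st = T := by
  induction i generalizing T with
  | zero =>
    refine ⟨[], rfl, trivial, ?_⟩
    rw [setOf, eq_comm, Finset.eq_empty_iff_forall_notMem]
    intro v hv
    obtain ⟨c, -, h, -⟩ := hT.2 v hv
    omega
  | succ i ih =>
    obtain ⟨T₀, S, hT₀, hS, rfl, hg⟩ := exists_parent hL hi hT
    obtain ⟨st, rfl, hv, rfl⟩ := ih (by omega) (Finset.subset_union_left.trans hTn) hT₀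
    obtain ⟨x, hx, rfl⟩ := (hc.2 S).1 ⟨Finset.subset_union_right.trans hTn, hS⟩
    exact ⟨x :: st, rfl, ⟨hx, hg, hv⟩, rfl⟩

theorem exists_child (hL : Layered k n m cl lv) (hk : 1 ≤ k) (hc : IsTable k n M cand)
    {st : List ℕ} (hv : ValidNode M (Child m cl lv cand) st) (hst : st.length < n) :
    ∃ x < M, Child m cl lv cand st x := by
  obtain ⟨S, hSn, hSk, hg⟩ := exists_good hL hk hst hv.minTr
  obtain ⟨x, hx, rfl⟩ := (hc.2 S).1 ⟨hSn, hSk⟩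
  exact ⟨x, hx, hg⟩

theorem setOf_subset (hc : IsTable k n M cand) {st : List ℕ} {tst : List ℕ → ℕ → Prop}
    (hv : ValidNode M tst st) : setOf cand st ⊆ Finset.range n := by
  induction st with
  | nil => simp [setOf]
  | cons x st ih =>
    exact Finset.union_subset (ih hv.2.2) ((hc.2 _).2 ⟨x, hv.1, rfl⟩).1

/-- For each of the `k + 1` possible sizes there are at most `n ^ k` sets. -/
theorem le_of_injOn_small (hinj : Set.InjOn cand (Set.Iio M))
    (hc : ∀ x < M, cand x ⊆ Finset.range n ∧ (cand x).card ≤ k) (hn : 1 ≤ n) :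
    M ≤ (k + 1) * n ^ k := by
  classical
  have h1 : M ≤ ((Finset.range (k + 1)).biUnion
      (fun j => (Finset.range n).powersetCard j)).card := by
    rw [← Finset.card_range M]
    refine Finset.card_le_card_of_injOn cand ?_ ?_
    · intro x hx
      have := hc x (by simpa using hx)
      simp only [Finset.coe_biUnion, Set.mem_iUnion, Finset.mem_coe, Finset.mem_powersetCard,
        Finset.mem_range]
      exact ⟨_, by omega, this.1, rfl⟩
    · intro x hx y hy
      exact hinj (by simpa using hx) (by simpa using hy)
  refine h1.trans (Finset.card_biUnion_le.trans ?_)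
  simp only [Finset.card_powersetCard, Finset.card_range]
  calc ∑ j ∈ Finset.range (k + 1), n.choose j ≤ ∑ _j ∈ Finset.range (k + 1), n ^ k :=
        Finset.sum_le_sum fun j hj => (Nat.choose_le_pow n j).trans
          (Nat.pow_le_pow_right hn (by rw [Finset.mem_range] at hj; omega))
    _ = (k + 1) * n ^ k := by simp

/-! ### Memory layout -/

notation "aIn" => (0 : ℕ)
notation "aLit" => (1 : ℕ)
notation "aCls" => (2 : ℕ)
notation "aLen" => (3 : ℕ)
notation "aPar" => (4 : ℕ)
notation "aVal" => (5 : ℕ)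
notation "aDep" => (6 : ℕ)
notation "aSize" => (7 : ℕ)
notation "aLv" => (8 : ℕ)
notation "aX" => (9 : ℕ)
notation "aI" => (10 : ℕ)
notation "aOk" => (11 : ℕ)
notation "aDone" => (12 : ℕ)
notation "aMem" => (13 : ℕ)
notation "aCA" => (14 : ℕ)
notation "aCT" => (15 : ℕ)
notation "aMin" => (16 : ℕ)
notation "aM1" => (17 : ℕ)
notation "aM2" => (18 : ℕ)
notation "aDeg" => (19 : ℕ)
notation "aY" => (20 : ℕ)
notation "aPos" => (21 : ℕ)
notation "aCnt" => (22 : ℕ)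
notation "aCur" => (23 : ℕ)
notation "aOuter" => (24 : ℕ)
notation "aInner" => (25 : ℕ)

/-- The entry of the array `a` whose index is the scalar `b`. -/
def entry (a b : ℕ) : Expr := .get a (scal b)

/-- The entry of the array `a` whose index is `b[c]` for the scalar `c`. -/
def entry₂ (a b c : ℕ) : Expr := .get a (entry b c)

/-- Assignment to a scalar. -/
def setScal (a : ℕ) (e : Expr) : Program := .assign a (.const 0) e

def numVars : Expr := .get aIn (.const 0)
def numClauses : Expr := .get aIn (.const 1)

/-- The memory contains the literal occurrences of the clauses `cl c`, `c < m`. -/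
structure Input (n m N : ℕ) (cl : ℕ → Finset ℕ) (σ : Memory) : Prop where
  vars : σ aIn 0 = n
  clauses : σ aIn 1 = m
  len : σ aLen 0 = N
  lit_lt : ∀ p < N, σ aLit p < n
  cls_lt : ∀ p < N, σ aCls p < m
  inj : ∀ p < N, ∀ q < N, σ aCls p = σ aCls q → σ aLit p = σ aLit q → p = q
  mem : ∀ c < m, ∀ v, v ∈ cl c ↔ ∃ p < N, σ aCls p = c ∧ σ aLit p = v

/-- The memory contains the table of candidates. -/
structure Table (k n M : ℕ) (cand : ℕ → Finset ℕ) (σ : Memory) : Prop where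
  size : σ aSize 0 = M
  isTable : IsTable k n M cand
  zero : cand 0 = ∅
  chain : ∀ x, 0 < x → x < M → σ aPar x < M ∧ σ aVal x ∉ cand (σ aPar x) ∧
    cand x = insert (σ aVal x) (cand (σ aPar x))

theorem Input.congr {n m N : ℕ} {cl : ℕ → Finset ℕ} {σ σ' : Memory} (h : Input n m N cl σ)
    (h0 : σ' aIn = σ aIn) (h1 : σ' aLit = σ aLit) (h2 : σ' aCls = σ aCls)
    (h3 : σ' aLen = σ aLen) : Input n m N cl σ' := by
  obtain ⟨a, b, c, d, e, f, g⟩ := h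
  constructor <;> simp only [h0, h1, h2, h3] <;> assumption

theorem Table.congr {k n M : ℕ} {cand : ℕ → Finset ℕ} {σ σ' : Memory} (h : Table k n M cand σ)
    (h0 : σ' aSize = σ aSize) (h1 : σ' aPar = σ aPar) (h2 : σ' aVal = σ aVal) :
    Table k n M cand σ' := by
  obtain ⟨a, b, c, d⟩ := h
  constructor <;> (try simp only [h0, h1, h2]) <;> assumption

attribute [simp] store_same store_ne Program.eff Expr.eval Test.eval

@[simp] theorem scal_eval (σ : Memory) (a : ℕ) : (scal a).eval σ = σ a 0 := rfl
@[simp] theorem entry_eval (σ : Memory) (a b : ℕ) : (entry a b).eval σ = σ a (σ b 0) := rfl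
@[simp] theorem entry₂_eval (σ : Memory) (a b c : ℕ) :
    (entry₂ a b c).eval σ = σ a (σ b (σ c 0)) := rfl
@[simp] theorem numVars_eval (σ : Memory) : numVars.eval σ = σ aIn 0 := rfl
@[simp] theorem numClauses_eval (σ : Memory) : numClauses.eval σ = σ aIn 1 := rfl
@[simp] theorem setScal_eff (σ : Memory) (a : ℕ) (e : Expr) :
    (setScal a e).eff σ = store σ a 0 (e.eval σ) := rfl

/-! ### Marking the current set -/

/-- `a[0] := 0; …; a[e - 1] := 0`. -/
def fill (a : ℕ) (e v : Expr) : Program := forLoop aInner e (.assign a (scal aInner) v)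

theorem exec_fill {a N : ℕ} {e v : Expr} {σ : Memory} {w : ℕ} (ha : (aInner == a) = false)
    (he : ∀ σ', (∀ b, b ≠ a → b ≠ aInner → σ' b = σ b) → e.eval σ' = N)
    (hv : ∀ σ', (∀ b, b ≠ a → b ≠ aInner → σ' b = σ b) → v.eval σ' = w) :
    Exec (fill a e v) σ (N * 3 + 2) (fun σ' => ∀ j < N, σ' a j = w) := by
  have hne : a ≠ aInner := by
    rintro rfl; simp at ha
  have key : ∀ σ' : Memory, (∀ b, (fill a e v).touches b = false → σ' b = σ b) →
      (∀ b, b ≠ a → b ≠ aInner → σ' b = σ b) := by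
    intro σ' h b h1 h2
    apply h
    simp [fill, forLoop, Program.touches, h1, h2]
  refine exec_for_straight (fun j σ' => ∀ i < j, σ' a i = w) 1 rfl rfl ha (by simp)
    (fun σ' h => he σ' (key σ' h)) ?_
  intro j σ' hj hI hx hf i hi
  simp only [Program.eff, ne_eq, hne, not_false_eq_true, store_ne, store_same, scal_eval, hx,
    hv σ' (key σ' hf), Function.update_apply]
  split_ifs with h
  · rfl
  · exact hI i (by omega)

/-- Mark the elements of the candidate `aCur` by `1`. -/
def markOnes (k : ℕ) : Program :=
  forLoop aInner (.const k) (.ite (.lt (.const 0) (scal aCur))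
    (.seq (.assign aMem (entry aVal aCur) (.const 1)) (setScal aCur (entry aPar aCur))) .skip)

section

variable {k n m N M : ℕ} {cl cand : ℕ → Finset ℕ} {σ : Memory}

theorem exec_markOnes (hT : Table k n M cand σ) (hx : σ aCur 0 < M) :
    Exec (markOnes k) σ (k * 5 + 2) (fun σ' => ∀ v,
      σ' aMem v = if v ∈ cand (σ aCur 0) then 1 else σ aMem v) := by
  -- After `j ≤ k` rounds at most `k - j` elements are left on the chain, so `k` rounds exhaust it.
  -- Rounds after reaching candidate `0`, the empty set, are idle.
  refine (exec_for_straight (fun j σ' => σ' aCur 0 < M ∧ (cand (σ' aCur 0)).card + j ≤ max k j ∧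
    cand (σ' aCur 0) ⊆ cand (σ aCur 0) ∧ ∀ v,
      σ' aMem v = if v ∈ cand (σ aCur 0) \ cand (σ' aCur 0) then 1 else σ aMem v)
    3 rfl rfl rfl ?_ (fun _ _ => rfl) ?_).mono le_rfl ?_
  · have := ((hT.isTable.2 _).2 ⟨_, hx, rfl⟩).2
    simp [hx, this]
  · rintro j σ' hj ⟨h1, h2, h3, h4⟩ hx hf
    have e1 := hf aPar rfl
    have e2 := hf aVal rfl
    by_cases h0 : 0 < σ' aCur 0
    · obtain ⟨c1, c2, c3⟩ := hT.chain _ h0 h1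
      have c4 : (cand (σ' aCur 0)).card = (cand (σ aPar (σ' aCur 0))).card + 1 := by
        rw [c3, Finset.card_insert_of_notMem c2]
      have c5 : cand (σ aPar (σ' aCur 0)) ⊆ cand (σ' aCur 0) := by
        rw [c3]; exact Finset.subset_insert _ _
      have c6 : σ aVal (σ' aCur 0) ∈ cand (σ' aCur 0) := by rw [c3]; simp
      simp (disch := decide) only [Program.eff, Test.eval, Expr.eval, scal_eval, h0, decide_true,
        if_true, setScal_eff, store_ne, store_same, entry_eval, Function.update_self, e1, e2]
      refine ⟨c1, by omega, c5.trans h3, fun v => ?_⟩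
      rw [Function.update_apply, h4]
      by_cases hv : v = σ aVal (σ' aCur 0)
      · subst hv; simp [c2, h3 c6]
      · have : v ∈ cand (σ' aCur 0) ↔ v ∈ cand (σ aPar (σ' aCur 0)) := by
          rw [c3]; simp [hv]
        simp [hv, this]
    · have h0' : σ' aCur 0 = 0 := by omega
      have : (cand (σ' aCur 0)).card = 0 := by rw [h0', hT.zero]; rfl
      simp [h0]
      refine ⟨h1, by omega, h3, ?_⟩
      simpa using h4
  · rintro σ' ⟨h1, h2, h3, h4⟩ v
    have : cand (σ' aCur 0) = ∅ := by rw [← Finset.card_eq_zero]; omega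
    rw [h4, this]; simp

end

/-- The number `x` is the truth value of `P`. -/
def Flag (x : ℕ) (P : Prop) : Prop := (P → x = 1) ∧ (¬ P → x = 0)

/-- Mark the elements of the candidates `X[0], …, X[e - 1]` by `1`. -/
def markPrefix (k : ℕ) (e : Expr) : Program :=
  forLoop aOuter e (.seq (setScal aCur (entry aX aOuter)) (markOnes k))

/-- Mark the elements of the candidate `X[I]` by `2`, and clear the flag if one of them is
already marked. -/
def markTwos (k : ℕ) : Program :=
  .seq (setScal aCur (entry aX aI))
    (forLoop aInner (.const k) (.ite (.lt (.const 0) (scal aCur))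
      (.seq (.ite (.eq (entry₂ aMem aVal aCur) (.const 0))
          (.assign aMem (entry aVal aCur) (.const 2)) (setScal aOk (.const 0)))
        (setScal aCur (entry aPar aCur))) .skip))

/-- Count, for every clause, its elements that are marked, and those marked by `1`, and find the
smallest marked one. -/
def countMarks : Program :=
  forLoop aInner (scal aLen) (.ite (.lt (.const 0) (entry₂ aMem aLit aInner))
    (.seq (.assign aCA (entry aCls aInner) (.succ (entry₂ aCA aCls aInner)))
      (.seq (.ite (.eq (entry₂ aMem aLit aInner) (.const 1))
          (.assign aCT (entry aCls aInner) (.succ (entry₂ aCT aCls aInner))) .skip)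
        (.ite (.lt (entry aLit aInner) (entry₂ aMin aCls aInner))
          (.assign aMin (entry aCls aInner) (entry aLit aInner)) .skip))) .skip)

/-- Record which vertices have a private clause, and check that all clauses are covered. -/
def markPrivate : Program :=
  forLoop aInner numClauses (.ite (.not (.lt (scal aI) (entry aLv aInner)))
    (.seq (.ite (.eq (entry aCA aInner) (.const 0)) (setScal aOk (.const 0)) .skip)
      (.seq (.ite (.eq (entry aCA aInner) (.const 1))
          (.assign aM1 (entry aMin aInner) (.const 1)) .skip)
        (.ite (.and (.lt (entry aLv aInner) (scal aI)) (.eq (entry aCT aInner) (.const 1)))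
          (.assign aM2 (entry aMin aInner) (.const 1)) .skip))) .skip)

/-- Check that all vertices have private clauses. -/
def checkPrivate : Program :=
  forLoop aInner numVars (.seq
    (.ite (.and (.lt (.const 0) (entry aMem aInner)) (.eq (entry aM1 aInner) (.const 0)))
      (setScal aOk (.const 0)) .skip)
    (.ite (.and (.eq (entry aMem aInner) (.const 1)) (.eq (entry aM2 aInner) (.const 0)))
      (setScal aOk (.const 0)) .skip))

section

variable {k n m N M : ℕ} {cl cand : ℕ → Finset ℕ} {σ : Memory}

theorem exec_markPrefix {e : Expr} {i : ℕ} (hT : Table k n M cand σ)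
    (he : ∀ σ', (∀ a, (markPrefix k e).touches a = false → σ' a = σ a) → e.eval σ' = i)
    (hX : ∀ j < i, σ aX j < M) :
    Exec (markPrefix k e) σ (i * (k * 5 + 5) + 2) (fun σ' => ∀ v,
      σ' aMem v = if v ∈ (Finset.range i).biUnion (fun j => cand (σ aX j)) then 1
        else σ aMem v) := by
  refine (exec_for (t := 1 + (k * 5 + 2)) (fun j σ' => ∀ v,
      σ' aMem v = if v ∈ (Finset.range j).biUnion (fun j => cand (σ aX j)) then 1
        else σ aMem v) rfl (by simp) he ?_).mono (by ring_nf; omega) (fun _ h => h)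
  intro j σ' hj hI hx hf
  have e0 := hf aX rfl
  refine (exec_straight (p := setScal aCur (entry aX aOuter)) rfl σ').seq ?_
  rintro σ1 rfl -
  simp (disch := decide) only [setScal_eff, entry_eval, hx, e0]
  refine (exec_markOnes (M := M) (n := n) (cand := cand) (hT.congr ?_ ?_ ?_) ?_).mono le_rfl ?_
  · simpa using hf aSize rfl
  · simpa using hf aPar rfl
  · simpa using hf aVal rfl
  · simpa using hX j hj
  · intro σ2 h v
    have := h v
    simp (disch := decide) only [store_ne, store_same, Function.update_self, hI v] at this ⊢
    rw [this, Finset.range_add_one, Finset.biUnion_insert]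
    by_cases h1 : v ∈ cand (σ aX j) <;> simp [h1]

/-- The marks `1` and `2` keep node and candidate apart, so a single pass can later count both `T`
and `T ∪ S`. No element repeats on a chain, so a vertex found already marked must belong to `T`, and
the flag decides disjointness. -/
theorem exec_markTwos {T : Finset ℕ} (hT : Table k n M cand σ) (hX : σ aX (σ aI 0) < M)
    (hmem : ∀ v < n, σ aMem v = if v ∈ T then 1 else 0) (hok : σ aOk 0 = 1) :
    Exec (markTwos k) σ (k * 6 + 3) (fun σ' =>
      (∀ v < n, σ' aMem v = if v ∈ T then 1 else if v ∈ cand (σ aX (σ aI 0)) then 2 else 0) ∧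
        Flag (σ' aOk 0) (Disjoint T (cand (σ aX (σ aI 0))))) := by
  set S := cand (σ aX (σ aI 0)) with hS
  have hSn := (hT.isTable.2 S).2 ⟨_, hX, rfl⟩
  refine Exec.mono (t := 1 + (k * (4 + 2) + 2))
    ((exec_straight (p := setScal aCur (entry aX aI)) rfl σ).seq ?_) (by omega) (fun _ h => h)
  rintro σ1 rfl -
  simp only [setScal_eff, entry_eval]
  refine (exec_for_straight (fun j σ' => σ' aCur 0 < M ∧ (cand (σ' aCur 0)).card + j ≤ max k j ∧
    cand (σ' aCur 0) ⊆ S ∧ (∀ v < n, σ' aMem v = if v ∈ T then 1 else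
      if v ∈ S \ cand (σ' aCur 0) then 2 else 0) ∧
      Flag (σ' aOk 0) (Disjoint T (S \ cand (σ' aCur 0))))
    4 rfl rfl rfl ?_ (fun _ _ => rfl) ?_).mono le_rfl ?_
  · simp (disch := decide) only [store_ne, store_same, Function.update_self]
    refine ⟨hX, ?_, le_rfl, ?_, ?_⟩
    · have := hSn.2
      simp [← hS, this]
    · simpa [← hS] using hmem
    · simp [← hS, Flag, hok]
  · rintro j σ' hj ⟨h1, h2, h3, h4, h5⟩ hx hf
    have e1 := hf aPar rfl
    have e2 := hf aVal rfl
    simp (disch := decide) only [store_ne] at e1 e2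
    by_cases h0 : 0 < σ' aCur 0
    · obtain ⟨c1, c2, c3⟩ := hT.chain _ h0 h1
      set w := σ aVal (σ' aCur 0) with hw
      have c4 : (cand (σ' aCur 0)).card = (cand (σ aPar (σ' aCur 0))).card + 1 := by
        rw [c3, Finset.card_insert_of_notMem c2]
      have c5 : cand (σ aPar (σ' aCur 0)) ⊆ cand (σ' aCur 0) := by
        rw [c3]; exact Finset.subset_insert _ _
      have c6 : w ∈ cand (σ' aCur 0) := by rw [c3]; simp
      have hwn : w < n := by simpa using hSn.1 (h3 c6)
      have hmw := h4 w hwn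
      have hD : S \ cand (σ aPar (σ' aCur 0)) = insert w (S \ cand (σ' aCur 0)) := by
        ext v
        have := @h3 w c6
        rw [c3]
        simp only [Finset.mem_sdiff, Finset.mem_insert]
        by_cases hv : v = w
        · subst hv; simp [this, c2]
        · simp [hv]
      have hdw : w ∉ S \ cand (σ' aCur 0) := by simp [c6]
      simp (disch := decide) only [Program.eff, Test.eval, Expr.eval, scal_eval, h0, decide_true,
        if_true, setScal_eff, entry_eval, entry₂_eval, e2, ← hw]
      by_cases hwT : w ∈ T
      · rw [if_pos hwT] at hmw
        have hnd : ¬ Disjoint T (S \ cand (σ aPar (σ' aCur 0))) := by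
          rw [hD]; intro h
          exact Finset.disjoint_left.1 h hwT (by simp)
        simp (disch := decide) only [hmw, one_ne_zero, decide_false, Bool.false_eq_true, if_false,
          store_ne, store_same, Function.update_self, e1]
        refine ⟨c1, by omega, c5.trans h3, ?_, fun h => absurd h hnd, fun _ => rfl⟩
        intro v hv
        rw [h4 v hv, hD]
        by_cases hv : v = w
        · subst hv; simp [hwT]
        · simp [hv]
      · rw [if_neg hwT, if_neg hdw] at hmw
        simp (disch := decide) only [hmw, decide_true, if_true,
          store_ne, store_same, Function.update_self, e1]
        refine ⟨c1, by omega, c5.trans h3, ?_, ?_⟩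
        · intro v hv
          rw [Function.update_apply, h4 v hv, hD]
          by_cases hv : v = w
          · subst hv; simp [hwT]
          · simp [hv]
        · have : Disjoint T (S \ cand (σ aPar (σ' aCur 0))) ↔
              Disjoint T (S \ cand (σ' aCur 0)) := by
            rw [hD, Finset.disjoint_insert_right]; simp [hwT]
          rw [this]; exact h5
    · have h0' : σ' aCur 0 = 0 := by omega
      have : (cand (σ' aCur 0)).card = 0 := by rw [h0', hT.zero]; rfl
      simp only [Program.eff, Test.eval, Expr.eval, scal_eval, h0, decide_false,
        Bool.false_eq_true, if_false]
      simp (disch := decide) only [store_ne]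
      exact ⟨h1, by omega, h3, h4, h5⟩
  · rintro σ' ⟨h1, h2, h3, h4, h5⟩
    have : cand (σ' aCur 0) = ∅ := by rw [← Finset.card_eq_zero]; omega
    rw [this, Finset.sdiff_empty] at h4 h5
    exact ⟨h4, h5⟩

/-- No literal occurrence is stored twice, so counting occurrences counts elements. -/
theorem Input.card_eq (hI : Input n m N cl σ) {c : ℕ} (hc : c < m) (A : Finset ℕ) :
    ((Finset.range N).filter (fun p => σ aCls p = c ∧ σ aLit p ∈ A)).card = (cl c ∩ A).card := by
  refine Finset.card_bij (fun p _ => σ aLit p) ?_ ?_ ?_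
  · intro p hp
    simp only [Finset.mem_filter, Finset.mem_range] at hp
    exact Finset.mem_inter.2 ⟨(hI.mem c hc _).2 ⟨p, hp.1, hp.2.1, rfl⟩, hp.2.2⟩
  · intro p hp q hq h
    simp only [Finset.mem_filter, Finset.mem_range] at hp hq
    exact hI.inj p hp.1 q hq.1 (hp.2.1.trans hq.2.1.symm) h
  · intro v hv
    rw [Finset.mem_inter] at hv
    obtain ⟨p, h1, h2, h3⟩ := (hI.mem c hc v).1 hv.1
    refine ⟨p, ?_, h3⟩
    simp only [Finset.mem_filter, Finset.mem_range]
    exact ⟨h1, h2, h3 ▸ hv.2⟩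

theorem card_filter_succ (P : ℕ → Prop) [DecidablePred P] (j : ℕ) :
    ((Finset.range (j + 1)).filter P).card =
      ((Finset.range j).filter P).card + if P j then 1 else 0 := by
  rw [Finset.range_add_one, Finset.filter_insert]
  split_ifs with h
  · rw [Finset.card_insert_of_notMem (by simp)]
  · simp

theorem exec_countMarks {A T : Finset ℕ} (hI : Input n m N cl σ)
    (hA : ∀ v < n, 0 < σ aMem v ↔ v ∈ A) (hT : ∀ v < n, σ aMem v = 1 ↔ v ∈ T)
    (h1 : ∀ c < m, σ aCA c = 0) (h2 : ∀ c < m, σ aCT c = 0) (h3 : ∀ c < m, σ aMin c = n) :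
    Exec countMarks σ (N * 8 + 2) (fun σ' => ∀ c < m, σ' aCA c = (cl c ∩ A).card ∧
      σ' aCT c = (cl c ∩ T).card ∧ ((cl c ∩ A).Nonempty → σ' aMin c ∈ cl c ∩ A ∧
        ∀ u ∈ cl c ∩ A, σ' aMin c ≤ u)) := by
  -- The value `n` exceeds every vertex and stands for the minimum of the empty set.
  refine (exec_for_straight (fun j σ' => ∀ c < m,
    σ' aCA c = ((Finset.range j).filter (fun p => σ aCls p = c ∧ σ aLit p ∈ A)).card ∧
    σ' aCT c = ((Finset.range j).filter (fun p => σ aCls p = c ∧ σ aLit p ∈ T)).card ∧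
    (∀ p < j, σ aCls p = c → σ aLit p ∈ A → σ' aMin c ≤ σ aLit p) ∧
    (σ' aMin c = n ∨ ∃ p < j, σ aCls p = c ∧ σ aLit p ∈ A ∧ σ aLit p = σ' aMin c))
    6 rfl rfl rfl ?_ ?_ ?_).mono le_rfl ?_
  · intro c hc
    simp [h1 c hc, h2 c hc, h3 c hc]
  · intro σ' h
    rw [scal_eval, h aLen rfl, hI.len]
  · intro j σ' hj hIj hx hf c hc
    have e1 := hf aLit rfl
    have e2 := hf aCls rfl
    have e3 := hf aMem rfl
    obtain ⟨i1, i2, i3, i4⟩ := hIj c hc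
    have hv := hI.lit_lt j hj
    have hTA : σ aLit j ∈ T → σ aLit j ∈ A := fun h => by
      rw [← hA _ hv, (hT _ hv).2 h]; exact Nat.one_pos
    rw [card_filter_succ, card_filter_succ, ← i1, ← i2]
    by_cases hjA : σ aLit j ∈ A
    swap
    · have hjT := mt hTA hjA
      simp (disch := decide) only [Program.eff, Test.eval, Expr.eval, entry₂_eval, entry_eval, hx,
        e1, e2, e3, hA _ hv, decide_eq_true_eq, hjA, hjT, if_false, store_ne, and_false, add_zero]
      refine ⟨trivial, trivial, ?_, ?_⟩
      · intro p hp h h'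
        rcases Nat.lt_succ_iff_lt_or_eq.1 hp with hp | rfl
        exacts [i3 p hp h h', absurd h' hjA]
      · rcases i4 with h | ⟨p, hp, h⟩
        exacts [.inl h, .inr ⟨p, by omega, h⟩]
    -- Both conditions on the minimum hold for any number given by this case distinction; it then
    -- remains to see that the program computes it.
    have hmin : ∀ b, b = (if σ aCls j = c ∧ σ aLit j < σ' aMin c then σ aLit j else σ' aMin c) →
        (∀ p < j + 1, σ aCls p = c → σ aLit p ∈ A → b ≤ σ aLit p) ∧
        (b = n ∨ ∃ p < j + 1, σ aCls p = c ∧ σ aLit p ∈ A ∧ σ aLit p = b) := by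
      rintro b rfl
      constructor
      · intro p hp h h'
        rcases Nat.lt_succ_iff_lt_or_eq.1 hp with hp | rfl
        · have := i3 p hp h h'
          split_ifs <;> omega
        · split_ifs <;> omega
      · split_ifs with hlt
        · exact .inr ⟨j, by omega, hlt.1, hjA, rfl⟩
        · rcases i4 with h | ⟨p, hp, h⟩
          exacts [.inl h, .inr ⟨p, by omega, h⟩]
    refine ⟨?_, ?_, hmin _ ?_⟩ <;> by_cases hjT : σ aLit j ∈ T <;>
      by_cases hlt : σ aLit j < σ' aMin (σ aCls j) <;>
      simp (disch := decide) only [Program.eff, Test.eval, Expr.eval, entry₂_eval, entry_eval, hx,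
        e1, e2, e3, hA _ hv, hT _ hv, decide_eq_true_eq, hjA, hjT, hlt, if_true, if_false, store_ne,
        store_same, and_true, and_false] <;>
      rcases eq_or_ne c (σ aCls j) with hcc | hcc <;>
      first
      | (subst hcc; simp [hlt])
      | simp [hcc, hcc.symm]
  · intro σ' h c hc
    obtain ⟨i1, i2, i3, i4⟩ := h c hc
    refine ⟨i1.trans (hI.card_eq hc A), i2.trans (hI.card_eq hc T), ?_⟩
    rintro ⟨v, hv⟩
    rw [Finset.mem_inter, hI.mem c hc] at hv
    obtain ⟨⟨p, p1, p2, rfl⟩, p4⟩ := hv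
    have hlt : σ' aMin c < n := (i3 p p1 p2 p4).trans_lt (hI.lit_lt p p1)
    constructor
    · rcases i4 with h | ⟨q, q1, q2, q3, q4⟩
      · omega
      · rw [← q4]
        exact Finset.mem_inter.2 ⟨(hI.mem c hc _).2 ⟨q, q1, q2, rfl⟩, q3⟩
    · intro u hu
      rw [Finset.mem_inter, hI.mem c hc] at hu
      obtain ⟨⟨q, q1, q2, rfl⟩, q3⟩ := hu
      exact i3 q q1 q2 q3

end

theorem Flag.and_not {x y : ℕ} {P Q : Prop} (b : Prop) [Decidable b] (h : Flag x P)
    (hy : y = if b then 0 else x) (hQ : Q ↔ P ∧ ¬ b) : Flag y Q := by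
  by_cases hb : b <;> simp_all [Flag]

theorem Flag.or {x y : ℕ} {P Q : Prop} (b : Prop) [Decidable b] (h : Flag x P)
    (hy : y = if b then 1 else x) (hQ : Q ↔ P ∨ b) : Flag y Q := by
  by_cases hb : b <;> simp_all [Flag]

theorem exists_lt_succ (Q : ℕ → Prop) (j : ℕ) : (∃ c < j + 1, Q c) ↔ (∃ c < j, Q c) ∨ Q j := by
  simp only [Nat.lt_succ_iff_lt_or_eq, or_and_right, exists_or, exists_eq_left]

theorem forall_lt_succ (Q : ℕ → Prop) (j : ℕ) : (∀ c < j + 1, Q c) ↔ (∀ c < j, Q c) ∧ Q j := by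
  simp only [Nat.lt_succ_iff_lt_or_eq, or_imp, forall_and, forall_eq]

theorem Flag.iff {x : ℕ} {P Q : Prop} (h : Flag x P) (hPQ : P ↔ Q) : Flag x Q := by
  rwa [← propext hPQ]

theorem Flag.eq_zero {x : ℕ} {P : Prop} (h : Flag x P) : x = 0 ↔ ¬ P := by
  refine ⟨fun h0 hP => ?_, h.2⟩
  have := h.1 hP
  omega

section

variable {k n m N M : ℕ} {cl cand : ℕ → Finset ℕ} {σ : Memory}

/-- When exactly one element of a clause is marked, the recorded minimum is that element. So each
clause can itself mark the vertex to which it is private, in constant time. -/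
theorem exec_markPrivate {P : Prop} (hm : σ aIn 1 = m) (hok : Flag (σ aOk 0) P)
    (h1 : ∀ v < n, σ aM1 v = 0) (h2 : ∀ v < n, σ aM2 v = 0) :
    Exec markPrivate σ (m * 9 + 2) (fun σ' =>
      Flag (σ' aOk 0) (P ∧ ∀ c < m, σ aLv c ≤ σ aI 0 → σ aCA c ≠ 0) ∧
      ∀ v < n, Flag (σ' aM1 v) (∃ c < m, σ aLv c ≤ σ aI 0 ∧ σ aCA c = 1 ∧ σ aMin c = v) ∧
        Flag (σ' aM2 v) (∃ c < m, σ aLv c < σ aI 0 ∧ σ aCT c = 1 ∧ σ aMin c = v)) := by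
  refine exec_for_straight (fun j σ' =>
      Flag (σ' aOk 0) (P ∧ ∀ c < j, σ aLv c ≤ σ aI 0 → σ aCA c ≠ 0) ∧
      ∀ v < n, Flag (σ' aM1 v) (∃ c < j, σ aLv c ≤ σ aI 0 ∧ σ aCA c = 1 ∧ σ aMin c = v) ∧
        Flag (σ' aM2 v) (∃ c < j, σ aLv c < σ aI 0 ∧ σ aCT c = 1 ∧ σ aMin c = v))
    7 rfl rfl rfl ?_ ?_ ?_
  · simp (disch := decide) only [store_ne]
    refine ⟨hok.iff (by simp), fun v hv => ⟨?_, ?_⟩⟩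
    · simp [Flag, h1 v hv]
    · simp [Flag, h2 v hv]
  · intro σ' h
    rw [numClauses_eval, h aIn rfl, hm]
  · rintro j σ' hj ⟨i1, i2⟩ hx hf
    have e1 := hf aLv rfl
    have e2 := hf aI rfl
    have e3 := hf aCA rfl
    have e4 := hf aCT rfl
    have e5 := hf aMin rfl
    refine ⟨i1.and_not (σ aLv j ≤ σ aI 0 ∧ σ aCA j = 0) ?_ ?_, fun v hv =>
      ⟨(i2 v hv).1.or (σ aLv j ≤ σ aI 0 ∧ σ aCA j = 1 ∧ σ aMin j = v) ?_ ?_,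
        (i2 v hv).2.or (σ aLv j < σ aI 0 ∧ σ aCT j = 1 ∧ σ aMin j = v) ?_ ?_⟩⟩
    · simp (disch := decide) only [store_ne, store_same, Program.eff, Test.eval, Expr.eval,
        entry_eval, scal_eval, hx, e1, e2, e3, e4, e5, setScal_eff, ite_apply, ite_self]
      grind
    · rw [forall_lt_succ]; tauto
    · simp (disch := decide) only [store_ne, store_same, Program.eff, Test.eval, Expr.eval,
        entry_eval, scal_eval, hx, e1, e2, e3, e4, e5, setScal_eff, ite_apply, ite_self,
        Function.update_apply]
      grind
    · rw [exists_lt_succ]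
    · simp (disch := decide) only [store_ne, store_same, Program.eff, Test.eval, Expr.eval,
        entry_eval, scal_eval, hx, e1, e2, e3, e4, e5, setScal_eff, ite_apply, ite_self,
        Function.update_apply]
      grind
    · rw [exists_lt_succ]

theorem exec_checkPrivate {P : Prop} (hn : σ aIn 0 = n) (hok : Flag (σ aOk 0) P) :
    Exec checkPrivate σ (n * 6 + 2) (fun σ' => Flag (σ' aOk 0) (P ∧ ∀ v < n,
      ¬ (0 < σ aMem v ∧ σ aM1 v = 0) ∧ ¬ (σ aMem v = 1 ∧ σ aM2 v = 0))) := by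
  refine exec_for_straight (fun j σ' => Flag (σ' aOk 0) (P ∧ ∀ v < j,
      ¬ (0 < σ aMem v ∧ σ aM1 v = 0) ∧ ¬ (σ aMem v = 1 ∧ σ aM2 v = 0)))
    4 rfl rfl rfl ?_ ?_ ?_
  · simp (disch := decide) only [store_ne]
    exact hok.iff (by simp)
  · intro σ' h
    rw [numVars_eval, h aIn rfl, hn]
  · rintro j σ' hj i1 hx hf
    have e1 := hf aMem rfl
    have e2 := hf aM1 rfl
    have e3 := hf aM2 rfl
    refine i1.and_not (0 < σ aMem j ∧ σ aM1 j = 0 ∨ σ aMem j = 1 ∧ σ aM2 j = 0) ?_ ?_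
    · simp (disch := decide) only [store_ne, store_same, Program.eff, Test.eval, Expr.eval,
        entry_eval, hx, e1, e2, e3, setScal_eff, ite_apply, ite_self]
      grind
    · rw [forall_lt_succ]; tauto

/-- Decide whether the candidate `X[I]` leads from the node `X[0], …, X[I - 1]` to a child. -/
def test (k : ℕ) : Program :=
  .seq (fill aMem numVars (.const 0)) (.seq (markPrefix k (scal aI)) (.seq (setScal aOk (.const 1))
    (.seq (markTwos k) (.seq (fill aCA numClauses (.const 0)) (.seq (fill aCT numClauses (.const 0))
      (.seq (fill aMin numClauses numVars) (.seq countMarks (.seq (fill aM1 numVars (.const 0))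
        (.seq (fill aM2 numVars (.const 0)) (.seq markPrivate checkPrivate))))))))))

theorem exec_test (hI : Input n m N cl σ) (hT : Table k n M cand σ)
    (hX : ∀ j ≤ σ aI 0, σ aX j < M) :
    Exec (test k) σ (n * 15 + m * 18 + N * 8 + k * 6 + σ aI 0 * (k * 5 + 5) + 24)
      (fun σ' => Flag (σ' aOk 0) (Good m cl (σ aLv) (σ aI 0)
        ((Finset.range (σ aI 0)).biUnion (fun j => cand (σ aX j))) (cand (σ aX (σ aI 0))))) := by
  set i := σ aI 0 with hi
  set T := (Finset.range i).biUnion (fun j => cand (σ aX j)) with hTdef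
  set S := cand (σ aX i) with hS
  have hcn : ∀ x < M, cand x ⊆ Finset.range n := fun x hx =>
    ((hT.isTable.2 (cand x)).2 ⟨x, hx, rfl⟩).1
  have hAn : ∀ v ∈ T ∪ S, v < n := by
    intro v hv
    rw [← Finset.mem_range]
    rcases Finset.mem_union.1 hv with hv | hv
    · obtain ⟨j, hj, hv⟩ := Finset.mem_biUnion.1 hv
      exact hcn _ (hX j (Finset.mem_range.1 hj).le) hv
    · exact hcn _ (hX i le_rfl) hv
  refine Exec.mono (t := (n * 3 + 2) + ((i * (k * 5 + 5) + 2) + (1 + ((k * 6 + 3) + ((m * 3 + 2) +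
    ((m * 3 + 2) + ((m * 3 + 2) + ((N * 8 + 2) + ((n * 3 + 2) + ((n * 3 + 2) + ((m * 9 + 2) +
    (n * 6 + 2)))))))))))) (Exec.seq (exec_fill (N := n) (w := 0) rfl ?_ (fun _ _ => rfl)) ?_)
    (by omega) (fun _ h => h)
  · intro σ' h; rw [numVars_eval, h _ (by decide) (by decide), hI.vars]
  intro s1 p1 f1
  refine (exec_markPrefix (hT.congr (f1 _ rfl) (f1 _ rfl) (f1 _ rfl)) (i := i) ?_ ?_).seq ?_
  · intro σ' h; rw [scal_eval, h _ rfl, f1 _ rfl]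
  · intro j hj; rw [f1 _ rfl]; exact hX j hj.le
  intro s2 p2 f2
  have hT' : (Finset.range i).biUnion (fun j => cand (s1 aX j)) = T := by rw [f1 aX rfl]
  rw [hT'] at p2
  refine (exec_straight (p := setScal aOk (.const 1)) rfl s2).seq ?_
  intro s3 p3 f3
  have eI : s3 aI = σ aI := by rw [f3 _ rfl, f2 _ rfl, f1 _ rfl]
  have eX : s3 aX = σ aX := by rw [f3 _ rfl, f2 _ rfl, f1 _ rfl]
  refine (exec_markTwos (T := T) (hT.congr (σ' := s3) ?_ ?_ ?_) ?_ ?_ ?_).seq ?_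
  · rw [f3 _ rfl, f2 _ rfl, f1 _ rfl]
  · rw [f3 _ rfl, f2 _ rfl, f1 _ rfl]
  · rw [f3 _ rfl, f2 _ rfl, f1 _ rfl]
  · rw [eI, eX]; exact hX _ le_rfl
  · intro v hv; rw [f3 _ rfl, p2, p1 v hv]
  · rw [p3]; simp
  rw [eI, eX, ← hi, ← hS]
  rintro s4 ⟨p4, p4'⟩ f4
  have in4 : Input n m N cl s4 := hI.congr (by rw [f4 _ rfl, f3 _ rfl, f2 _ rfl, f1 _ rfl])
    (by rw [f4 _ rfl, f3 _ rfl, f2 _ rfl, f1 _ rfl])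
    (by rw [f4 _ rfl, f3 _ rfl, f2 _ rfl, f1 _ rfl])
    (by rw [f4 _ rfl, f3 _ rfl, f2 _ rfl, f1 _ rfl])
  refine (exec_fill (N := m) (w := 0) rfl ?_ (fun _ _ => rfl)).seq ?_
  · intro σ' h; rw [numClauses_eval, h _ (by decide) (by decide), in4.clauses]
  intro s5 p5 f5
  refine (exec_fill (N := m) (w := 0) rfl ?_ (fun _ _ => rfl)).seq ?_
  · intro σ' h; rw [numClauses_eval, h _ (by decide) (by decide), f5 _ rfl, in4.clauses]
  intro s6 p6 f6
  refine (exec_fill (N := m) (w := n) rfl ?_ ?_).seq ?_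
  · intro σ' h; rw [numClauses_eval, h _ (by decide) (by decide), f6 _ rfl, f5 _ rfl, in4.clauses]
  · intro σ' h; rw [numVars_eval, h _ (by decide) (by decide), f6 _ rfl, f5 _ rfl, in4.vars]
  intro s7 p7 f7
  have in7 : Input n m N cl s7 := in4.congr (by rw [f7 _ rfl, f6 _ rfl, f5 _ rfl])
    (by rw [f7 _ rfl, f6 _ rfl, f5 _ rfl]) (by rw [f7 _ rfl, f6 _ rfl, f5 _ rfl])
    (by rw [f7 _ rfl, f6 _ rfl, f5 _ rfl])
  have eM7 : s7 aMem = s4 aMem := by rw [f7 _ rfl, f6 _ rfl, f5 _ rfl]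
  have hmA : ∀ v < n, 0 < s4 aMem v ↔ v ∈ T ∪ S := by
    intro v hv
    rw [p4 v hv, Finset.mem_union]
    by_cases h1 : v ∈ T <;> by_cases h2 : v ∈ S <;> simp [h1, h2]
  have hmT : ∀ v < n, s4 aMem v = 1 ↔ v ∈ T := by
    intro v hv
    rw [p4 v hv]
    by_cases h1 : v ∈ T <;> by_cases h2 : v ∈ S <;> simp [h1, h2]
  refine (exec_countMarks (A := T ∪ S) (T := T) in7 (by rw [eM7]; exact hmA)
    (by rw [eM7]; exact hmT) ?_ ?_ p7).seq ?_
  · intro c hc; rw [f7 _ rfl, f6 _ rfl, p5 c hc]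
  · intro c hc; rw [f7 _ rfl, p6 c hc]
  intro s8 p8 f8
  have e80 : s8 aIn = s7 aIn := f8 _ rfl
  refine (exec_fill (N := n) (w := 0) rfl ?_ (fun _ _ => rfl)).seq ?_
  · intro σ' h; rw [numVars_eval, h _ (by decide) (by decide), e80, in7.vars]
  intro s9 p9 f9
  refine (exec_fill (N := n) (w := 0) rfl ?_ (fun _ _ => rfl)).seq ?_
  · intro σ' h; rw [numVars_eval, h _ (by decide) (by decide), f9 _ rfl, e80, in7.vars]
  intro s10 p10 f10
  refine (exec_markPrivate (n := n) (m := m) (P := Disjoint T S) ?_ ?_ ?_ p10).seq ?_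
  · rw [f10 _ rfl, f9 _ rfl, e80, in7.clauses]
  · rw [f10 _ rfl, f9 _ rfl, f8 _ rfl, f7 _ rfl, f6 _ rfl, f5 _ rfl]; exact p4'
  · rw [f10 _ rfl]; exact p9
  rintro s11 ⟨p11, p11'⟩ f11
  have eL : s10 aLv = σ aLv := by
    rw [f10 _ rfl, f9 _ rfl, f8 _ rfl, f7 _ rfl, f6 _ rfl, f5 _ rfl, f4 _ rfl, f3 _ rfl,
      f2 _ rfl, f1 _ rfl]
  have eI' : s10 aI = σ aI := by
    rw [f10 _ rfl, f9 _ rfl, f8 _ rfl, f7 _ rfl, f6 _ rfl, f5 _ rfl, f4 _ rfl, eI]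
  have eA : s10 aCA = s8 aCA := by rw [f10 _ rfl, f9 _ rfl]
  have eT : s10 aCT = s8 aCT := by rw [f10 _ rfl, f9 _ rfl]
  have eN : s10 aMin = s8 aMin := by rw [f10 _ rfl, f9 _ rfl]
  have eM : s11 aMem = s4 aMem := by
    rw [f11 _ rfl, f10 _ rfl, f9 _ rfl, f8 _ rfl, eM7]
  rw [eL, eI', eA, eT, eN, ← hi] at p11'
  rw [eL, eI', eA, ← hi] at p11
  refine (exec_checkPrivate (n := n) ?_ p11).mono le_rfl ?_
  · rw [f11 _ rfl, f10 _ rfl, f9 _ rfl, e80, in7.vars]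
  intro s12 p12
  rw [eM] at p12
  refine p12.iff ?_
  -- It remains to translate counts and minima back into `Good`.
  have single : ∀ c < m, ∀ v, cl c ∩ (T ∪ S) = {v} ↔ s8 aCA c = 1 ∧ s8 aMin c = v := by
    intro c hc v
    obtain ⟨q1, -, q3⟩ := p8 c hc
    rw [q1, Finset.card_eq_one]
    constructor
    · intro h
      refine ⟨⟨v, h⟩, ?_⟩
      have := (q3 (by rw [h]; simp)).1
      rw [h] at this
      simpa using this
    · rintro ⟨⟨w, hw⟩, rfl⟩
      have := (q3 (by rw [hw]; simp)).1
      rw [hw] at this ⊢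
      rw [Finset.mem_singleton.1 this]
  -- One element of `T` in the clause, together with a minimum over `T ∪ S` that lies in `T`, is
  -- exactly the greedy condition. If the minimum lies in `S` instead, `aM2` is set at a vertex
  -- outside `T`, where it is never inspected.
  have singleT : ∀ c < m, ∀ v ∈ T, (cl c ∩ T = {v} ∧ ∀ u ∈ cl c ∩ (T ∪ S), v ≤ u) ↔
      s8 aCT c = 1 ∧ s8 aMin c = v := by
    intro c hc v hv
    obtain ⟨-, q2, q3⟩ := p8 c hc
    have hsub : cl c ∩ T ⊆ cl c ∩ (T ∪ S) :=
      Finset.inter_subset_inter_left Finset.subset_union_left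
    rw [q2, Finset.card_eq_one]
    constructor
    · rintro ⟨h, h'⟩
      have hvc : v ∈ cl c ∩ T := by rw [h]; simp
      obtain ⟨r1, r2⟩ := q3 ⟨v, hsub hvc⟩
      exact ⟨⟨v, h⟩, le_antisymm (r2 v (hsub hvc)) (h' _ r1)⟩
    · rintro ⟨⟨w, hw⟩, rfl⟩
      have hwc : w ∈ cl c ∩ T := by rw [hw]; simp
      obtain ⟨r1, r2⟩ := q3 ⟨w, hsub hwc⟩
      have : s8 aMin c ∈ cl c ∩ T :=
        Finset.mem_inter.2 ⟨(Finset.mem_inter.1 r1).1, hv⟩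
      rw [hw, Finset.mem_singleton] at this
      exact ⟨by rw [hw, this], r2⟩
  constructor
  · rintro ⟨⟨h1, h2⟩, h3⟩
    refine ⟨h1, ⟨fun c hc hci => ?_, fun v hv => ?_⟩, fun v hv => ?_⟩
    · have := h2 c hc (by omega)
      rw [(p8 c hc).1] at this
      rwa [← Finset.card_pos, Nat.pos_iff_ne_zero]
    · have hvn := hAn v hv
      have := (h3 v hvn).1
      rw [hmA v hvn, (p11' v hvn).1.eq_zero] at this
      obtain ⟨c, hc, hci, h⟩ := not_not.1 fun h => this ⟨hv, h⟩
      exact ⟨c, hc, by omega, (single c hc v).2 h⟩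
    · have hvn := hAn v (Finset.mem_union_left _ hv)
      have := (h3 v hvn).2
      rw [hmT v hvn, (p11' v hvn).2.eq_zero] at this
      obtain ⟨c, hc, hci, h⟩ := not_not.1 fun h => this ⟨hv, h⟩
      exact ⟨c, hc, hci, (singleT c hc v hv).2 h⟩
  · rintro ⟨h1, ⟨h2, h3⟩, h4⟩
    refine ⟨⟨h1, fun c hc hci => ?_⟩, fun v hvn => ?_⟩
    · rw [(p8 c hc).1]
      exact (Finset.card_pos.2 (h2 c hc (by omega))).ne'
    · rw [hmA v hvn, hmT v hvn, (p11' v hvn).1.eq_zero, (p11' v hvn).2.eq_zero]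
      refine ⟨fun h => h.2 ?_, fun h => h.2 ?_⟩
      · obtain ⟨c, hc, hci, hs⟩ := h3 v h.1
        exact ⟨c, hc, by omega, (single c hc v).1 hs⟩
      · obtain ⟨c, hc, hci, hs⟩ := h4 v h.1
        exact ⟨c, hc, hci, (singleT c hc v h.1).1 hs⟩

end

/-! ### Finding the layers -/

/-- The degree of every vertex in the hypergraph of the clauses without a layer. -/
def countDeg : Program :=
  forLoop aInner (scal aLen) (.ite (.eq (entry₂ aLv aCls aInner) numVars)
    (.assign aDeg (entry aLit aInner) (.succ (entry₂ aDeg aLit aInner))) .skip)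

/-- Find a vertex of positive degree at most `k`. -/
def pickVertex (k : ℕ) : Program :=
  forLoop aInner numVars (.ite (.and (.lt (.const 0) (entry aDeg aInner))
    (.not (.lt (.const k) (entry aDeg aInner)))) (setScal aY (scal aInner)) .skip)

/-- Put the clauses at the vertex `aY` into the layer `aI`. -/
def assignLayer : Program :=
  forLoop aInner (scal aLen) (.ite (.and (.eq (entry aLit aInner) (scal aY))
    (.eq (entry₂ aLv aCls aInner) numVars)) (.assign aLv (entry aCls aInner) (scal aI)) .skip)

/-- Determine the layers from the last one to the first one. -/
def findLayers (k : ℕ) : Program :=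
  .seq (fill aLv numClauses numVars) (.seq (setScal aI numVars) (forLoop aOuter numVars
    (.seq (setScal aI (.pred (scal aI))) (.seq (fill aDeg numVars (.const 0)) (.seq countDeg
      (.seq (setScal aY numVars) (.seq (pickVertex k) assignLayer)))))))

section

variable {k n m N M : ℕ} {cl cand : ℕ → Finset ℕ} {σ : Memory}

theorem exec_countDeg (hI : Input n m N cl σ) (h0 : ∀ v < n, σ aDeg v = 0) :
    Exec countDeg σ (N * 4 + 2) (fun σ' => ∀ v < n, σ' aDeg v =
      ((Finset.range m).filter (fun c => σ aLv c = n ∧ v ∈ cl c)).card) := by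
  refine (exec_for_straight (fun j σ' => ∀ v < n, σ' aDeg v =
      ((Finset.range j).filter (fun p => σ aLv (σ aCls p) = n ∧ σ aLit p = v)).card)
    2 rfl rfl rfl ?_ ?_ ?_).mono le_rfl ?_
  · intro v hv; simp [h0 v hv]
  · intro σ' h
    rw [scal_eval, h aLen rfl, hI.len]
  · intro j σ' hj i1 hx hf v hv
    have e0 := hf aIn rfl
    have e1 := hf aLv rfl
    have e2 := hf aCls rfl
    have e3 := hf aLit rfl
    rw [card_filter_succ, ← i1 v hv]
    simp (disch := decide) only [store_ne, store_same, Program.eff, Test.eval, Expr.eval,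
      entry_eval, entry₂_eval, numVars_eval, hx, e0, e1, e2, e3, ite_apply, hI.vars,
      Function.update_apply]
    grind
  · intro σ' h v hv
    rw [h v hv]
    refine Finset.card_bij (fun p _ => σ aCls p) ?_ ?_ ?_
    · intro p hp
      simp only [Finset.mem_filter, Finset.mem_range] at hp ⊢
      have := hI.cls_lt p hp.1
      exact ⟨this, hp.2.1, (hI.mem _ this _).2 ⟨p, hp.1, rfl, hp.2.2⟩⟩
    · intro p hp q hq h
      simp only [Finset.mem_filter, Finset.mem_range] at hp hq
      exact hI.inj p hp.1 q hq.1 h (hp.2.2.trans hq.2.2.symm)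
    · intro c hc
      simp only [Finset.mem_filter, Finset.mem_range] at hc
      obtain ⟨p, h1, h2, h3⟩ := (hI.mem c hc.1 v).1 hc.2.2
      refine ⟨p, ?_, h2⟩
      simp only [Finset.mem_filter, Finset.mem_range]
      exact ⟨h1, h2 ▸ hc.2.1, h3⟩

/-- As `n` is not a vertex, it signals failure. Later hits overwrite earlier ones, which is harmless
because any low-degree vertex will do. -/
theorem exec_pickVertex (hn : σ aIn 0 = n) (hY : σ aY 0 = n) :
    Exec (pickVertex k) σ (n * 4 + 2) (fun σ' =>
      (σ' aY 0 = n ∧ ∀ v < n, ¬ (0 < σ aDeg v ∧ σ aDeg v ≤ k)) ∨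
      (σ' aY 0 < n ∧ 0 < σ aDeg (σ' aY 0) ∧ σ aDeg (σ' aY 0) ≤ k)) := by
  refine exec_for_straight (fun j σ' =>
      (σ' aY 0 = n ∧ ∀ v < j, ¬ (0 < σ aDeg v ∧ σ aDeg v ≤ k)) ∨
      (σ' aY 0 < n ∧ 0 < σ aDeg (σ' aY 0) ∧ σ aDeg (σ' aY 0) ≤ k))
    2 rfl rfl rfl ?_ ?_ ?_
  · simp [hY]
  · intro σ' h
    rw [numVars_eval, h aIn rfl, hn]
  · intro j σ' hj i1 hx hf
    have e1 := hf aDeg rfl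
    simp (disch := decide) only [store_ne, store_same, Program.eff, Test.eval, Expr.eval,
      entry_eval, scal_eval, hx, e1, ite_apply, setScal_eff, forall_lt_succ,
      Function.update_self]
    by_cases hd : 0 < σ aDeg j ∧ σ aDeg j ≤ k
    · simp [hd, hj]
    · grind

theorem exec_assignLayer (hI : Input n m N cl σ) :
    Exec assignLayer σ (N * 4 + 2) (fun σ' => ∀ c < m, σ' aLv c =
      if σ aLv c = n ∧ σ aY 0 ∈ cl c then σ aI 0 else σ aLv c) := by
  classical
  refine (exec_for_straight (fun j σ' => ∀ c < m, σ' aLv c =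
      if σ aLv c = n ∧ ∃ p < j, σ aCls p = c ∧ σ aLit p = σ aY 0 then σ aI 0 else σ aLv c)
    2 rfl rfl rfl ?_ ?_ ?_).mono le_rfl ?_
  · intro c hc; simp
  · intro σ' h
    rw [scal_eval, h aLen rfl, hI.len]
  · intro j σ' hj i1 hx hf c hc
    have e0 := hf aIn rfl
    have e1 := hf aI rfl
    have e2 := hf aCls rfl
    have e3 := hf aLit rfl
    have e4 := hf aY rfl
    have i2 := i1 _ (hI.cls_lt j hj)
    have i3 := i1 c hc
    simp (disch := decide) only [store_ne, store_same, Program.eff, Test.eval,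
      entry_eval, entry₂_eval, scal_eval, numVars_eval, hx, e0, e1, e2, e3, e4, ite_apply, hI.vars,
      Function.update_apply, exists_lt_succ]
    rcases eq_or_ne c (σ aCls j) with hcc | hcc
    · subst hcc
      rw [i2]
      by_cases h1 : σ aLv (σ aCls j) = n <;> by_cases h2 : σ aLit j = σ aY 0 <;>
        by_cases h3 : ∃ p < j, σ aCls p = σ aCls j ∧ σ aLit p = σ aY 0 <;> simp [h1, h2, h3]
    · simp only [hcc, hcc.symm, if_false, ite_self, false_and, or_false, i3]
  · intro σ' h c hc
    rw [h c hc]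
    simp only [hI.mem c hc]

/-! ### Correctness of peeling off low-degree vertices -/

/-- The state of the search for layers when those from `i` on have been determined; the clauses
without a layer are in layer `n`. -/
def LayersFrom (k n m : ℕ) (cl : ℕ → Finset ℕ) (i : ℕ) (lv : ℕ → ℕ) : Prop :=
  (∀ c < m, i ≤ lv c ∧ lv c ≤ n) ∧
  (∀ j, i ≤ j → j < n → ((Finset.range m).filter (fun c => lv c = j)).card ≤ k ∧
    ∃ y < n, ∀ c < m, (lv c = j → y ∈ cl c) ∧ (lv c < j ∨ lv c = n → y ∉ cl c)) ∧
  ((Finset.range n).filter (fun v => ∃ c < m, lv c = n ∧ v ∈ cl c)).card ≤ i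

/-- Every nonempty set of edges has a vertex whose degree is positive and at most `k`. -/
def LowDegree (k n m : ℕ) (cl : ℕ → Finset ℕ) : Prop :=
  ∀ U ⊆ Finset.range m, U.Nonempty → ∃ v < n, 0 < (U.filter (fun c => v ∈ cl c)).card ∧
    (U.filter (fun c => v ∈ cl c)).card ≤ k

/-- Layer `i` consists of the unassigned clauses at `y`. Unassigned clauses end up in lower layers,
so they must avoid the shared vertices of all layers formed so far; this is why `LayersFrom` treats
the label `n` like a lower layer. The vertex `y` disappears from the unassigned clauses, so the
bound on their vertices drops along with `i`. -/
theorem LayersFrom.step (hd : LowDegree k n m cl) {i y : ℕ} {lv lv' : ℕ → ℕ}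
    (h : LayersFrom k n m cl (i + 1) lv) (hi : i < n)
    (hy : (y = n ∧ ∀ v < n,
        ¬ (0 < ((Finset.range m).filter (fun c => lv c = n ∧ v ∈ cl c)).card ∧
          ((Finset.range m).filter (fun c => lv c = n ∧ v ∈ cl c)).card ≤ k)) ∨
      (y < n ∧ 0 < ((Finset.range m).filter (fun c => lv c = n ∧ y ∈ cl c)).card ∧
        ((Finset.range m).filter (fun c => lv c = n ∧ y ∈ cl c)).card ≤ k))
    (hcl : ∀ c < m, n ∉ cl c)
    (hlv : ∀ c < m, lv' c = if lv c = n ∧ y ∈ cl c then i else lv c) :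
    LayersFrom k n m cl i lv' := by
  obtain ⟨h1, h2, h3⟩ := h
  refine ⟨fun c hc => ?_, fun j hij hjn => ?_, ?_⟩
  · have := h1 c hc
    rw [hlv c hc]; split_ifs <;> omega
  · rcases Nat.eq_or_lt_of_le hij with rfl | hij'
    · have hf : (Finset.range m).filter (fun c => lv' c = i) =
          (Finset.range m).filter (fun c => lv c = n ∧ y ∈ cl c) := by
        apply Finset.filter_congr
        intro c hc
        rw [Finset.mem_range] at hc
        have := h1 c hc
        rw [hlv c hc]
        split_ifs with h
        · simp [h]
        · simp only [h, iff_false]; omega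
      rw [hf]
      rcases hy with ⟨rfl, hy⟩ | ⟨hyn, hy1, hy2⟩
      · have hno : ∀ c < m, lv c ≠ y := by
          intro c hc hcy
          obtain ⟨v, hv, hv1, hv2⟩ := hd ((Finset.range m).filter (fun c => lv c = y))
            (Finset.filter_subset _ _) ⟨c, by simp [hc, hcy]⟩
          rw [Finset.filter_filter] at hv1 hv2
          exact hy v hv ⟨hv1, hv2⟩
        have he : (Finset.range m).filter (fun c => lv c = y ∧ y ∈ cl c) = ∅ := by
          apply Finset.filter_eq_empty_iff.2
          intro c hc h
          exact hno c (Finset.mem_range.1 hc) h.1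
        rw [he]
        -- No clause lies in or below layer `i` and none is unassigned, so any vertex can be named
        -- as shared; `i` is one.
        refine ⟨by simp, i, hi, fun c hc => ?_⟩
        have := h1 c hc
        have h' := hno c hc
        rw [hlv c hc, if_neg (fun h => h' h.1)]
        exact ⟨fun h => by omega, fun h => by omega⟩
      · refine ⟨hy2, y, hyn, fun c hc => ?_⟩
        have := h1 c hc
        rw [hlv c hc]
        split_ifs with h
        · exact ⟨fun _ => h.2, fun h => by omega⟩
        · refine ⟨fun h => by omega, fun h' hyc => ?_⟩
          rcases h' with h' | h'
          · omega
          · exact h ⟨h', hyc⟩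
    · obtain ⟨g1, z, hz, g2⟩ := h2 j hij' hjn
      have hf : (Finset.range m).filter (fun c => lv' c = j) =
          (Finset.range m).filter (fun c => lv c = j) := by
        apply Finset.filter_congr
        intro c hc
        rw [Finset.mem_range] at hc
        rw [hlv c hc]
        split_ifs with h <;> omega
      rw [hf]
      refine ⟨g1, z, hz, fun c hc => ?_⟩
      have := h1 c hc
      rw [hlv c hc]
      split_ifs with h
      · exact ⟨fun h => by omega, fun _ => (g2 c hc).2 (.inr h.1)⟩
      · exact g2 c hc
  · rcases hy with ⟨rfl, hy⟩ | ⟨hyn, hy1, hy2⟩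
    · have : (Finset.range y).filter (fun v => ∃ c < m, lv' c = y ∧ v ∈ cl c) = ∅ := by
        apply Finset.filter_eq_empty_iff.2
        rintro v - ⟨c, hc, hcy, -⟩
        rw [hlv c hc, if_neg (fun h => hcl c hc h.2)] at hcy
        obtain ⟨v, hv, hv1, hv2⟩ := hd ((Finset.range m).filter (fun c => lv c = y))
          (Finset.filter_subset _ _) ⟨c, by simp [hc, hcy]⟩
        rw [Finset.filter_filter] at hv1 hv2
        exact hy v hv ⟨hv1, hv2⟩
      rw [this]; simp
    -- The inclusion is strict because `y`, of positive degree, is lost.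
    · refine Nat.le_of_lt_succ (lt_of_lt_of_le (Finset.card_lt_card ?_) h3)
      rw [Finset.ssubset_iff_of_subset]
      · obtain ⟨c, hc⟩ := Finset.card_pos.1 hy1
        simp only [Finset.mem_filter, Finset.mem_range] at hc
        refine ⟨y, ?_, ?_⟩
        · simp only [Finset.mem_filter, Finset.mem_range]
          exact ⟨hyn, c, hc⟩
        · simp only [Finset.mem_filter, Finset.mem_range, not_and, not_exists]
          intro _ c hc hn hyc
          rw [hlv c hc] at hn
          split_ifs at hn with h
          · omega
          · exact h ⟨hn, hyc⟩
      · intro v hv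
        simp only [Finset.mem_filter, Finset.mem_range] at hv ⊢
        obtain ⟨hv, c, hc, hn, hvc⟩ := hv
        refine ⟨hv, c, hc, ?_, hvc⟩
        rw [hlv c hc] at hn
        split_ifs at hn with h
        · omega
        · exact hn

/-- With `i = 0` no vertex is left in an unassigned clause, and clauses are nonempty, so every
clause has a layer. -/
theorem LayersFrom.layered {lv : ℕ → ℕ} (h : LayersFrom k n m cl 0 lv)
    (hcl : ∀ c < m, cl c ⊆ Finset.range n) (hne : ∀ c < m, (cl c).Nonempty) :
    Layered k n m cl lv ∧ ∀ c < m, lv c < n := by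
  obtain ⟨h1, h2, h3⟩ := h
  refine ⟨fun i hi => ?_, fun c hc => lt_of_le_of_ne (h1 c hc).2 fun hn => ?_⟩
  · obtain ⟨g1, y, hy, g2⟩ := h2 i (Nat.zero_le i) hi
    exact ⟨g1, y, hy, fun c hc => ⟨(g2 c hc).1, fun h => (g2 c hc).2 (.inl h)⟩⟩
  · obtain ⟨v, hv⟩ := hne c hc
    rw [Nat.le_zero, Finset.card_eq_zero, Finset.filter_eq_empty_iff] at h3
    exact h3 (hcl c hc hv) ⟨c, hc, hn, hv⟩

theorem Input.cl_subset (hI : Input n m N cl σ) : ∀ c < m, cl c ⊆ Finset.range n := by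
  intro c hc v hv
  obtain ⟨p, hp, -, rfl⟩ := (hI.mem c hc v).1 hv
  exact Finset.mem_range.2 (hI.lit_lt p hp)

theorem exec_findLayers (hI : Input n m N cl σ) (hd : LowDegree k n m cl)
    (hne : ∀ c < m, (cl c).Nonempty) :
    Exec (findLayers k) σ (m * 3 + 5 + n * (n * 7 + N * 8 + 12))
      (fun σ' => Layered k n m cl (σ' aLv) ∧ ∀ c < m, σ' aLv c < n) := by
  refine Exec.mono (t := (m * 3 + 2) + (1 + (n * ((1 + ((n * 3 + 2) + ((N * 4 + 2) + (1 +
    ((n * 4 + 2) + (N * 4 + 2)))))) + 2) + 2))) ?_ (by ring_nf; omega) (fun _ h => h)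
  refine (exec_fill (N := m) (w := n) rfl ?_ ?_).seq ?_
  · intro σ' h; rw [numClauses_eval, h _ (by decide) (by decide), hI.clauses]
  · intro σ' h; rw [numVars_eval, h _ (by decide) (by decide), hI.vars]
  intro s1 p1 f1
  refine (exec_straight (p := setScal aI numVars) rfl s1).seq ?_
  intro s2 p2 f2
  have eIn : s2 aIn = σ aIn := by rw [f2 _ rfl, f1 _ rfl]
  -- The loop counter goes up while the layer index in `aI` goes down from `n`.
  refine (exec_for (fun r σ' => σ' aI 0 + r = n ∧ LayersFrom k n m cl (n - r) (σ' aLv)) rfl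
    ?_ ?_ ?_).mono le_rfl ?_
  · simp (disch := decide) only [store_ne]
    refine ⟨by rw [p2]; simp [f1 aIn rfl, hI.vars], fun c hc => ?_, fun j h1 h2 => by omega, ?_⟩
    · rw [f2 _ rfl, p1 c hc]; simp
    · exact (Finset.card_filter_le _ _).trans (by simp)
  · intro σ' h
    rw [numVars_eval, h _ rfl, eIn, hI.vars]
  · rintro r s3 hr ⟨i1, i2⟩ hx hf
    have in3 : Input n m N cl s3 := hI.congr (by rw [hf _ rfl, f2 _ rfl, f1 _ rfl])
      (by rw [hf _ rfl, f2 _ rfl, f1 _ rfl]) (by rw [hf _ rfl, f2 _ rfl, f1 _ rfl])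
      (by rw [hf _ rfl, f2 _ rfl, f1 _ rfl])
    refine (exec_straight (p := setScal aI (.pred (scal aI))) rfl s3).seq ?_
    intro s4 p4 f4
    refine (exec_fill (N := n) (w := 0) rfl ?_ (fun _ _ => rfl)).seq ?_
    · intro σ' h; rw [numVars_eval, h _ (by decide) (by decide), f4 _ rfl, in3.vars]
    intro s5 p5 f5
    have in5 : Input n m N cl s5 := in3.congr (by rw [f5 _ rfl, f4 _ rfl])
      (by rw [f5 _ rfl, f4 _ rfl]) (by rw [f5 _ rfl, f4 _ rfl]) (by rw [f5 _ rfl, f4 _ rfl])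
    refine (exec_countDeg in5 p5).seq ?_
    intro s6 p6 f6
    refine (exec_straight (p := setScal aY numVars) rfl s6).seq ?_
    intro s7 p7 f7
    refine (exec_pickVertex (n := n) ?_ ?_).seq ?_
    · rw [f7 _ rfl, f6 _ rfl, in5.vars]
    · rw [p7]; simp [f6 aIn rfl, in5.vars]
    intro s8 p8 f8
    have in8 : Input n m N cl s8 := in5.congr (by rw [f8 _ rfl, f7 _ rfl, f6 _ rfl])
      (by rw [f8 _ rfl, f7 _ rfl, f6 _ rfl]) (by rw [f8 _ rfl, f7 _ rfl, f6 _ rfl])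
      (by rw [f8 _ rfl, f7 _ rfl, f6 _ rfl])
    have eI4 : s4 aI 0 = n - (r + 1) := by rw [p4]; simp; omega
    have eI8 : s8 aI 0 = n - (r + 1) := by
      rw [f8 _ rfl, f7 _ rfl, f6 _ rfl, f5 _ rfl, eI4]
    have eL5 : s5 aLv = s3 aLv := by rw [f5 _ rfl, f4 _ rfl]
    have eL8 : s8 aLv = s3 aLv := by rw [f8 _ rfl, f7 _ rfl, f6 _ rfl, eL5]
    refine ((exec_assignLayer in8).frame).mono le_rfl ?_
    rintro s9 ⟨p9, f9⟩
    simp (disch := decide) only [store_ne]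
    refine ⟨by rw [f9 _ rfl, eI8]; omega, ?_⟩
    rw [eI8, eL8] at p9
    have hr' : n - r = n - (r + 1) + 1 := by omega
    rw [hr'] at i2
    rw [eL5] at p6
    refine i2.step hd (by omega) (y := s8 aY 0) ?_ ?_ p9
    · rw [f7 aDeg rfl] at p8
      rcases p8 with ⟨q1, q2⟩ | ⟨q1, q2⟩
      · refine .inl ⟨q1, fun v hv => ?_⟩
        rw [← p6 v hv]; exact q2 v hv
      · refine .inr ⟨q1, ?_⟩
        rw [← p6 _ q1]; exact q2
    · intro c hc hnc
      simpa using in3.cl_subset c hc hnc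
  · rintro σ' ⟨-, h⟩
    rw [Nat.sub_self] at h
    exact h.layered hI.cl_subset hne

end

/-! ### Reading the input -/

/-- Read the clauses into lists of literal occurrences. -/
def parse : Program :=
  .seq (setScal aPos (.const 2)) (.seq (setScal aLen (.const 0)) (forLoop aOuter numClauses
    (.seq (.seq (setScal aCnt (entry aIn aPos)) (setScal aPos (.succ (scal aPos))))
      (forLoop aInner (scal aCnt) (.seq (.assign aLit (scal aLen) (entry aIn aPos))
        (.seq (.assign aCls (scal aLen) (scal aOuter))
          (.seq (setScal aLen (.succ (scal aLen))) (setScal aPos (.succ (scal aPos))))))))))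

/-- The literal occurrences in the first `c` clauses. -/
def occurrences (Ls : List (List ℕ)) (c : ℕ) : List (ℕ × ℕ) :=
  (List.range c).flatMap (fun i => (Ls.getD i []).map (fun v => (i, v)))

/-- The memory contains the list `G` of literal occurrences. -/
def Holds (G : List (ℕ × ℕ)) (σ : Memory) : Prop :=
  σ aLen 0 = G.length ∧ ∀ t < G.length, G[t]? = some (σ aCls t, σ aLit t)

theorem exec_parse {n : ℕ} {Ls : List (List ℕ)} {σ : Memory}
    (h0 : ∀ i, σ aIn i =
      (n :: Ls.length :: Ls.flatMap (fun l => l.length :: l)).getD i 0)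
    {b : ℕ} (hb : ∀ l ∈ Ls, l.length ≤ b) :
    Exec parse σ (Ls.length * (b * 6 + 6) + 4) (Holds (occurrences Ls Ls.length)) := by
  set w := n :: Ls.length :: Ls.flatMap (fun l => l.length :: l) with hw
  -- The reading position is tracked through the unread suffix of the input word: its head is the
  -- entry read, and advancing removes it.
  have hhead : ∀ {i a : ℕ} {r : List ℕ}, w.drop i = a :: r → σ aIn i = a ∧ w.drop (i + 1) = r := by
    intro i a r h
    constructor
    · rw [h0, List.getD_eq_getElem?_getD]
      have : (w.drop i)[0]? = some a := by rw [h]; rfl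
      rw [List.getElem?_drop] at this
      simp only [add_zero] at this
      rw [this]; rfl
    · rw [← List.drop_drop, h]; rfl
  refine Exec.mono (t := 1 + (1 + (Ls.length * ((2 + (b * (4 + 2) + 2)) + 2) + 2)))
    ((exec_straight (p := setScal aPos (.const 2)) rfl σ).seq ?_) (by ring_nf; omega)
    (fun _ h => h)
  intro s1 p1 f1
  refine (exec_straight (p := setScal aLen (.const 0)) rfl s1).seq ?_
  intro s2 p2 f2
  refine (exec_for (fun c σ' => Holds (occurrences Ls c) σ' ∧
    w.drop (σ' aPos 0) = (Ls.drop c).flatMap (fun l => l.length :: l)) rfl ?_ ?_ ?_).mono le_rfl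
    (fun _ h => h.1)
  · rw [p2, p1]
    simp [Holds, occurrences, hw]
  · intro σ' h
    rw [numClauses_eval, h _ rfl, f2 _ rfl, f1 _ rfl, h0]
    rfl
  rintro c s3 hc ⟨i1, i2⟩ hx hf
  have eIn : s3 aIn = σ aIn := by rw [hf _ rfl, f2 _ rfl, f1 _ rfl]
  set l := Ls[c] with hl
  have hld : Ls.getD c [] = l := by simp [hl, hc]
  rw [List.drop_eq_getElem_cons hc, List.flatMap_cons, List.cons_append] at i2
  obtain ⟨q1, q2⟩ := hhead i2
  refine (exec_straight (p := .seq (setScal aCnt (entry aIn aPos))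
    (setScal aPos (.succ (scal aPos)))) rfl s3).seq ?_
  intro s4 p4 f4
  have e4 : s4 aPos 0 = s3 aPos 0 + 1 := by rw [p4]; simp
  have e4' : s4 aCnt 0 = l.length := by rw [p4]; simp [eIn, q1]; rfl
  refine (exec_for_straight (N := l.length) (fun d σ' =>
    Holds (occurrences Ls c ++ (l.take d).map (fun v => (c, v))) σ' ∧
    w.drop (σ' aPos 0) = l.drop d ++ (Ls.drop (c + 1)).flatMap (fun l => l.length :: l)) 4 rfl rfl
    rfl ?_ ?_ ?_).mono ?_ ?_
  · simp (disch := decide) only [store_ne, e4, q2, Holds, f4 aLen rfl, f4 aCls rfl, f4 aLit rfl]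
    simpa [Holds, ← hl] using i1
  · intro σ' h
    rw [scal_eval, h _ rfl, e4']
  · rintro d s5 hd ⟨⟨j1, j2⟩, j3⟩ hx5 hf5
    have eIn5 : s5 aIn = σ aIn := by rw [hf5 _ rfl, f4 _ rfl, eIn]
    have eO : s5 aOuter 0 = c := by rw [hf5 _ rfl, f4 _ rfl, hx]
    rw [List.drop_eq_getElem_cons hd, List.cons_append] at j3
    obtain ⟨r1, r2⟩ := hhead j3
    set G := occurrences Ls c ++ (l.take d).map (fun v => (c, v)) with hG
    have hG' : occurrences Ls c ++ (l.take (d + 1)).map (fun v => (c, v)) = G ++ [(c, l[d])] := by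
      rw [hG, List.take_succ_eq_append_getElem hd, List.map_append, List.append_assoc]
      rfl
    rw [hG']
    simp (disch := decide) only [Holds, store_ne, store_same, Program.eff, Expr.eval,
      entry_eval, scal_eval, setScal_eff, Function.update_self, eIn5, r1, eO, r2, j1,
      List.length_append, List.length_singleton]
    refine ⟨⟨trivial, fun t ht => ?_⟩, trivial⟩
    rcases Nat.lt_succ_iff_lt_or_eq.1 ht with ht | rfl
    · rw [List.getElem?_append_left ht, j2 t ht, Function.update_of_ne ht.ne,
        Function.update_of_ne ht.ne]
    · simp
  · have := hb l (List.getElem_mem hc)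
    nlinarith
  · rintro s6 ⟨j1, j2⟩
    simp only [Holds]
    simp (disch := decide) only [store_ne]
    have : occurrences Ls (c + 1) =
        occurrences Ls c ++ (l.take l.length).map (fun v => (c, v)) := by
      rw [occurrences, List.range_succ, List.flatMap_append, List.flatMap_singleton, hld,
        List.take_length]
      rfl
    rw [this]
    exact ⟨j1, by simpa using j2⟩

theorem mem_occurrences {Ls : List (List ℕ)} {c i v : ℕ} :
    (i, v) ∈ occurrences Ls c ↔ i < c ∧ v ∈ Ls.getD i [] := by
  simp only [occurrences, List.mem_flatMap, List.mem_range, List.mem_map, Prod.mk.injEq]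
  constructor
  · rintro ⟨j, hj, u, hu, rfl, rfl⟩; exact ⟨hj, hu⟩
  · rintro ⟨h1, h2⟩; exact ⟨i, h1, v, h2, rfl, rfl⟩

theorem nodup_occurrences {Ls : List (List ℕ)} (h : ∀ l ∈ Ls, l.Nodup) (c : ℕ) :
    (occurrences Ls c).Nodup := by
  rw [occurrences, List.nodup_flatMap]
  constructor
  · intro i _
    refine List.Nodup.map (fun a b h => by simpa using h) ?_
    rw [List.getD_eq_getElem?_getD]
    cases hi : Ls[i]? with
    | none => simp
    | some l => exact h l (List.mem_of_getElem? hi)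
  · refine List.nodup_range.imp ?_
    intro a b hab
    rw [Function.onFun, List.disjoint_left]
    rintro ⟨x, y⟩ h1 h2
    simp only [List.mem_map, Prod.mk.injEq] at h1 h2
    obtain ⟨_, -, rfl, -⟩ := h1
    obtain ⟨_, -, rfl, -⟩ := h2
    exact hab rfl

theorem Holds.input {n : ℕ} {Ls : List (List ℕ)} {σ : Memory}
    (h : Holds (occurrences Ls Ls.length) σ) (hn : σ aIn 0 = n) (hm : σ aIn 1 = Ls.length)
    (hlt : ∀ l ∈ Ls, ∀ v ∈ l, v < n) (hnd : ∀ l ∈ Ls, l.Nodup) :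
    Input n Ls.length (occurrences Ls Ls.length).length (fun c => (Ls.getD c []).toFinset) σ := by
  obtain ⟨h1, h2⟩ := h
  have hmem : ∀ p < (occurrences Ls Ls.length).length,
      σ aCls p < Ls.length ∧ σ aLit p ∈ Ls.getD (σ aCls p) [] := by
    intro p hp
    have := List.mem_of_getElem? (h2 p hp)
    rwa [mem_occurrences] at this
  refine ⟨hn, hm, h1, fun p hp => ?_, fun p hp => (hmem p hp).1, fun p hp q hq e1 e2 => ?_,
    fun c hc v => ?_⟩
  · obtain ⟨g1, g2⟩ := hmem p hp
    simp only [List.getD_eq_getElem _ _ g1] at g2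
    exact hlt _ (List.getElem_mem g1) _ g2
  · have h3 : (occurrences Ls Ls.length)[p]? = (occurrences Ls Ls.length)[q]? := by
      rw [h2 p hp, h2 q hq, e1, e2]
    exact (List.getElem?_inj hp (nodup_occurrences hnd _)).1 h3
  · rw [List.mem_toFinset]
    constructor
    · intro hv
      obtain ⟨p, hp⟩ := List.mem_iff_getElem?.1 (mem_occurrences.2 ⟨hc, hv⟩)
      have hpl := (List.getElem?_eq_some_iff.1 hp).1
      rw [h2 p hpl, Option.some.injEq, Prod.mk.injEq] at hp
      exact ⟨p, hpl, hp⟩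
    · rintro ⟨p, hp, rfl, rfl⟩
      exact (hmem p hp).2

/-! ### The table of candidates -/

/-- List the sets of at most `k` variables. -/
def makeTable (k : ℕ) : Program :=
  .seq (.seq (setScal aSize (.const 1)) (setScal aDep (.const 0)))
    (forLoop aOuter numVars (.seq (setScal aCnt (scal aSize))
      (forLoop aInner (scal aCnt) (.ite (.lt (entry aDep aInner) (.const k))
        (.seq (.assign aPar (scal aSize) (scal aInner))
          (.seq (.assign aVal (scal aSize) (scal aOuter))
            (.seq (.assign aDep (scal aSize) (.succ (entry aDep aInner)))
              (setScal aSize (.succ (scal aSize)))))) .skip))))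

/-- The first `M` entries of the memory arrays describe the sets `cand x`. -/
structure Chains (M : ℕ) (cand : ℕ → Finset ℕ) (σ : Memory) : Prop where
  size : σ aSize 0 = M
  pos : 0 < M
  zero : cand 0 = ∅
  chain : ∀ x, 0 < x → x < M → σ aPar x < M ∧ σ aVal x ∉ cand (σ aPar x) ∧
    cand x = insert (σ aVal x) (cand (σ aPar x))
  dep : ∀ x < M, σ aDep x = (cand x).card

theorem Chains.congr {M : ℕ} {cand : ℕ → Finset ℕ} {σ σ' : Memory} (h : Chains M cand σ)
    (h0 : σ' aSize = σ aSize) (h1 : σ' aPar = σ aPar) (h2 : σ' aVal = σ aVal)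
    (h3 : σ' aDep = σ aDep) : Chains M cand σ' := by
  obtain ⟨a, b, c, d, e⟩ := h
  constructor <;> (try simp only [h0, h1, h2, h3]) <;> assumption

theorem Chains.append {M y v : ℕ} {cand : ℕ → Finset ℕ} {σ σ' : Memory} (h : Chains M cand σ)
    (hy : y < M) (hv : v ∉ cand y) (h0 : σ' aSize 0 = M + 1)
    (h1 : σ' aPar = Function.update (σ aPar) M y) (h2 : σ' aVal = Function.update (σ aVal) M v)
    (h3 : σ' aDep = Function.update (σ aDep) M (σ aDep y + 1)) :
    Chains (M + 1) (Function.update cand M (insert v (cand y))) σ' := by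
  have hM := h.pos
  refine ⟨h0, by omega, ?_, fun x hx hxM => ?_, fun x hx => ?_⟩
  · rw [Function.update_of_ne hM.ne, h.zero]
  · rw [h1, h2]
    rcases Nat.lt_succ_iff_lt_or_eq.1 hxM with hxM | rfl
    · obtain ⟨c1, c2, c3⟩ := h.chain x hx hxM
      rw [Function.update_of_ne hxM.ne, Function.update_of_ne hxM.ne, Function.update_of_ne hxM.ne,
        Function.update_of_ne c1.ne]
      exact ⟨by omega, c2, c3⟩
    · simp only [Function.update_self]
      rw [Function.update_of_ne hy.ne]
      exact ⟨by omega, hv, rfl⟩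
  · rw [h3]
    rcases Nat.lt_succ_iff_lt_or_eq.1 hx with hx | rfl
    · rw [Function.update_of_ne hx.ne, Function.update_of_ne hx.ne, h.dep x hx]
    · rw [Function.update_self, Function.update_self, Finset.card_insert_of_notMem hv, h.dep y hy]

/-- The table after `h` of the `M₀` sets without elements from `v` on have been extended by `v`. -/
structure Partial (k v M₀ h M : ℕ) (cand : ℕ → Finset ℕ) (σ : Memory) : Prop where
  chains : Chains M cand σ
  le : M₀ ≤ M
  old : IsTable k v M₀ cand
  inj : Set.InjOn cand (Set.Iio M)
  new : ∀ x, M₀ ≤ x → x < M → ∃ y < h, (cand y).card < k ∧ cand x = insert v (cand y)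
  all : ∀ y < h, (cand y).card < k → ∃ x < M, cand x = insert v (cand y)

/-- Appending to the table changes the enumeration only from index `M` on. -/
theorem IsTable.congr {k v M : ℕ} {cand cand' : ℕ → Finset ℕ} (h : IsTable k v M cand)
    (he : ∀ x < M, cand' x = cand x) : IsTable k v M cand' := by
  refine ⟨fun x hx y hy hxy => h.1 hx hy ?_, fun S => ?_⟩
  · rwa [he x hx, he y hy] at hxy
  · rw [h.2 S]
    constructor
    · rintro ⟨x, hx, rfl⟩; exact ⟨x, hx, he x hx⟩
    · rintro ⟨x, hx, rfl⟩; exact ⟨x, hx, (he x hx).symm⟩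

theorem IsTable.subset {k v M x : ℕ} {cand : ℕ → Finset ℕ} (h : IsTable k v M cand) (hx : x < M) :
    cand x ⊆ Finset.range v ∧ (cand x).card ≤ k := (h.2 _).2 ⟨x, hx, rfl⟩

theorem Partial.skip {k v M₀ h M : ℕ} {cand : ℕ → Finset ℕ} {σ : Memory}
    (hP : Partial k v M₀ h M cand σ) (hk : ¬ (cand h).card < k) :
    Partial k v M₀ (h + 1) M cand σ := by
  obtain ⟨a, b, c, d, e, f⟩ := hP
  refine ⟨a, b, c, d, fun x h1 h2 => ?_, fun y hy hyk => ?_⟩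
  · obtain ⟨y, hy, h3⟩ := e x h1 h2
    exact ⟨y, by omega, h3⟩
  · rcases Nat.lt_succ_iff_lt_or_eq.1 hy with hy | rfl
    exacts [f y hy hyk, absurd hyk hk]

theorem Partial.append {k v M₀ h M : ℕ} {cand : ℕ → Finset ℕ} {σ σ' : Memory}
    (hP : Partial k v M₀ h M cand σ) (hh : h < M₀) (hk : (cand h).card < k)
    (h0 : σ' aSize 0 = M + 1)
    (h1 : σ' aPar = Function.update (σ aPar) M h) (h2 : σ' aVal = Function.update (σ aVal) M v)
    (h3 : σ' aDep = Function.update (σ aDep) M (σ aDep h + 1)) :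
    Partial k v M₀ (h + 1) (M + 1) (Function.update cand M (insert v (cand h))) σ' := by
  obtain ⟨a, b, c, d, e, f⟩ := hP
  have hv : ∀ x < M₀, v ∉ cand x := fun x hx hv => by
    simpa using (c.subset hx).1 hv
  have hup : ∀ x < M, Function.update cand M (insert v (cand h)) x = cand x := fun x hx =>
    Function.update_of_ne hx.ne _ _
  -- Old sets do not contain `v`. A set added in this pass extends some `cand y` with `y < h`, and
  -- erasing `v` recovers `cand y`, which differs from `cand h`.
  have hne : ∀ x < M, cand x ≠ insert v (cand h) := by
    intro x hx hxe
    by_cases hxo : x < M₀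
    · exact hv x hxo (by rw [hxe]; simp)
    · obtain ⟨y, hy, -, hye⟩ := e x (by omega) hx
      rw [hye] at hxe
      have hyh : cand y = cand h := by
        rw [← Finset.erase_insert (hv y (by omega)), hxe, Finset.erase_insert (hv h hh)]
      have := c.1 (Set.mem_Iio.2 (hy.trans hh)) (Set.mem_Iio.2 hh) hyh
      omega
  refine ⟨a.append (by omega) (hv h hh) h0 h1 h2 h3, by omega,
    c.congr fun x hx => hup x (by omega), ?_, ?_, ?_⟩
  · intro x hx y hy hxy
    rcases Nat.lt_succ_iff_lt_or_eq.1 hx with hx | rfl <;>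
      rcases Nat.lt_succ_iff_lt_or_eq.1 hy with hy | rfl
    · rw [hup x hx, hup y hy] at hxy
      exact d hx hy hxy
    · rw [hup x hx, Function.update_self] at hxy
      exact absurd hxy (hne x hx)
    · rw [hup y hy, Function.update_self] at hxy
      exact absurd hxy.symm (hne y hy)
    · rfl
  · intro x hx hxM
    rcases Nat.lt_succ_iff_lt_or_eq.1 hxM with hxM | rfl
    · obtain ⟨y, hy, g1, g2⟩ := e x hx hxM
      refine ⟨y, by omega, ?_⟩
      rw [hup y (by omega), hup x hxM]
      exact ⟨g1, g2⟩
    · refine ⟨h, by omega, ?_⟩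
      rw [hup h (by omega), Function.update_self]
      exact ⟨hk, rfl⟩
  · intro y hy hyk
    rcases Nat.lt_succ_iff_lt_or_eq.1 hy with hy | rfl
    · rw [hup y (by omega)] at hyk ⊢
      obtain ⟨x, hx, hxe⟩ := f y hy hyk
      exact ⟨x, by omega, by rw [hup x hx, hxe]⟩
    · exact ⟨M, by omega, by rw [hup y (by omega), Function.update_self]⟩

/-- A small set without `v` is an old one; a small set with `v` extends an old one of fewer than `k`
elements. -/
theorem Partial.isTable {k v M₀ M : ℕ} {cand : ℕ → Finset ℕ} {σ : Memory}
    (hP : Partial k v M₀ M₀ M cand σ) : IsTable k (v + 1) M cand := by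
  obtain ⟨a, b, c, d, e, f⟩ := hP
  refine ⟨d, fun S => ⟨?_, ?_⟩⟩
  · rintro ⟨hS, hSk⟩
    by_cases hv : v ∈ S
    · have h1 : (S.erase v).card + 1 = S.card := Finset.card_erase_add_one hv
      obtain ⟨y, hy, hye⟩ := (c.2 (S.erase v)).1 ⟨fun u hu => by
        have h2 := Finset.mem_range.1 (hS (Finset.mem_of_mem_erase hu))
        have h3 := Finset.ne_of_mem_erase hu
        rw [Finset.mem_range]; omega, by omega⟩
      obtain ⟨x, hx, hxe⟩ := f y hy (by rw [hye]; omega)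
      exact ⟨x, hx, by rw [hxe, hye, Finset.insert_erase hv]⟩
    · obtain ⟨x, hx, hxe⟩ := (c.2 S).1 ⟨fun u hu => by
        have h2 := Finset.mem_range.1 (hS hu)
        have h3 : u ≠ v := fun h => hv (h ▸ hu)
        rw [Finset.mem_range]; omega, hSk⟩
      exact ⟨x, by omega, hxe⟩
  · rintro ⟨x, hx, rfl⟩
    by_cases hxo : x < M₀
    · have := c.subset hxo
      exact ⟨this.1.trans (Finset.range_mono (by omega)), this.2⟩
    · obtain ⟨y, hy, g1, g2⟩ := e x (by omega) hx
      rw [g2]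
      refine ⟨?_, (Finset.card_insert_le _ _).trans g1⟩
      intro u hu
      rcases Finset.mem_insert.1 hu with rfl | hu
      · simp
      · have := Finset.mem_range.1 ((c.subset hy).1 hu)
        rw [Finset.mem_range]; omega

theorem exec_makeTable {n k : ℕ} {σ : Memory} (hn : σ aIn 0 = n) (hn1 : 1 ≤ n) :
    Exec (makeTable k) σ (n * ((k + 1) * n ^ k * 7 + 5) + 4)
      (fun σ' => ∃ cand M, Table k n M cand σ' ∧ 0 < M) := by
  refine Exec.mono (t := 2 + (n * ((1 + ((k + 1) * n ^ k * (5 + 2) + 2)) + 2) + 2))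
    ((exec_straight (p := .seq (setScal aSize (.const 1)) (setScal aDep (.const 0))) rfl σ).seq ?_)
    (by ring_nf; omega) (fun _ h => h)
  intro s1 p1 f1
  refine (exec_for (fun v σ' => ∃ cand M, Chains M cand σ' ∧ IsTable k v M cand) rfl
    ?_ ?_ ?_).mono le_rfl ?_
  · refine ⟨fun _ => ∅, 1, ⟨?_, Nat.one_pos, rfl, fun x h1 h2 => by omega, fun x hx => ?_⟩, ?_, ?_⟩
    · rw [p1]; simp
    · have : x = 0 := by omega
      rw [p1, this]; simp
    · intro x hx y hy _
      simp only [Set.mem_Iio] at hx hy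
      omega
    · intro S
      simp only [Finset.range_zero, Finset.subset_empty]
      constructor
      · rintro ⟨rfl, -⟩; exact ⟨0, by omega, rfl⟩
      · rintro ⟨-, -, rfl⟩; simp
  · intro σ' h
    rw [numVars_eval, h _ rfl, f1 _ rfl, hn]
  · rintro v s2 hv ⟨cand₀, M₀, i1, i2⟩ hx hf
    refine (exec_straight (p := setScal aCnt (scal aSize)) rfl s2).seq ?_
    intro s3 p3 f3
    have eC : s3 aCnt 0 = M₀ := by rw [p3]; simp [i1.size]
    -- Every intermediate table consists of distinct small subsets of the final ground set, so one
    -- bound serves all passes.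
    have hM₀ : M₀ ≤ (k + 1) * n ^ k := le_of_injOn_small i2.1
      (fun x hx => ⟨(i2.subset hx).1.trans (Finset.range_mono hv.le), (i2.subset hx).2⟩) hn1
    refine (exec_for_straight (N := M₀) (fun h σ' => ∃ cand M, Partial k v M₀ h M cand σ') 5
      rfl rfl rfl ?_ ?_ ?_).mono ?_ ?_
    · refine ⟨cand₀, M₀, i1.congr ?_ ?_ ?_ ?_, le_rfl, i2, i2.1, fun x h1 h2 => by omega,
        fun y hy => by omega⟩
      · rw [store_ne (by decide), f3 _ rfl]
      · rw [store_ne (by decide), f3 _ rfl]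
      · rw [store_ne (by decide), f3 _ rfl]
      · rw [store_ne (by decide), f3 _ rfl]
    · intro σ' h
      rw [scal_eval, h _ rfl, eC]
    · rintro h s4 hh ⟨cand, M, hP⟩ hx4 hf4
      have eO : s4 aOuter 0 = v := by rw [hf4 _ rfl, f3 _ rfl, hx]
      have hd := hP.chains.dep h (hh.trans_le hP.le)
      have hs := hP.chains.size
      by_cases hk : (cand h).card < k
      · refine ⟨_, _, hP.append (σ' := store _ aInner 0 (h + 1)) hh hk ?_ ?_ ?_ ?_⟩ <;>
        simp (disch := decide) only [store_ne, store_same, Program.eff, Expr.eval, Test.eval,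
          entry_eval, scal_eval, setScal_eff, Function.update_self, hx4, hd, hk, decide_true,
          if_true, eO, hs]
      · have hP' := hP.skip hk
        refine ⟨cand, M, ?_, hP'.le, hP'.old, hP'.inj, hP'.new, hP'.all⟩
        refine hP'.chains.congr ?_ ?_ ?_ ?_ <;>
        simp (disch := decide) only [store_ne, Program.eff, Expr.eval, Test.eval,
          entry_eval, hx4, hd, hk, decide_false, Bool.false_eq_true, if_false]
    · have := Nat.mul_le_mul_right (5 + 2) hM₀
      omega
    · rintro s5 ⟨cand, M, hP⟩
      refine ⟨cand, M, hP.chains.congr ?_ ?_ ?_ ?_, hP.isTable⟩ <;>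
      simp (disch := decide) only [store_ne]
  · rintro σ' ⟨cand, M, h1, h2⟩
    exact ⟨cand, M, ⟨h1.size, h2, h1.zero, h1.chain⟩, h1.pos⟩

/-! ### The search -/

/-- Find the first candidate from `X[I]` on that leads to a child. -/
def seek (k : ℕ) : Program :=
  .seq (setScal aOk (.const 0)) (.while
    (.and (.lt (entry aX aI) (scal aSize)) (.eq (scal aOk) (.const 0)))
    (.seq (test k) (.ite (.eq (scal aOk) (.const 0))
      (.assign aX (scal aI) (.succ (entry aX aI))) .skip)))

/-- Go down to the first leaf below the current node. -/
def descend (k : ℕ) : Program :=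
  .while (.lt (scal aI) numVars) (.seq (.assign aX (scal aI) (.const 0))
    (.seq (seek k) (setScal aI (.succ (scal aI)))))

/-- Go up until there is a further child. -/
def backtrack (k : ℕ) : Program :=
  .while (.and (.lt (.const 0) (scal aI)) (.eq (scal aOk) (.const 0)))
    (.seq (.seq (setScal aI (.pred (scal aI))) (.assign aX (scal aI) (.succ (entry aX aI))))
      (seek k))

/-- Go from a leaf to the next one. -/
def next (k : ℕ) : Program :=
  .seq (setScal aOk (.const 0)) (.seq (backtrack k)
    (.ite (.eq (scal aOk) (.const 1)) (.seq (setScal aI (.succ (scal aI))) (descend k))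
      (setScal aDone (.const 1))))

theorem eval_lt {σ : Memory} {a b : Expr} :
    (Test.lt a b).eval σ = true ↔ a.eval σ < b.eval σ := by simp [Test.eval]

theorem eval_eq {σ : Memory} {a b : Expr} :
    (Test.eq a b).eval σ = true ↔ a.eval σ = b.eval σ := by simp [Test.eval]

theorem eval_and {σ : Memory} {a b : Test} :
    (Test.and a b).eval σ = true ↔ a.eval σ = true ∧ b.eval σ = true := by simp [Test.eval]

/-- The first entries of `a` are the choices on the path to a node. -/
def Path (a : ℕ → ℕ) : List ℕ → Prop
  | [] => True
  | x :: st => a st.length = x ∧ Path a st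

theorem Path.congr {a a' : ℕ → ℕ} {st : List ℕ} (h : Path a st)
    (h' : ∀ j < st.length, a' j = a j) : Path a' st := by
  induction st with
  | nil => trivial
  | cons x st ih =>
    exact ⟨(h' _ (by simp)).trans h.1, ih h.2 fun j hj => h' j (by simp; omega)⟩

theorem Path.setOf_eq {a : ℕ → ℕ} {st : List ℕ} (h : Path a st) (cand : ℕ → Finset ℕ) :
    setOf cand st = (Finset.range st.length).biUnion (fun j => cand (a j)) := by
  induction st with
  | nil => rfl
  | cons x st ih =>
    rw [setOf, ih h.2, List.length_cons, Finset.range_add_one, Finset.biUnion_insert, h.1,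
      Finset.union_comm]

theorem Path.lt {a : ℕ → ℕ} {st : List ℕ} (h : Path a st) {M : ℕ} {tst : List ℕ → ℕ → Prop}
    (hv : ValidNode M tst st) : ∀ j < st.length, a j < M := by
  induction st with
  | nil => simp
  | cons x st ih =>
    intro j hj
    rcases Nat.lt_succ_iff_lt_or_eq.1 hj with hj | rfl
    · exact ih h.2 hv.2.2 j hj
    · rw [h.1]; exact hv.1

/-- The data of the search. -/
structure Data where
  k : ℕ
  n : ℕ
  m : ℕ
  N : ℕ
  M : ℕ
  cl : ℕ → Finset ℕ
  cand : ℕ → Finset ℕ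
  lv : ℕ → ℕ

/-- The conditions under which the search is correct. -/
structure Data.Ok (d : Data) : Prop where
  one_le : 1 ≤ d.k
  layered : Layered d.k d.n d.m d.cl d.lv
  isTable : IsTable d.k d.n d.M d.cand

namespace Data

variable (d : Data)

/-- The data are stored in the memory. -/
structure Stored (σ : Memory) : Prop where
  input : Input d.n d.m d.N d.cl σ
  table : Table d.k d.n d.M d.cand σ
  layers : σ aLv = d.lv

def IsChild (st : List ℕ) (x : ℕ) : Prop := Child d.m d.cl d.lv d.cand st x

/-- The memory describes the node `st`. -/
structure At (st : List ℕ) (σ : Memory) : Prop where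
  stored : d.Stored σ
  path : Path (σ aX) st
  depth : σ aI 0 = st.length
  le : st.length ≤ d.n
  valid : ValidNode d.M d.IsChild st

def testTime : ℕ := d.n * 15 + d.m * 18 + d.N * 8 + d.k * 6 + d.n * (d.k * 5 + 5) + 24
def seekTime : ℕ := (d.M + 1) * (d.testTime + 2 + 1) + 2
def descendTime : ℕ := d.n * (d.seekTime + 2 + 1) + 1
def nextTime : ℕ := d.n * (d.seekTime + 2 + 1) + d.descendTime + 4

noncomputable def leavesFrom (st : List ℕ) : List (List ℕ) :=
  leaves d.M d.IsChild (d.n - st.length) st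

noncomputable def laterLeaves (st : List ℕ) : List (List ℕ) := later d.M d.IsChild d.n st

variable {d} {st : List ℕ} {σ σ' : Memory}

theorem Stored.congr (h : d.Stored σ) (h0 : σ' aIn = σ aIn) (h1 : σ' aLit = σ aLit)
    (h2 : σ' aCls = σ aCls) (h3 : σ' aLen = σ aLen) (h4 : σ' aPar = σ aPar)
    (h5 : σ' aVal = σ aVal) (h6 : σ' aSize = σ aSize) (h7 : σ' aLv = σ aLv) : d.Stored σ' :=
  ⟨h.input.congr h0 h1 h2 h3, h.table.congr h6 h4 h5, h7.trans h.layers⟩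

theorem Stored.of_frame (h : d.Stored σ) {p : Program}
    (hf : ∀ a, p.touches a = false → σ' a = σ a)
    (hp : (p.touches aIn || p.touches aLit || p.touches aCls || p.touches aLen || p.touches aPar ||
      p.touches aVal || p.touches aSize || p.touches aLv) = false) : d.Stored σ' := by
  simp only [Bool.or_eq_false_iff] at hp
  obtain ⟨⟨⟨⟨⟨⟨⟨h0, h1⟩, h2⟩, h3⟩, h4⟩, h5⟩, h6⟩, h7⟩ := hp
  exact h.congr (hf _ h0) (hf _ h1) (hf _ h2) (hf _ h3) (hf _ h4) (hf _ h5) (hf _ h6) (hf _ h7)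

theorem At.of_frame (h : d.At st σ) {p : Program}
    (hf : ∀ a, p.touches a = false → σ' a = σ a)
    (hp : (p.touches aIn || p.touches aLit || p.touches aCls || p.touches aLen || p.touches aPar ||
      p.touches aVal || p.touches aSize || p.touches aLv) = false)
    (hX : p.touches aX = false) (hI : p.touches aI = false) : d.At st σ' :=
  ⟨h.stored.of_frame hf hp, by rw [hf _ hX]; exact h.path, by rw [hf _ hI]; exact h.depth, h.le,
    h.valid⟩

theorem At.exec_test (h : d.At st σ) (hx : σ aX st.length < d.M) :
    Exec (test d.k) σ d.testTime (fun σ' => d.At st σ' ∧ σ' aX = σ aX ∧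
      Flag (σ' aOk 0) (d.IsChild st (σ aX st.length))) := by
  have hX : ∀ j ≤ σ aI 0, σ aX j < d.M := by
    rw [h.depth]
    intro j hj
    rcases Nat.lt_or_eq_of_le hj with hj | rfl
    exacts [h.path.lt h.valid j hj, hx]
  refine (Dualization.exec_test h.stored.input h.stored.table hX).frame.mono ?_ ?_
  · have : σ aI 0 * (d.k * 5 + 5) ≤ d.n * (d.k * 5 + 5) :=
      Nat.mul_le_mul_right _ (by rw [h.depth]; exact h.le)
    rw [testTime]; omega
  · rintro σ' ⟨q, hf⟩
    refine ⟨h.of_frame hf rfl rfl rfl, hf _ rfl, ?_⟩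
    rw [h.depth, h.stored.layers, ← h.path.setOf_eq] at q
    exact q

theorem At.exec_seek (h : d.At st σ) (hx : σ aX st.length ≤ d.M) :
    Exec (seek d.k) σ d.seekTime (fun σ' => d.At st σ' ∧
      ((σ' aOk 0 = 1 ∧ σ' aX st.length < d.M ∧ σ aX st.length ≤ σ' aX st.length ∧
          d.IsChild st (σ' aX st.length) ∧
          ∀ z, σ aX st.length ≤ z → z < σ' aX st.length → ¬ d.IsChild st z) ∨
        (σ' aOk 0 = 0 ∧ ∀ z, σ aX st.length ≤ z → z < d.M → ¬ d.IsChild st z))) := by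
  set x₀ := σ aX st.length with hx₀
  refine Exec.mono (t := 1 + ((d.M + 1) * (d.testTime + 2 + 1) + 1))
    ((exec_straight (p := setScal aOk (.const 0)) rfl σ).seq ?_)
    (by rw [seekTime]; omega) (fun _ h => h)
  intro s1 p1 f1
  -- The measure counts the candidates left as long as no child is found, and drops to `0` at once
  -- when one is.
  refine Exec.mono (exec_while (t := d.testTime + 2) (fun r σ' => d.At st σ' ∧
    σ' aX st.length ≤ d.M ∧ x₀ ≤ σ' aX st.length ∧
    (∀ z, x₀ ≤ z → z < σ' aX st.length → ¬ d.IsChild st z) ∧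
    ((σ' aOk 0 = 0 ∧ r = d.M - σ' aX st.length + 1) ∨
      (σ' aOk 0 = 1 ∧ r = 0 ∧ σ' aX st.length < d.M ∧ d.IsChild st (σ' aX st.length)))) ?_
    (d.M - x₀ + 1) s1 ?_) ?_ ?_
  · rintro r s2 ⟨i1, i2, i3, i4, i5⟩ hb
    simp only [eval_and, eval_lt, eval_eq, entry_eval, scal_eval, Expr.eval,
      i1.depth, i1.stored.table.size] at hb
    rcases i5 with ⟨i5, rfl⟩ | ⟨i5, -⟩
    swap
    · omega
    have hb1 := hb.1
    by_cases hc : d.IsChild st (s2 aX st.length)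
    · refine ⟨0, by omega, (i1.exec_test hb.1).seq ?_⟩
      rintro s3 ⟨q1, q2, q3⟩ f3
      refine Exec.of_eff rfl le_rfl ?_
      have e := q3.1 hc
      simp only [Program.eff, eval_eq, scal_eval, Expr.eval, e, one_ne_zero, if_false, q2]
      exact ⟨q1, i2, i3, i4, .inr ⟨trivial, trivial, hb1, hc⟩⟩
    · refine ⟨d.M - (s2 aX st.length + 1) + 1, by omega, (i1.exec_test hb.1).seq ?_⟩
      rintro s3 ⟨q1, q2, q3⟩ f3
      refine Exec.of_eff rfl le_rfl ?_
      have e := q3.2 hc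
      simp (disch := decide) only [Program.eff, eval_eq, scal_eval, Expr.eval, e, if_true,
        entry_eval, q1.depth, store_same, store_ne, Function.update_self, q2]
      refine ⟨⟨q1.stored.congr ?_ ?_ ?_ ?_ ?_ ?_ ?_ ?_, ?_, ?_, q1.le, q1.valid⟩, by omega,
        by omega, ?_, .inl ⟨trivial, trivial⟩⟩
      any_goals simp (disch := decide) only [store_ne]
      · rw [store_same]
        exact q1.path.congr fun j hj => by rw [Function.update_of_ne hj.ne]
      · exact q1.depth
      · intro z h1 h2
        rcases Nat.lt_succ_iff_lt_or_eq.1 h2 with h2 | rfl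
        exacts [i4 z h1 h2, hc]
  · have e : s1 aX st.length = x₀ := by rw [f1 _ rfl]
    rw [e]
    refine ⟨h.of_frame f1 rfl rfl rfl, hx, le_rfl, fun z h1 h2 => by omega, .inl ⟨?_, rfl⟩⟩
    rw [p1]; simp
  · have : (d.M - x₀ + 1) * (d.testTime + 2 + 1) ≤ (d.M + 1) * (d.testTime + 2 + 1) :=
      Nat.mul_le_mul_right _ (by omega)
    omega
  · rintro s2 ⟨hb, r, -, i1, i2, i3, i4, i5⟩
    simp only [← Bool.not_eq_true, eval_and, eval_lt, eval_eq, entry_eval, scal_eval, Expr.eval,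
      i1.depth, i1.stored.table.size] at hb
    refine ⟨i1, ?_⟩
    rcases i5 with ⟨i5, rfl⟩ | ⟨i5, rfl, i6, i7⟩
    · exact .inr ⟨i5, fun z h1 h2 => i4 z h1 (by omega)⟩
    · exact .inl ⟨i5, i6, i3, i7, i4⟩

theorem At.cons {x : ℕ} (h : d.At st σ) (hn : st.length < d.n) (hx : x < d.M)
    (hc : d.IsChild st x) (hX : σ aX st.length = x) (hσ : σ' = store σ aI 0 (st.length + 1)) :
    d.At (x :: st) σ' := by
  subst hσ
  refine ⟨h.stored.congr ?_ ?_ ?_ ?_ ?_ ?_ ?_ ?_, ?_, by simp, by simp; omega, hx, hc, h.valid⟩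
  any_goals simp (disch := decide) only [store_ne]
  exact ⟨hX, h.path⟩

/-- The list of leaves to come is invariant by `leaves_first`. Each round goes one level deeper,
since every search for a child succeeds. -/
theorem At.exec_descend (hd : d.Ok) (h : d.At st σ) :
    Exec (descend d.k) σ d.descendTime (fun σ' => ∃ st', d.At st' σ' ∧ st'.length = d.n ∧
      d.leavesFrom st ++ d.laterLeaves st = st' :: d.laterLeaves st') := by
  refine Exec.mono (exec_while (t := d.seekTime + 2) (fun r σ' => ∃ st', d.At st' σ' ∧
    r = d.n - st'.length ∧ d.leavesFrom st ++ d.laterLeaves st =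
      d.leavesFrom st' ++ d.laterLeaves st') ?_ (d.n - st.length) σ ⟨st, h, rfl, rfl⟩) ?_ ?_
  · rintro r s1 ⟨st', i1, rfl, i3⟩ hb
    simp only [eval_lt, scal_eval, numVars_eval, i1.depth,
      i1.stored.input.vars] at hb
    refine ⟨d.n - (st'.length + 1), by omega, ?_⟩
    refine Exec.mono (t := 1 + (d.seekTime + 1))
      ((exec_straight (p := .assign aX (scal aI) (.const 0)) rfl s1).seq ?_)
      (by omega) (fun _ h => h)
    intro s2 p2 f2
    simp only [Program.eff, scal_eval, i1.depth, Expr.eval] at p2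
    have eX : s2 aX st'.length = 0 := by rw [p2]; simp
    have a2 : d.At st' s2 := by
      refine ⟨i1.stored.of_frame f2 rfl, ?_, ?_, i1.le, i1.valid⟩
      · rw [p2, store_same]
        exact i1.path.congr fun j hj => by rw [Function.update_of_ne hj.ne]
      · rw [f2 _ rfl, i1.depth]
    refine (a2.exec_seek (by rw [eX]; omega)).seq ?_
    rintro s3 ⟨q1, q2⟩ f3
    rw [eX] at q2
    refine Exec.of_eff rfl le_rfl ?_
    rcases q2 with ⟨-, q3, -, q4, q5⟩ | ⟨-, q3⟩
    · refine ⟨s3 aX st'.length :: st', q1.cons hb q3 q4 rfl ?_, rfl, ?_⟩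
      · rw [setScal_eff, Expr.eval, scal_eval, q1.depth]
      · rw [i3]
        exact leaves_first hb q3 (fun z hz => q5 z (Nat.zero_le z) hz) q4
    -- A failing search is impossible: there are no dead ends.
    · obtain ⟨x, hx, hc⟩ := exists_child hd.layered hd.one_le hd.isTable i1.valid hb
      exact absurd hc (q3 x (Nat.zero_le x) hx)
  · have : (d.n - st.length) * (d.seekTime + 2 + 1) ≤ d.n * (d.seekTime + 2 + 1) :=
      Nat.mul_le_mul_right _ (by omega)
    rw [descendTime]; omega
  · rintro s1 ⟨hb, r, -, st', i1, -, i3⟩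
    simp only [← Bool.not_eq_true, eval_lt, scal_eval, numVars_eval, i1.depth,
      i1.stored.input.vars] at hb
    have hl : st'.length = d.n := le_antisymm i1.le (by omega)
    refine ⟨st', i1, hl, i3.trans ?_⟩
    rw [leavesFrom, hl, Nat.sub_self]
    rfl

/-- The measure is the depth. On success the memory still describes the parent `st'`, with the next
choice `x` in place but the depth not yet increased; `next` does that. -/
theorem At.exec_backtrack (h : d.At st σ) (hok : σ aOk 0 = 0) :
    Exec (backtrack d.k) σ (d.n * (d.seekTime + 2 + 1) + 1) (fun σ' =>
      (σ' aOk 0 = 0 ∧ d.laterLeaves st = []) ∨ (σ' aOk 0 = 1 ∧ ∃ x st', d.At st' σ' ∧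
        st'.length < d.n ∧ x < d.M ∧ d.IsChild st' x ∧ σ' aX st'.length = x ∧
        d.laterLeaves st = d.leavesFrom (x :: st') ++ d.laterLeaves (x :: st'))) := by
  refine Exec.mono (exec_while (t := d.seekTime + 2) (fun r σ' =>
      (σ' aOk 0 = 0 ∧ ∃ st', d.At st' σ' ∧ r = st'.length ∧ d.laterLeaves st = d.laterLeaves st') ∨
      (σ' aOk 0 = 1 ∧ ∃ x st', d.At st' σ' ∧
        st'.length < d.n ∧ x < d.M ∧ d.IsChild st' x ∧ σ' aX st'.length = x ∧
        d.laterLeaves st = d.leavesFrom (x :: st') ++ d.laterLeaves (x :: st')))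
      ?_ st.length σ (.inl ⟨hok, st, h, rfl, rfl⟩)) ?_ ?_
  · rintro r s1 (⟨i1, st', i2, rfl, i3⟩ | ⟨i1, -⟩) hb
    swap
    · simp [i1] at hb
    simp only [eval_and, eval_lt, eval_eq, scal_eval, Expr.eval,
      i2.depth] at hb
    cases st' with
    | nil => simp at hb
    | cons x st' =>
    have hn : st'.length < d.n := i2.le
    have hxX : s1 aX st'.length = x := i2.path.1
    have hdep : s1 aI 0 = st'.length + 1 := i2.depth
    refine ⟨_, Nat.lt_succ_self st'.length, ?_⟩
    refine Exec.mono (t := 2 + d.seekTime) ((exec_straight (p := .seq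
      (setScal aI (.pred (scal aI))) (.assign aX (scal aI) (.succ (entry aX aI)))) rfl s1).seq ?_)
      (by omega) (fun _ h => h)
    intro s2 p2 f2
    simp (disch := decide) only [Program.eff, setScal_eff, scal_eval, Expr.eval, entry_eval, hdep,
      Nat.add_sub_cancel, store_same, store_ne, Function.update_self, hxX] at p2
    have eX : s2 aX st'.length = x + 1 := by rw [p2]; simp
    have a2 : d.At st' s2 := by
      refine ⟨i2.stored.of_frame f2 rfl, ?_, ?_, hn.le, i2.valid.2.2⟩
      · rw [p2, store_same, store_ne (by decide)]
        exact i2.path.2.congr fun j hj => by rw [Function.update_of_ne hj.ne]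
      · rw [p2]; simp
    refine (a2.exec_seek (by rw [eX]; exact i2.valid.1)).mono le_rfl ?_
    rintro s3 ⟨q1, q2⟩
    rw [eX] at q2
    rcases q2 with ⟨q3, q4, q5, q6, q7⟩ | ⟨q3, q4⟩
    · exact .inr ⟨q3, s3 aX st'.length, st', q1, hn, q4, q6, rfl, i3.trans
        (later_next q5 q4 q7 q6)⟩
    · refine .inl ⟨q3, st', q1, rfl, ?_⟩
      rw [i3]; exact later_none q4
  · have : st.length * (d.seekTime + 2 + 1) ≤ d.n * (d.seekTime + 2 + 1) :=
      Nat.mul_le_mul_right _ h.le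
    omega
  · rintro s1 ⟨hb, r, -, ⟨i1, st', i2, -, i3⟩ | ⟨i1, i2⟩⟩
    · left
      simp only [← Bool.not_eq_true, eval_and, eval_lt, eval_eq, scal_eval, Expr.eval,
        i2.depth, i1, and_true, not_lt, Nat.le_zero, List.length_eq_zero_iff] at hb
      subst hb
      exact ⟨i1, i3⟩
    · exact .inr ⟨i1, i2⟩

theorem At.exec_next (hd : d.Ok) (h : d.At st σ) :
    Exec (next d.k) σ d.nextTime (fun σ' =>
      (d.laterLeaves st = [] ∧ σ' aDone 0 = 1) ∨
      (∃ st', d.At st' σ' ∧ st'.length = d.n ∧ σ' aDone 0 = σ aDone 0 ∧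
        d.laterLeaves st = st' :: d.laterLeaves st')) := by
  refine Exec.mono (t := 1 + ((d.n * (d.seekTime + 2 + 1) + 1) + (1 + d.descendTime + 1)))
    ((exec_straight (p := setScal aOk (.const 0)) rfl σ).seq ?_) (by rw [nextTime]; omega)
    (fun _ h => h)
  intro s1 p1 f1
  refine ((h.of_frame f1 rfl rfl rfl).exec_backtrack (by rw [p1]; simp)).seq ?_
  rintro s2 q2 f2
  refine Exec.ite (fun hb => ?_) (fun hb => ?_)
  · rw [eval_eq] at hb
    rcases q2 with ⟨q2, -⟩ | ⟨-, x, st', q3, q4, q5, q6, q7, q8⟩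
    · simp [q2] at hb
    refine (exec_straight (p := setScal aI (.succ (scal aI))) rfl s2).seq ?_
    intro s3 p3 f3
    have a3 : d.At (x :: st') s3 := q3.cons q4 q5 q6 q7 (by
      rw [p3, setScal_eff, Expr.eval, scal_eval, q3.depth])
    refine (a3.exec_descend hd).frame.mono le_rfl ?_
    rintro s4 ⟨⟨st'', r1, r2, r3⟩, f4⟩
    refine .inr ⟨st'', r1, r2, ?_, q8.trans r3⟩
    rw [f4 _ rfl, f3 _ rfl, f2 _ rfl, f1 _ rfl]
  · rw [← Bool.not_eq_true, eval_eq] at hb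
    rcases q2 with ⟨-, q2⟩ | ⟨q2, -⟩
    · refine Exec.of_eff rfl (Nat.le_add_right 1 _ |>.trans le_rfl) (.inl ⟨q2, ?_⟩)
      simp
    · simp [q2] at hb

end Data

/-! ### Output -/

/-- Write the marked variables. -/
def writeMarked : Program :=
  forLoop aInner numVars (.ite (.lt (.const 0) (entry aMem aInner)) (.write (scal aInner)) .skip)

/-- Write the current leaf. -/
def output (k : ℕ) : Program :=
  .seq (fill aMem numVars (.const 0)) (.seq (markPrefix k numVars) writeMarked)

theorem symbols_append (l l' : List Event) : symbols (l ++ l') = symbols l ++ symbols l' := by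
  simp [symbols]

theorem symbols_silent {l : List Event} (h : ∀ e ∈ l, e = .silent) : symbols l = [] := by
  rw [symbols, List.filterMap_eq_nil_iff]
  intro e he
  rw [h e he]

theorem not_mem_silent {l : List Event} (h : ∀ e ∈ l, e = .silent) : Event.itemEnd ∉ l :=
  fun he => by simpa using h _ he

theorem silent_append {l : List Event} (h : ∀ e ∈ l, e = .silent) :
    ∀ e ∈ l ++ [Event.silent], e = .silent := by
  intro e he
  rcases List.mem_append.1 he with he | he
  exacts [h e he, List.mem_singleton.1 he]

/-- Since `Exec` covers only silent runs, the trace of the output loop is computed directly, by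
induction on the rounds left. -/
theorem run_writeMarked {σ : Memory} {n : ℕ} (hn : σ aIn 0 = n) :
    ∃ σ' tr, Run writeMarked σ σ' tr ∧ Event.itemEnd ∉ tr ∧
      symbols tr = (List.range n).filter (fun v => 0 < σ aMem v) ∧ tr.length ≤ n * 4 + 2 := by
  set body : Program := .ite (.lt (.const 0) (entry aMem aInner)) (.write (scal aInner)) .skip
  have key : ∀ (r : ℕ) (s : Memory), s aInner 0 + r = n → s aIn = σ aIn → s aMem = σ aMem →
      ∃ σ' tr, Run (.while (.lt (scal aInner) numVars)
        (.seq body (.assign aInner (.const 0) (.succ (scal aInner))))) s σ' tr ∧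
        Event.itemEnd ∉ tr ∧
        symbols tr = (List.range' (s aInner 0) r).filter (fun v => 0 < σ aMem v) ∧
        tr.length ≤ r * 4 + 1 := by
    intro r
    induction r with
    | zero =>
      intro s h1 h2 h3
      refine ⟨s, [.silent], .while_false ?_, by simp, by simp [symbols], by simp⟩
      rw [← Bool.not_eq_true, eval_lt, scal_eval, numVars_eval, h2, hn]
      omega
    | succ r ih =>
      intro s h1 h2 h3
      obtain ⟨s', tr, k1, k2, k3, k4⟩ := ih (store s aInner 0 (s aInner 0 + 1))
        (by rw [store_same, Function.update_self]; omega) h2 h3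
      rw [store_same, Function.update_self] at k3
      have hb : ∃ tb, Run body s s tb ∧ Event.itemEnd ∉ tb ∧ tb.length ≤ 2 ∧
          symbols tb = if 0 < σ aMem (s aInner 0) then [s aInner 0] else [] := by
        by_cases h0 : 0 < σ aMem (s aInner 0)
        · refine ⟨_, .ite_true ?_ (.write s _), by simp, by simp, by simp [symbols, h0]⟩
          rw [eval_lt, entry_eval, h3]; exact h0
        · refine ⟨_, .ite_false ?_ (.skip s), by simp, by simp, by simp [symbols, h0]⟩
          rw [← Bool.not_eq_true, eval_lt, entry_eval, h3]; exact h0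
      obtain ⟨tb, b1, b2, b3, b4⟩ := hb
      refine ⟨s', _, .while_true ?_ (.seq b1 (.assign s aInner (.const 0) (.succ (scal aInner)))) k1,
        ?_, ?_, ?_⟩
      · rw [eval_lt, scal_eval, numVars_eval, h2, hn]; omega
      · simp [b2, k2]
      · rw [List.range'_succ, List.filter_cons]
        change symbols ([Event.silent] ++ ((tb ++ [Event.silent]) ++ tr)) = _
        rw [symbols_append, symbols_append, symbols_append, k3, b4]
        by_cases h0 : 0 < σ aMem (s aInner 0) <;> simp [symbols, h0]
      · simp only [List.length_cons, List.length_append, List.length_nil]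
        omega
  obtain ⟨s', tr, k1, k2, k3, k4⟩ := key n (store σ aInner 0 0) (by simp) rfl rfl
  refine ⟨s', _, .seq (.assign σ aInner (.const 0) (.const 0)) k1, by simp [k2], ?_, ?_⟩
  · rw [symbols_append, k3, List.range_eq_range']
    simp [symbols]
  · simp only [List.length_append, List.length_singleton]; omega

namespace Data

/-- The output for the leaf `st`. -/
def item (d : Data) (st : List ℕ) : List ℕ :=
  (List.range d.n).filter (fun v => v ∈ setOf d.cand st)

def outputTime (d : Data) : ℕ := d.n * 7 + d.n * (d.k * 5 + 5) + 6

variable {d : Data} {st : List ℕ} {σ : Memory}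

theorem At.run_output (h : d.At st σ) (hn : st.length = d.n) :
    ∃ σ' tr, Run (output d.k) σ σ' tr ∧ Event.itemEnd ∉ tr ∧ symbols tr = d.item st ∧
      tr.length ≤ d.outputTime ∧ d.At st σ' ∧ σ' aDone = σ aDone := by
  obtain ⟨s1, t1, r1, e1, l1, q1, f1⟩ := (exec_fill (a := aMem) (e := numVars) (v := .const 0)
    (N := d.n) (w := 0) (σ := σ) rfl
    (fun σ' h' => by
      rw [numVars_eval, h' _ (by decide) (by decide), h.stored.input.vars]) (fun _ _ => rfl)).frame
  have a1 : d.At st s1 := h.of_frame f1 rfl rfl rfl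
  obtain ⟨s2, t2, r2, e2, l2, q2, f2⟩ := (exec_markPrefix (k := d.k) (e := numVars) (i := d.n)
    a1.stored.table
    (fun σ' h' => by
      rw [numVars_eval, h' _ rfl, a1.stored.input.vars])
    (fun j hj => a1.path.lt a1.valid j (hn ▸ hj))).frame
  have a2 : d.At st s2 := a1.of_frame f2 rfl rfl rfl
  obtain ⟨s3, t3, r3, e3, y3, l3⟩ := run_writeMarked a2.stored.input.vars
  have f3 : ∀ a, writeMarked.touches a = false → s3 a = s2 a := fun a ha => r3.frame ha
  refine ⟨s3, _, .seq r1 (.seq r2 r3), ?_, ?_, ?_, a2.of_frame f3 rfl rfl rfl, ?_⟩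
  · simp only [List.mem_append, not_or]
    exact ⟨not_mem_silent e1, not_mem_silent e2, e3⟩
  · rw [symbols_append, symbols_append, symbols_silent e1, symbols_silent e2, y3, item]
    refine List.filter_congr fun v hv => ?_
    rw [q2 v, q1 v (List.mem_range.1 hv), a1.path.setOf_eq, hn]
    split_ifs with h1 <;> simp [h1]
  · simp only [List.length_append, outputTime]; omega
  · rw [f3 _ rfl, f2 _ rfl, f1 _ rfl]

end Data

theorem outputsWithDelay_nil {D : ℕ} {tr : List Event} (h : ∀ e ∈ tr, e = .silent)
    (hl : tr.length ≤ D) : OutputsWithDelay D tr [] :=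
  ⟨[], tr, by simp, by simp, ⟨not_mem_silent h, hl⟩, rfl, symbols_silent h⟩

theorem OutputsWithDelay.cons {D : ℕ} {b tr : List Event} {items : List (List ℕ)}
    (h : OutputsWithDelay D tr items) (hb : Event.itemEnd ∉ b) (hl : b.length + 1 ≤ D) :
    OutputsWithDelay D (b ++ .itemEnd :: tr) (symbols b :: items) := by
  obtain ⟨blocks, rest, rfl, h2, h3, rfl, h5⟩ := h
  exact ⟨b :: blocks, rest, by simp, by simpa using ⟨⟨hb, hl⟩, h2⟩, h3, rfl, h5⟩

/-- Output the leaves one after the other. -/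
def enumerate (k : ℕ) : Program :=
  .while (.eq (scal aDone) (.const 0)) (.seq (output k) (.seq .endItem (next k)))

/-- The steps before an item come from the preparation for the first item and from the call of
`next` in the previous round for all others. Quantifying over a silent prefix `pre` of length at
most `T` treats both alike. The summand `2` in the bound on `D` pays for the loop test and
`endItem`. -/
theorem Data.At.run_enumerate {d : Data} (hd : d.Ok) {D T : ℕ} (hT : d.nextTime ≤ T)
    (hD : T + d.outputTime + 2 ≤ D) (ls : List (List ℕ)) :
    ∀ {st : List ℕ} {σ : Memory}, d.At st σ → st.length = d.n → σ aDone 0 = 0 →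
      d.laterLeaves st = ls → ∃ σ' tr, Run (enumerate d.k) σ σ' tr ∧
        ∀ pre : List Event, (∀ e ∈ pre, e = .silent) → pre.length ≤ T →
          OutputsWithDelay D (pre ++ tr) ((st :: ls).map d.item) := by
  induction ls with
  | nil =>
    intro st σ h hn h0 hl
    obtain ⟨s1, t1, r1, e1, y1, l1, a1, d1⟩ := h.run_output hn
    obtain ⟨s2, t2, r2, e2, l2, q2⟩ := a1.exec_next hd
    rcases q2 with ⟨-, q2⟩ | ⟨st', -, -, -, q2⟩
    swap
    · rw [hl] at q2; simp at q2
    have r3 : Run (enumerate d.k) s2 s2 [.silent] := .while_false (by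
      rw [← Bool.not_eq_true, eval_eq, scal_eval, q2]; simp [Expr.eval])
    refine ⟨s2, _, .while_true ?_ (.seq r1 (.seq (.endItem s1) r2)) r3, fun pre hp hpl => ?_⟩
    · rw [eval_eq, scal_eval, h0]; rfl
    have hs := silent_append hp
    have := (outputsWithDelay_nil (D := D) (tr := t2 ++ [.silent]) (silent_append e2)
      (by simp; omega)).cons (b := (pre ++ [.silent]) ++ t1)
      (by rw [List.mem_append, not_or]; exact ⟨not_mem_silent hs, e1⟩)
      (by simp; omega)
    rw [symbols_append, symbols_silent hs, y1] at this
    simpa using this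
  | cons st₁ ls ih =>
    intro st σ h hn h0 hl
    obtain ⟨s1, t1, r1, e1, y1, l1, a1, d1⟩ := h.run_output hn
    obtain ⟨s2, t2, r2, e2, l2, q2⟩ := a1.exec_next hd
    rcases q2 with ⟨q2, -⟩ | ⟨st', b1, b2, b3, b4⟩
    · rw [hl] at q2; simp at q2
    rw [hl, List.cons.injEq] at b4
    obtain ⟨rfl, b4⟩ := b4
    obtain ⟨s3, t3, r3, k3⟩ := ih b1 b2 (by rw [b3, d1, h0]) b4.symm
    refine ⟨s3, _, .while_true ?_ (.seq r1 (.seq (.endItem s1) r2)) r3, fun pre hp hpl => ?_⟩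
    · rw [eval_eq, scal_eval, h0]; rfl
    have hs := silent_append hp
    have := (k3 t2 e2 (l2.trans hT)).cons (b := (pre ++ [.silent]) ++ t1)
      (by rw [List.mem_append, not_or]; exact ⟨not_mem_silent hs, e1⟩)
      (by simp; omega)
    rw [symbols_append, symbols_silent hs, y1] at this
    simpa using this

/-! ### The prime CNF of the dual function -/

/-- `c` meets all clauses of `φ`, and each of its elements is needed. -/
def IsMinTransversal {n : ℕ} (φ : MonotoneCNF n) (c : Finset (Fin n)) : Prop :=
  (∀ C ∈ φ, (C ∩ c).Nonempty) ∧ ∀ v ∈ c, ∃ C ∈ φ, C ∩ c = {v}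

section

variable {n : ℕ} {φ : MonotoneCNF n}

theorem clauseFn_eq_true {P N : Finset (Fin n)} {v : Fin n → Bool} :
    clauseFn P N v = true ↔ (∃ i ∈ P, v i = true) ∨ ∃ i ∈ N, v i = false := by
  simp [clauseFn]

theorem dual_cnfFn_eq_true {v : Fin n → Bool} :
    dual (cnfFn φ) v = true ↔ ∃ C ∈ φ, ∀ i ∈ C, v i = true := by
  simp [dual, cnfFn, clauseFn]

theorem le_iff_imp {f g : BoolFn n} : f ≤ g ↔ ∀ v, f v = true → g v = true := by
  simp only [Pi.le_def, Bool.le_iff_imp]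

theorem dual_le_clauseFn {c : Finset (Fin n)} :
    dual (cnfFn φ) ≤ clauseFn c ∅ ↔ ∀ C ∈ φ, (C ∩ c).Nonempty := by
  rw [le_iff_imp]
  constructor
  · intro h C hC
    -- The characteristic vector of `C` satisfies the dual function, so a clause that is an
    -- implicate must contain an element of `C`.
    have := h (fun i => decide (i ∈ C)) (dual_cnfFn_eq_true.2 ⟨C, hC, by simp⟩)
    rw [clauseFn_eq_true] at this
    rcases this with ⟨i, hi, hiC⟩ | ⟨i, hi, -⟩
    · exact ⟨i, Finset.mem_inter.2 ⟨by simpa using hiC, hi⟩⟩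
    · simp at hi
  · intro h v hv
    obtain ⟨C, hC, hCv⟩ := dual_cnfFn_eq_true.1 hv
    obtain ⟨i, hi⟩ := h C hC
    rw [Finset.mem_inter] at hi
    exact clauseFn_eq_true.2 (.inl ⟨i, hi.2, hCv i hi.1⟩)

theorem clauseFn_le_clauseFn {P c : Finset (Fin n)} : clauseFn P ∅ ≤ clauseFn c ∅ ↔ P ⊆ c := by
  rw [le_iff_imp]
  constructor
  · intro h i hi
    have := h (fun j => decide (j = i)) (clauseFn_eq_true.2 (.inl ⟨i, hi, by simp⟩))
    rw [clauseFn_eq_true] at this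
    simpa using this
  · intro h v hv
    rw [clauseFn_eq_true] at hv ⊢
    rcases hv with ⟨i, hi, hv⟩ | ⟨i, hi, -⟩
    · exact .inl ⟨i, h hi, hv⟩
    · simp at hi

/-- The monotone implicates of the dual are the transversals, and erasing an element makes a clause
strictly smaller, so primality is minimality. Clauses with negative literals do not matter. -/
theorem isPrimeImplicate_dual {c : Finset (Fin n)} :
    IsPrimeImplicate (dual (cnfFn φ)) c ↔ IsMinTransversal φ c := by
  rw [IsPrimeImplicate, IsMinTransversal, dual_le_clauseFn]
  refine and_congr_right fun hc => ⟨fun h v hv => ?_, fun h P N hPN hle hlt => ?_⟩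
  · by_contra hno
    push Not at hno
    refine h (c.erase v) ∅ (by simp) (dual_le_clauseFn.2 fun C hC => ?_) ?_
    · by_contra hemp
      refine hno C hC (Finset.eq_singleton_iff_nonempty_unique_mem.2 ⟨hc C hC, fun u hu => ?_⟩)
      by_contra huv
      rw [Finset.mem_inter] at hu
      exact hemp ⟨u, Finset.mem_inter.2 ⟨hu.1, Finset.mem_erase.2 ⟨huv, hu.2⟩⟩⟩
    · rw [lt_iff_le_not_ge, clauseFn_le_clauseFn, clauseFn_le_clauseFn]
      exact ⟨Finset.erase_subset _ _, fun h => by simpa using h hv⟩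
  -- At the all-false point a negative literal is true while the monotone clause `c` is false.
  · have hN : N = ∅ := by
      by_contra hN
      obtain ⟨i, hi⟩ := Finset.nonempty_iff_ne_empty.2 hN
      have := le_iff_imp.1 hlt.le (fun _ => false) (clauseFn_eq_true.2 (.inr ⟨i, hi, rfl⟩))
      rw [clauseFn_eq_true] at this
      simp at this
    subst hN
    rw [lt_iff_le_not_ge, clauseFn_le_clauseFn, clauseFn_le_clauseFn] at hlt
    refine hlt.2 fun v hv => ?_
    obtain ⟨C, hC, hCv⟩ := h v hv
    obtain ⟨u, hu⟩ := dual_le_clauseFn.1 hle C hC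
    rw [Finset.mem_inter] at hu
    have : u ∈ C ∩ c := Finset.mem_inter.2 ⟨hu.1, hlt.1 hu.2⟩
    rw [hCv, Finset.mem_singleton] at this
    exact this ▸ hu.2

theorem exists_isMinTransversal {T : Finset (Fin n)} (hT : ∀ C ∈ φ, (C ∩ T).Nonempty) :
    ∃ c ⊆ T, IsMinTransversal φ c := by
  classical
  obtain ⟨c, hc, hmin⟩ := (T.powerset.filter
    (fun c => ∀ C ∈ φ, (C ∩ c).Nonempty)).exists_min_image Finset.card ⟨T, by simpa using hT⟩
  rw [Finset.mem_filter, Finset.mem_powerset] at hc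
  refine ⟨c, hc.1, hc.2, fun v hv => ?_⟩
  by_contra hno
  push Not at hno
  have := hmin (c.erase v) (by
    rw [Finset.mem_filter, Finset.mem_powerset]
    refine ⟨(Finset.erase_subset _ _).trans hc.1, fun C hC => ?_⟩
    by_contra hemp
    refine hno C hC (Finset.eq_singleton_iff_nonempty_unique_mem.2 ⟨hc.2 C hC, fun u hu => ?_⟩)
    by_contra huv
    rw [Finset.mem_inter] at hu
    exact hemp ⟨u, Finset.mem_inter.2 ⟨hu.1, Finset.mem_erase.2 ⟨huv, hu.2⟩⟩⟩)
  exact absurd (Finset.card_erase_lt_of_mem hv) (not_lt.2 this)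

/-- If no clause of `φ` is entirely true at `v`, the false variables form a transversal; a minimal
one inside it is a clause of `ψ` violated at `v`. -/
theorem isPrimeCNFOf_dual {ψ : MonotoneCNF n} (hψ : ∀ c, c ∈ ψ ↔ IsMinTransversal φ c) :
    IsPrimeCNFOf ψ (dual (cnfFn φ)) := by
  refine ⟨?_, fun c => by rw [hψ, isPrimeImplicate_dual]⟩
  funext v
  rw [Bool.eq_iff_iff, dual_cnfFn_eq_true]
  simp only [cnfFn, decide_eq_true_eq, clauseFn_eq_true]
  constructor
  · intro h
    by_contra hno
    push Not at hno
    obtain ⟨c, hc, hm⟩ := exists_isMinTransversal (φ := φ)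
      (T := Finset.univ.filter (fun i => v i = false)) (fun C hC => by
        obtain ⟨i, hi, hv⟩ := hno C hC
        exact ⟨i, by simpa [hi] using hv⟩)
    rcases h c ((hψ c).2 hm) with ⟨i, hi, hv⟩ | ⟨i, hi, -⟩
    · have := hc hi
      simp [hv] at this
    · simp at hi
  · rintro ⟨C, hC, hCv⟩ c hc
    obtain ⟨i, hi⟩ := ((hψ c).1 hc).1 C hC
    rw [Finset.mem_inter] at hi
    exact .inl ⟨i, hi.2, hCv i hi.1⟩

/-- An empty clause would make the function constantly false, and then no clause containing a
variable is prime; but the variable `0` occurs. -/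
theorem IsPrime.nonempty (hφ : IsPrime φ) (ha : AllOccur φ) (hn : 0 < n) {C : Finset (Fin n)}
    (hC : C ∈ φ) : C.Nonempty := by
  rw [Finset.nonempty_iff_ne_empty]
  rintro rfl
  obtain ⟨c, hc, hv⟩ := ha ⟨0, hn⟩
  refine (hφ c hc).2 ∅ ∅ (by simp) (le_iff_imp.2 fun v hv => ?_) ?_
  · simp only [cnfFn, decide_eq_true_eq] at hv
    exact hv ∅ hC
  · rw [lt_iff_le_not_ge, clauseFn_le_clauseFn, clauseFn_le_clauseFn]
    exact ⟨by simp, fun h => by simpa using h hv⟩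

/-! ### Listed CNFs -/

/-- The number of the clause with number `c`. -/
def clauseOf (L : List (List (Fin n))) (c : ℕ) : Finset ℕ :=
  ((L.map (fun l => l.map Fin.val)).getD c []).toFinset

variable {L : List (List (Fin n))}

theorem clauseOf_eq {c : ℕ} (hc : c < L.length) :
    clauseOf L c = (L[c].toFinset).image Fin.val := by
  ext v
  simp [clauseOf, hc]

theorem val_mem_clauseOf {c : ℕ} (hc : c < L.length) {v : Fin n} :
    v.val ∈ clauseOf L c ↔ v ∈ L[c].toFinset := by
  rw [clauseOf_eq hc, Finset.mem_image]
  constructor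
  · rintro ⟨u, hu, h⟩
    rwa [← Fin.val_injective h]
  · exact fun h => ⟨v, h, rfl⟩

theorem Lists.mem (hL : Lists L φ) {C : Finset (Fin n)} :
    C ∈ φ ↔ ∃ (c : ℕ) (hc : c < L.length), L[c].toFinset = C := by
  rw [← hL.2.2, List.mem_toFinset, List.mem_map]
  simp only [List.mem_iff_getElem]
  constructor
  · rintro ⟨l, ⟨c, hc, rfl⟩, h⟩; exact ⟨c, hc, h⟩
  · rintro ⟨c, hc, h⟩; exact ⟨_, ⟨c, hc, rfl⟩, h⟩

theorem Lists.inj (hL : Lists L φ) {c c' : ℕ} (hc : c < L.length) (hc' : c' < L.length)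
    (h : L[c].toFinset = L[c'].toFinset) : c = c' := by
  have h1 : (L.map List.toFinset)[c]'(by simpa using hc) =
      (L.map List.toFinset)[c']'(by simpa using hc') := by simpa using h
  exact (hL.2.1.getElem_inj_iff).1 h1

theorem Lists.length_eq (hL : Lists L φ) :
    (occurrences (L.map (fun l => l.map Fin.val)) L.length).length = length φ := by
  rw [length, ← hL.2.2, List.sum_toFinset _ hL.2.1, occurrences, List.length_flatMap, List.map_map]
  congr 1
  apply List.ext_getElem
  · simp
  · intro c h1 h2
    have hc : c < L.length := by simpa using h1
    have := hL.1 _ (List.getElem_mem hc)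
    simp [hc, List.toFinset_card_of_nodup this]

/-- Take the last variable, in the degenerate ordering, that occurs in `U`. The clauses of `U` at it
contain no later variable, so they all belong to its `Delta`. -/
theorem Lists.lowDegree (hL : Lists L φ) {k : ℕ} (hφ : IsDegenerate k φ)
    (hne : ∀ C ∈ φ, C.Nonempty) : LowDegree k n L.length (clauseOf L) := by
  classical
  obtain ⟨x, hx⟩ := hφ
  intro U hU hUn
  have hne' : (Finset.univ.filter (fun i : Fin n => ∃ c ∈ U, (x i).val ∈ clauseOf L c)).Nonempty := by
    obtain ⟨c, hc⟩ := hUn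
    have hcm := Finset.mem_range.1 (hU hc)
    obtain ⟨v, hv⟩ := hne _ (hL.mem.2 ⟨c, hcm, rfl⟩)
    refine ⟨x.symm v, ?_⟩
    simp only [Finset.mem_filter, Finset.mem_univ, true_and, Equiv.apply_symm_apply]
    exact ⟨c, hc, (val_mem_clauseOf hcm).2 hv⟩
  obtain ⟨i, hi, hmax⟩ := Finset.exists_max_image _ id hne'
  simp only [Finset.mem_filter, Finset.mem_univ, true_and] at hi
  obtain ⟨c₀, hc₀, hic₀⟩ := hi
  refine ⟨x i, (x i).isLt, Finset.card_pos.2 ⟨c₀, Finset.mem_filter.2 ⟨hc₀, hic₀⟩⟩, ?_⟩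
  refine le_trans (Finset.card_le_card_of_injOn
    (fun c => if h : c < L.length then L[c].toFinset else ∅) ?_ ?_) (hx i)
  · intro c hc
    rw [Finset.mem_coe, Finset.mem_filter] at hc
    have hcm := Finset.mem_range.1 (hU hc.1)
    simp only [Finset.mem_coe, dif_pos hcm]
    rw [Delta, Finset.mem_sdiff, fixTail, fixTail, Finset.mem_filter,
      Finset.mem_filter]
    have hmem : L[c].toFinset ∈ φ := hL.mem.2 ⟨c, hcm, rfl⟩
    refine ⟨⟨hmem, fun j hj hxj => ?_⟩, fun h => ?_⟩
    · have := hmax j (by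
        simp only [Finset.mem_filter, Finset.mem_univ, true_and]
        exact ⟨c, hc.1, (val_mem_clauseOf hcm).2 hxj⟩)
      simp only [id, Fin.le_def] at this
      omega
    · exact h.2 i le_rfl ((val_mem_clauseOf hcm).1 hc.2)
  · intro c hc c' hc' h
    rw [Finset.mem_coe, Finset.mem_filter] at hc hc'
    have hcm := Finset.mem_range.1 (hU hc.1)
    have hcm' := Finset.mem_range.1 (hU hc'.1)
    simp only [dif_pos hcm, dif_pos hcm'] at h
    exact hL.inj hcm hcm' h

/-- When all layers lie below `i`, the layer conditions are void and only the passage from `Fin n`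
to `ℕ` remains. -/
theorem Lists.minTr_iff (hL : Lists L φ) {lv : ℕ → ℕ} {i : ℕ} (hlv : ∀ c < L.length, lv c < i)
    (T : Finset (Fin n)) :
    MinTr L.length (clauseOf L) lv i (T.image Fin.val) ↔ IsMinTransversal φ T := by
  have hint : ∀ c (hc : c < L.length), clauseOf L c ∩ T.image Fin.val =
      (L[c].toFinset ∩ T).image Fin.val := fun c hc => by
    rw [clauseOf_eq hc, Finset.image_inter _ _ Fin.val_injective]
  constructor
  · rintro ⟨h1, h2⟩
    refine ⟨fun C hC => ?_, fun v hv => ?_⟩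
    · obtain ⟨c, hc, rfl⟩ := hL.mem.1 hC
      have := h1 c hc (hlv c hc)
      rwa [hint c hc, Finset.image_nonempty] at this
    · obtain ⟨c, hc, -, h⟩ := h2 v.val (Finset.mem_image_of_mem _ hv)
      refine ⟨_, hL.mem.2 ⟨c, hc, rfl⟩, ?_⟩
      rw [hint c hc, ← Finset.image_singleton] at h
      exact Finset.image_injective Fin.val_injective h
  · rintro ⟨h1, h2⟩
    refine ⟨fun c hc _ => ?_, fun v hv => ?_⟩
    · rw [hint c hc, Finset.image_nonempty]
      exact h1 _ (hL.mem.2 ⟨c, hc, rfl⟩)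
    · obtain ⟨u, hu, rfl⟩ := Finset.mem_image.1 hv
      obtain ⟨C, hC, h⟩ := h2 u hu
      obtain ⟨c, hc, rfl⟩ := hL.mem.1 hC
      exact ⟨c, hc, hlv c hc, by rw [hint c hc, h, Finset.image_singleton]⟩

end

/-! ### The algorithm -/

/-- Prepare the search and go to the first leaf. -/
def prepare (k : ℕ) : Program :=
  .seq (makeTable k) (.seq (findLayers k) (.seq (setScal aI (.const 0))
    (.seq (descend k) (setScal aDone (.const 0)))))

/-- Output the minimal transversals of the hypergraph of the clauses. -/
def dualize (k : ℕ) : Program :=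
  .seq parse (.ite (.lt (.const 0) numVars) (.seq (prepare k) (enumerate k))
    (.ite (.eq numClauses (.const 0)) .endItem .skip))

/-- A bound for the time of the search for a child, in units of `N * n ^ k`. -/
def seekConst (k : ℕ) : ℕ := (k + 2) * (11 * k + 73) + 2

section

variable {k n m N M : ℕ} {cl : ℕ → Finset ℕ} {σ : Memory}

theorem Data.seekTime_le {d : Data} (hn : 1 ≤ d.n) (hnN : d.n ≤ d.N) (hmN : d.m ≤ d.N)
    (hM : d.M ≤ (d.k + 1) * d.n ^ d.k) : d.seekTime ≤ seekConst d.k * (d.N * d.n ^ d.k) := by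
  have hp : 1 ≤ d.n ^ d.k := Nat.one_le_pow _ _ hn
  -- With `n`, `m` and `1` bounded by `N`, the constants are `11 = 6 + 5` and `73 = 15 + 18 + 8 + 5
  -- + 24 + 3`.
  have h1 : d.testTime + 2 + 1 ≤ (11 * d.k + 73) * d.N := by
    have : d.n * (d.k * 5 + 5) ≤ d.N * (d.k * 5 + 5) := Nat.mul_le_mul_right _ hnN
    have : d.k * 6 * 1 ≤ d.k * 6 * d.N := Nat.mul_le_mul_left _ (hn.trans hnN)
    rw [testTime]
    nlinarith
  have h2 : d.M + 1 ≤ (d.k + 2) * d.n ^ d.k := by nlinarith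
  have h3 : 1 * 1 ≤ d.N * d.n ^ d.k := Nat.mul_le_mul (hn.trans hnN) hp
  calc d.seekTime ≤ ((d.k + 2) * d.n ^ d.k) * ((11 * d.k + 73) * d.N) + 2 * (d.N * d.n ^ d.k) := by
        rw [seekTime]
        have := Nat.mul_le_mul h2 h1
        omega
    _ = seekConst d.k * (d.N * d.n ^ d.k) := by rw [seekConst]; ring

theorem Data.descendTime_le {d : Data} (hn : 1 ≤ d.n) (hnN : d.n ≤ d.N) (hmN : d.m ≤ d.N)
    (hM : d.M ≤ (d.k + 1) * d.n ^ d.k) :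
    d.descendTime ≤ (seekConst d.k + 4) * (d.N * d.n ^ (d.k + 1)) := by
  have h1 := d.seekTime_le hn hnN hmN hM
  have hp : 1 ≤ d.n ^ d.k := Nat.one_le_pow _ _ hn
  have h3 : 1 * 1 ≤ d.N * d.n ^ d.k := Nat.mul_le_mul (hn.trans hnN) hp
  have h4 : d.n * (d.seekTime + 2 + 1) ≤ d.n * ((seekConst d.k + 3) * (d.N * d.n ^ d.k)) :=
    Nat.mul_le_mul_left _ (by nlinarith)
  have h5 : 1 * 1 ≤ d.n * (d.N * d.n ^ d.k) := Nat.mul_le_mul hn (by omega)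
  have h6 : d.N * d.n ^ (d.k + 1) = d.n * (d.N * d.n ^ d.k) := by ring
  rw [descendTime, h6]
  nlinarith

theorem Data.nextTime_le {d : Data} (hn : 1 ≤ d.n) (hnN : d.n ≤ d.N) (hmN : d.m ≤ d.N)
    (hM : d.M ≤ (d.k + 1) * d.n ^ d.k) :
    d.nextTime ≤ (2 * seekConst d.k + 11) * (d.N * d.n ^ (d.k + 1)) := by
  have h1 := d.descendTime_le hn hnN hmN hM
  have h2 : 1 * 1 ≤ d.N * d.n ^ (d.k + 1) :=
    Nat.mul_le_mul (hn.trans hnN) (Nat.one_le_pow _ _ hn)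
  -- Backtracking costs one step less than the bound for a descent, so the total is twice
  -- `descendTime` plus `3`, and `2 * (seekConst k + 4) + 3` gives the constant.
  rw [nextTime]
  rw [descendTime] at h1 ⊢
  nlinarith

theorem exec_prepare (hI : Input n m N cl σ) (hk : 1 ≤ k) (hn : 1 ≤ n) (hnN : n ≤ N) (hmN : m ≤ N)
    (hd : LowDegree k n m cl) (hne : ∀ c < m, (cl c).Nonempty) :
    Exec (prepare k) σ ((seekConst k + 7 * k + 70) * (N * n ^ (k + 1))) (fun σ' =>
      ∃ (M : ℕ) (cand : ℕ → Finset ℕ) (lv : ℕ → ℕ) (st : List ℕ),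
        Data.Ok ⟨k, n, m, N, M, cl, cand, lv⟩ ∧ M ≤ (k + 1) * n ^ k ∧ (∀ c < m, lv c < n) ∧
        Data.At ⟨k, n, m, N, M, cl, cand, lv⟩ st σ' ∧ st.length = n ∧ σ' aDone 0 = 0 ∧
        leaves M (Child m cl lv cand) n [] =
          st :: Data.laterLeaves ⟨k, n, m, N, M, cl, cand, lv⟩ st) := by
  have hnk : 1 ≤ n ^ k := Nat.one_le_pow _ _ hn
  have hb1 : n ≤ n ^ (k + 1) := by rw [pow_succ]; nlinarith
  have hb2 : N * n ≤ N * n ^ (k + 1) := Nat.mul_le_mul_left _ hb1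
  have hb3 : N * 1 ≤ N * n := Nat.mul_le_mul_left _ hn
  have hb4 : n * n ≤ N * n := Nat.mul_le_mul_right _ hnN
  have hb5 : 1 * n ^ (k + 1) ≤ N * n ^ (k + 1) := Nat.mul_le_mul_right _ (hn.trans hnN)
  refine Exec.mono (t := (n * ((k + 1) * n ^ k * 7 + 5) + 4) + ((m * 3 + 5 + n * (n * 7 + N * 8 + 12)) +
    (1 + ((seekConst k + 4) * (N * n ^ (k + 1)) + 1)))) ((exec_makeTable (k := k) hI.vars hn).seq ?_)
    ?_ (fun _ h => h)
  swap
  · have e1 : n * ((k + 1) * n ^ k * 7 + 5) = 7 * (k + 1) * n ^ (k + 1) + 5 * n := by ring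
    have e2 : 7 * (k + 1) * n ^ (k + 1) ≤ 7 * (k + 1) * (N * n ^ (k + 1)) :=
      Nat.mul_le_mul_left _ (by omega)
    rw [e1]
    nlinarith
  rintro s1 ⟨cand, M, hT, hM0⟩ f1
  have hM : M ≤ (k + 1) * n ^ k := le_of_injOn_small hT.isTable.1
    (fun x hx => (hT.isTable.2 _).2 ⟨x, hx, rfl⟩) hn
  have in1 : Input n m N cl s1 := hI.congr (f1 _ rfl) (f1 _ rfl) (f1 _ rfl) (f1 _ rfl)
  refine (exec_findLayers in1 hd hne).seq ?_
  rintro s2 ⟨hL, hlv⟩ f2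
  refine (exec_straight (p := setScal aI (.const 0)) rfl s2).seq ?_
  intro s3 p3 f3
  set d : Data := ⟨k, n, m, N, M, cl, cand, s2 aLv⟩ with hdd
  have hok : d.Ok := ⟨hk, hL, hT.isTable⟩
  have st3 : d.Stored s3 :=
    ⟨in1.congr (by rw [f3 _ rfl, f2 _ rfl]) (by rw [f3 _ rfl, f2 _ rfl])
      (by rw [f3 _ rfl, f2 _ rfl]) (by rw [f3 _ rfl, f2 _ rfl]),
    hT.congr (by rw [f3 _ rfl, f2 _ rfl]) (by rw [f3 _ rfl, f2 _ rfl])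
      (by rw [f3 _ rfl, f2 _ rfl]), f3 _ rfl⟩
  have a3 : d.At [] s3 := ⟨st3, trivial, by rw [p3]; simp, Nat.zero_le _, trivial⟩
  refine ((a3.exec_descend hok).mono (d.descendTime_le hn hnN hmN hM) (fun _ h => h)).seq ?_
  rintro s4 ⟨st, q1, q2, q3⟩ f4
  refine (exec_straight (p := setScal aDone (.const 0)) rfl s4).frame.mono le_rfl ?_
  rintro s5 ⟨p5, f5⟩
  refine ⟨M, cand, s2 aLv, st, hok, hM, hlv, q1.of_frame f5 rfl rfl rfl, q2, by rw [p5]; simp, ?_⟩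
  rw [← q3]
  simp [Data.leavesFrom, Data.laterLeaves, later]
  rfl

theorem AllOccur.le_length {φ : MonotoneCNF n} (h : AllOccur φ) : n ≤ length φ := by
  have h1 : (Finset.univ : Finset (Fin n)) ⊆ φ.biUnion id := by
    intro v _
    obtain ⟨c, hc, hv⟩ := h v
    exact Finset.mem_biUnion.2 ⟨c, hc, hv⟩
  calc n = (Finset.univ : Finset (Fin n)).card := by simp
    _ ≤ _ := Finset.card_le_card h1
    _ ≤ _ := Finset.card_biUnion_le

theorem Lists.length_le {φ : MonotoneCNF n} {L : List (List (Fin n))} (hL : Lists L φ)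
    (hne : ∀ C ∈ φ, C.Nonempty) : L.length ≤ length φ := by
  have h1 : L.length = φ.card := by
    rw [← hL.2.2, List.toFinset_card_of_nodup hL.2.1, List.length_map]
  rw [h1, Finset.card_eq_sum_ones, length]
  exact Finset.sum_le_sum fun C hC => Finset.card_pos.2 (hne C hC)

/-- A bound for the delay, in units of `N * n ^ (k + 1)`. -/
def delayConst (k : ℕ) : ℕ := 3 * seekConst k + 12 * k + 150

/-- Without variables there are two CNFs. With no clause the dual is constantly false and its prime
CNF is the empty clause, output as an empty item; with the empty clause the dual is constantly true
and nothing is output. -/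
theorem dualize_zero {φ : MonotoneCNF n} {L : List (List (Fin n))} {σ σ' : Memory}
    {tr : List Event} {b : ℕ} (hn : n = 0) (hL : Lists L φ) (hv : σ' aIn 0 = n)
    (hc : σ' aIn 1 = L.length) (hr : Run parse σ σ' tr) (hs : ∀ e ∈ tr, e = .silent)
    (ht : tr.length ≤ L.length * (n * 6 + 6) + 4) :
    ∃ (σ' : Memory) (tr : List Event) (ψ : MonotoneCNF n) (out : List (List (Fin n))),
      Run (dualize k) σ σ' tr ∧ IsPrimeCNFOf ψ (dual (cnfFn φ)) ∧ Lists out ψ ∧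
      OutputsWithDelay (delayConst k * (b + 1)) tr (out.map (fun l => l.map Fin.val)) := by
  subst hn
  have hD : 150 * 1 ≤ delayConst k * (b + 1) :=
    Nat.mul_le_mul (by rw [delayConst]; omega) (by omega)
  have hss := silent_append (silent_append hs)
  have hz : ¬ (Test.lt (.const 0) numVars).eval σ' = true := by
    rw [eval_lt, numVars_eval, hv]; simp [Expr.eval]
  rw [Bool.not_eq_true] at hz
  rcases Nat.eq_zero_or_pos L.length with h0 | h0
  · have hφ : ∀ C, C ∉ φ := fun C hC => by
      obtain ⟨c, hcl, -⟩ := hL.mem.1 hC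
      omega
    refine ⟨σ', _, {∅}, [[]], .seq hr (.ite_false hz (.ite_true ?_ (.endItem σ'))),
      isPrimeCNFOf_dual fun c => ?_, ⟨by simp, by simp, by simp⟩, ?_⟩
    · rw [eval_eq, numClauses_eval, hc, h0]; rfl
    · rw [Subsingleton.elim c ∅]
      simp only [Finset.mem_singleton, true_iff]
      exact ⟨fun C hC => absurd hC (hφ C), by simp⟩
    · have := (outputsWithDelay_nil (D := delayConst k * (b + 1)) (tr := []) (by simp)
        (by simp)).cons (not_mem_silent hss) (by simp; omega)
      rw [symbols_silent hss] at this
      simpa using this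
  · have h1 : L.length = 1 := by
      by_contra h1
      have := hL.inj (c := 0) (c' := 1) (by omega) (by omega) (Subsingleton.elim _ _)
      omega
    refine ⟨σ', _, ∅, [], .seq hr (.ite_false hz (.ite_false ?_ (.skip σ'))),
      isPrimeCNFOf_dual fun c => ?_, ⟨by simp, by simp, by simp⟩, ?_⟩
    · rw [← Bool.not_eq_true, eval_eq, numClauses_eval, hc, h1]; simp [Expr.eval]
    · simp only [Finset.notMem_empty, false_iff]
      intro h
      obtain ⟨v, -⟩ := h.1 _ (hL.mem.2 ⟨0, h0, rfl⟩)
      exact v.elim0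
    · refine outputsWithDelay_nil ?_ ?_
      · simpa using silent_append hss
      · simp; omega

theorem dualize_correct {φ : MonotoneCNF n} (hk : 1 ≤ k) (hφ : IsPrime φ) (ha : AllOccur φ)
    (hd : IsDegenerate k φ) :
    DualizesWithDelay (dualize k) φ (delayConst k * (length φ * n ^ (k + 1) + 1)) := by
  classical
  intro L hL
  set Ls := L.map (fun l => l.map Fin.val) with hLs
  have hLl : Ls.length = L.length := by simp [hLs]
  have hmemLs : ∀ l ∈ Ls, ∃ l' ∈ L, l = l'.map Fin.val := by
    intro l hl
    obtain ⟨l', h1, rfl⟩ := List.mem_map.1 hl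
    exact ⟨l', h1, rfl⟩
  have hlen : ∀ l ∈ Ls, l.length ≤ n := by
    intro l hl
    obtain ⟨l', h1, rfl⟩ := hmemLs l hl
    rw [List.length_map, ← List.toFinset_card_of_nodup (hL.1 l' h1)]
    exact (Finset.card_le_univ _).trans (by simp)
  have henc : encode L = n :: Ls.length :: Ls.flatMap (fun l => l.length :: l) := by
    simp [encode, hLs, List.flatMap_map]
  obtain ⟨s1, t1, r1, e1, l1, q1, f1⟩ := (exec_parse (n := n) (Ls := Ls)
    (σ := initial (encode L)) (fun i => by simp [initial, henc]) hlen).frame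
  have hv : s1 aIn 0 = n := by rw [f1 _ rfl]; simp [initial, henc]
  have hc : s1 aIn 1 = L.length := by rw [f1 _ rfl]; simp [initial, henc, hLl]
  have hψ : ∀ c, c ∈ Finset.univ.filter (fun c => IsMinTransversal φ c) ↔ IsMinTransversal φ c :=
    fun c => by simp
  rcases Nat.lt_or_ge n 1 with hn0 | hn
  · exact dualize_zero (Nat.lt_one_iff.1 hn0) hL hv hc r1 e1 (l1.trans (by rw [hLl]))
  have hne : ∀ C ∈ φ, C.Nonempty := fun C hC => hφ.nonempty ha hn hC
  set N := length φ with hN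
  have hnN : n ≤ N := ha.le_length
  have hmN : L.length ≤ N := hL.length_le hne
  have in1 : Input n L.length N (clauseOf L) s1 := by
    have := q1.input hv (hc.trans hLl.symm) ?_ ?_
    · rw [hLl] at this
      rw [hN, ← hL.length_eq]
      exact this
    · intro l hl v hvl
      obtain ⟨l', h1, rfl⟩ := hmemLs l hl
      obtain ⟨u, -, rfl⟩ := List.mem_map.1 hvl
      exact u.isLt
    · intro l hl
      obtain ⟨l', h1, rfl⟩ := hmemLs l hl
      exact (hL.1 l' h1).map Fin.val_injective
  have hne' : ∀ c < L.length, (clauseOf L c).Nonempty := by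
    intro c hcl
    obtain ⟨v, hv⟩ := hne _ (hL.mem.2 ⟨c, hcl, rfl⟩)
    exact ⟨v, (val_mem_clauseOf hcl).2 hv⟩
  obtain ⟨s2, t2, r2, e2, l2, M, cand, lv, st, hok, hM, hlv, hat, hst, hdone, hleaves⟩ :=
    exec_prepare in1 hk hn hnN hmN (hL.lowDegree hd hne) hne'
  set d : Data := ⟨k, n, L.length, N, M, clauseOf L, cand, lv⟩ with hdd
  set B := N * n ^ (k + 1) with hB
  have hB1 : 1 * 1 ≤ B := Nat.mul_le_mul (hn.trans hnN) (Nat.one_le_pow _ _ hn)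
  -- Parsing is bounded by a multiple of `L.length * n`, which is at most `N * n` and hence at most
  -- `B`.
  have hnB : N * n ≤ B := Nat.mul_le_mul_left _ (by
    rw [pow_succ]; exact Nat.le_mul_of_pos_left _ (Nat.pow_pos hn))
  have hnN' : 1 * n ≤ N * n := Nat.mul_le_mul_right _ (hn.trans hnN)
  have hmn : L.length * n ≤ N * n := Nat.mul_le_mul_right _ hmN
  have hNn : N * 1 ≤ N * n := Nat.mul_le_mul_left _ hn
  -- The same `T` has to bound a move between leaves and, for the first item, parsing together with
  -- the preparation; `delayConst` adds the cost of writing one item.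
  have hnext : d.nextTime ≤ (3 * seekConst k + 7 * k + 100) * (B + 1) := by
    have h1 : d.nextTime ≤ (2 * seekConst k + 11) * B := d.nextTime_le hn hnN hmN hM
    nlinarith [Nat.zero_le (seekConst k)]
  have hdelay : (3 * seekConst k + 7 * k + 100) * (B + 1) + d.outputTime + 2 ≤
      delayConst k * (B + 1) := by
    have h1 : d.outputTime = n * 7 + n * (k * 5 + 5) + 6 := rfl
    have h2 : n * (k * 5 + 5) ≤ B * (k * 5 + 5) := Nat.mul_le_mul_right _ (by omega)
    rw [h1, delayConst]
    nlinarith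
  obtain ⟨s3, t3, r3, k3⟩ := hat.run_enumerate hok
    (D := delayConst k * (B + 1)) (T := (3 * seekConst k + 7 * k + 100) * (B + 1))
    hnext hdelay _ hst hdone rfl
  have hruns : Run (dualize k) (initial (encode L)) s3 (t1 ++ (.silent :: (t2 ++ t3))) :=
    .seq r1 (.ite_true (by rw [eval_lt, numVars_eval, hv]; exact hn) (.seq r2 r3))
  have hpre := k3 (t1 ++ (.silent :: t2)) (by
      intro e he
      rcases List.mem_append.1 he with he | he
      · exact e1 e he
      · rcases List.mem_cons.1 he with he | he
        exacts [he, e2 e he]) (by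
      have h1 : L.length * (n * 6 + 6) + 4 ≤ 16 * B := by nlinarith
      rw [hLl] at l1
      rw [List.length_append, List.length_cons]
      nlinarith [Nat.zero_le (seekConst k)])
  set out : List (List (Fin n)) := (leaves M (Child L.length (clauseOf L) lv cand) n []).map
    (fun st => (List.finRange n).filter (fun v => v.val ∈ setOf cand st)) with hout
  have hitems : (st :: d.laterLeaves st).map d.item = out.map (fun l => l.map Fin.val) := by
    rw [← hleaves, hout, List.map_map]
    refine List.map_congr_left fun st _ => ?_
    rw [Data.item, ← List.map_coe_finRange_eq_range, List.filter_map]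
    rfl
  have himg : ∀ st, setOf cand st ⊆ Finset.range n →
      ((List.finRange n).filter (fun v => v.val ∈ setOf cand st)).toFinset.image Fin.val =
        setOf cand st := by
    intro st hst
    ext v
    simp only [Finset.mem_image, List.mem_toFinset, List.mem_filter, List.mem_finRange, true_and,
      decide_eq_true_eq]
    constructor
    · rintro ⟨u, hu, rfl⟩; exact hu
    · exact fun h => ⟨⟨v, Finset.mem_range.1 (hst h)⟩, h, rfl⟩
  have hmem : ∀ st, st ∈ leaves M (Child L.length (clauseOf L) lv cand) n [] ↔
      st.length = n ∧ ValidNode M (Child L.length (clauseOf L) lv cand) st := by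
    intro st
    rw [mem_leaves (show ValidNode M _ [] from trivial)]
    simp
  refine ⟨s3, _, _, out, hruns, isPrimeCNFOf_dual hψ, ⟨?_, ?_, ?_⟩, ?_⟩
  · intro l hl
    obtain ⟨st, -, rfl⟩ := List.mem_map.1 hl
    exact (List.nodup_finRange n).filter _
  -- No repetition: distinct leaves are distinct nodes of equal depth and so have distinct sets.
  · rw [hout, List.map_map]
    refine nodup_leaves.map_on fun st h st' h' he => ?_
    rw [hmem] at h h'
    refine setOf_injective hok.isTable h.2 h'.2 (h.1.trans h'.1.symm) ?_
    rw [← himg st (setOf_subset hok.isTable h.2), ← himg st' (setOf_subset hok.isTable h'.2)]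
    exact congrArg _ he
  · ext c
    rw [hψ, List.mem_toFinset, hout, List.map_map, List.mem_map, ← hL.minTr_iff hlv]
    constructor
    · rintro ⟨st, h, rfl⟩
      rw [hmem] at h
      rw [Function.comp_apply, himg st (setOf_subset hok.isTable h.2)]
      have := h.2.minTr
      rwa [h.1] at this
    -- Completeness: every minimal transversal is the set of a node at depth `n`.
    · intro h
      obtain ⟨st, h1, h2, h3⟩ := exists_node hok.layered hok.isTable le_rfl (by
        intro v hv
        obtain ⟨u, -, rfl⟩ := Finset.mem_image.1 hv
        exact Finset.mem_range.2 u.isLt) h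
      refine ⟨st, (hmem st).2 ⟨h1, h2⟩, Finset.image_injective Fin.val_injective ?_⟩
      rw [Function.comp_apply, himg st (setOf_subset hok.isTable h2), h3]
  · rw [← hitems]
    simpa using hpre

end
end Dualization

theorem mainTheorem7 (k : ℕ) (hk : 1 ≤ k) :
    ∃ (p : Dualization.Program) (C : ℕ),
      ∀ (n : ℕ) (φ : Dualization.MonotoneCNF n),
        Dualization.IsPrime φ → Dualization.AllOccur φ → Dualization.IsDegenerate k φ →
          Dualization.DualizesWithDelay p φ
            (C * (Dualization.length φ * n ^ (k + 1) + 1)) :=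
  ⟨Dualization.dualize k, Dualization.delayConst k, fun _ _ h1 h2 h3 =>
    Dualization.dualize_correct hk h1 h2 h3⟩
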